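/- Consider the following problem. An instance $(B,\mathcal R,k)$ consists of a box $B=[0,N_1]\times[0,N_2]$ with positive integers $N_1,N_2$, a finite collection $\mathcal R$ of items (distinct items may have equal dimensions), each item $R$ having a positive integer width $w(R)$ and a positive integer height $h(R)$, and an integer $k\ge 0$. Write $\|B\|=N_1+N_2$. An item is wide if $w(R)\ge h(R)$. A packing of size $m$ is a choice of $m$ items from $\mathcal R$ together with, for each chosen item $R$, a placement $[x,x+w(R)]\times[y,y+h(R)]\subseteq B$ with $(x,y)\in\mathbb Z^2$ (no rotation), such that the interiors of the placements of different chosen items are disjoint. There are a deterministic algorithm $\mathscr A$ and constants $C,c>0$ such that the following holds. The input of $\mathscr A$ is a rational accuracy $\varepsilon=p/q>0$, given by positive integers $p,q$, and an instance $(B,\mathcal R,k)$ in which every item is wide. If $\alpha\ge 1$ is a real number such that every item has width at least $N_1/\alpha$, then $\mathscr A$ halts after at most $$C\cdot\left(k+\tfrac1\varepsilon\right)^{c\,(k+1/\varepsilon)}\cdot\alpha^{c\,k}\cdot\bigl(\max(|\mathcal R|,1)\cdot\|B\|\bigr)^{c/\varepsilon^2}$$ steps, and it either returns a packing of size at least $(1-\varepsilon)k$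 or correctly reports that there is no packing of size $k$. ($\alpha$ is not part of the input.) Steps are counted on a random access machine holding natural numbers, in which every memory access, addition, truncated subtraction and test costs one step; each input number occupies one memory cell. -/

import Mathlib

/-! ### A random access machine with unit cost

Programs have finitely many registers and finitely many unbounded arrays, all holding natural
numbers, with indirect addressing through array indices. The only arithmetic operations are
addition and truncated subtraction. Every operation, memory access and test costs one step. -/

namespace RAM

/-- The store: registers `reg r` and array cells `arr a i`. -/
structure State where
  reg : ℕ → ℕ
  arr : ℕ → ℕ → ℕ

/-- Expressions: constants, registers, reads of a cell of an array, sums, truncated differences. -/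
inductive Expr where
  | lit (n : ℕ)
  | reg (r : ℕ)
  | arr (a : ℕ) (i : Expr)
  | add (e f : Expr)
  | sub (e f : Expr)

def Expr.eval (s : State) : Expr → ℕ
  | .lit n => n
  | .reg r => s.reg r
  | .arr a i => s.arr a (i.eval s)
  | .add e f => e.eval s + f.eval s
  | .sub e f => e.eval s - f.eval s

/-- The number of steps needed to evaluate an expression: one for each of its nodes. -/
def Expr.cost : Expr → ℕ
  | .lit _ => 1
  | .reg _ => 1
  | .arr _ i => i.cost + 1
  | .add e f => e.cost + f.cost + 1
  | .sub e f => e.cost + f.cost + 1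

/-- Programs. A test `e` succeeds if the value of `e` is not `0`. -/
inductive Prog where
  | skip
  | set (r : ℕ) (e : Expr)
  | store (a : ℕ) (i e : Expr)
  | seq (P Q : Prog)
  | branch (e : Expr) (P Q : Prog)
  | loop (e : Expr) (P : Prog)

/-- Assignment of `v` to register `r`. -/
def State.setReg (s : State) (r v : ℕ) : State :=
  { s with reg := Function.update s.reg r v }

/-- Assignment of `v` to cell `i` of array `a`. -/
def State.setArr (s : State) (a i v : ℕ) : State :=
  { s with arr := Function.update s.arr a (Function.update (s.arr a) i v) }

/-- `Exec P s s' t`: started in the store `s`, the program `P` halts after exactly `t` steps, and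
its final store is `s'`. -/
inductive Exec : Prog → State → State → ℕ → Prop where
  | skip (s : State) : Exec .skip s s 1
  | set (r : ℕ) (e : Expr) (s : State) :
      Exec (.set r e) s (s.setReg r (e.eval s)) (e.cost + 1)
  | store (a : ℕ) (i e : Expr) (s : State) :
      Exec (.store a i e) s (s.setArr a (i.eval s) (e.eval s)) (i.cost + e.cost + 1)
  | seq {P Q : Prog} {s s' s'' : State} {t u : ℕ} (hP : Exec P s s' t) (hQ : Exec Q s' s'' u) :
      Exec (.seq P Q) s s'' (t + u)
  | branch_true {e : Expr} {P Q : Prog} {s s' : State} {t : ℕ} (he : e.eval s ≠ 0)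
      (hP : Exec P s s' t) : Exec (.branch e P Q) s s' (e.cost + 1 + t)
  | branch_false {e : Expr} {P Q : Prog} {s s' : State} {t : ℕ} (he : e.eval s = 0)
      (hQ : Exec Q s s' t) : Exec (.branch e P Q) s s' (e.cost + 1 + t)
  | loop_true {e : Expr} {P : Prog} {s s' s'' : State} {t u : ℕ} (he : e.eval s ≠ 0)
      (hP : Exec P s s' t) (hL : Exec (.loop e P) s' s'' u) :
      Exec (.loop e P) s s'' (e.cost + 1 + t + u)
  | loop_false {e : Expr} {P : Prog} {s : State} (he : e.eval s = 0) :
      Exec (.loop e P) s s (e.cost + 1)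

/-- The machine is deterministic: the final store and the number of steps are determined by the
program and the initial store. -/
theorem Exec.deterministic {P : Prog} {s s₁ s₂ : State} {t₁ t₂ : ℕ}
    (h₁ : Exec P s s₁ t₁) (h₂ : Exec P s s₂ t₂) : s₁ = s₂ ∧ t₁ = t₂ := by
  induction h₁ generalizing s₂ t₂ with
  | skip s => cases h₂; exact ⟨rfl, rfl⟩
  | set r e s => cases h₂; exact ⟨rfl, rfl⟩
  | store a i e s => cases h₂; exact ⟨rfl, rfl⟩
  | seq _ _ ihP ihQ =>
    cases h₂ with
    | seq hP hQ =>
      obtain ⟨rfl, rfl⟩ := ihP hP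
      obtain ⟨rfl, rfl⟩ := ihQ hQ
      exact ⟨rfl, rfl⟩
  | branch_true he _ ih =>
    cases h₂ with
    | branch_true _ hP =>
      obtain ⟨rfl, rfl⟩ := ih hP
      exact ⟨rfl, rfl⟩
    | branch_false he' _ => exact absurd he' he
  | branch_false he _ ih =>
    cases h₂ with
    | branch_true he' _ => exact absurd he he'
    | branch_false _ hQ =>
      obtain ⟨rfl, rfl⟩ := ih hQ
      exact ⟨rfl, rfl⟩
  | loop_true he _ _ ihP ihL =>
    cases h₂ with
    | loop_true _ hP hL =>
      obtain ⟨rfl, rfl⟩ := ihP hP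
      obtain ⟨rfl, rfl⟩ := ihL hL
      exact ⟨rfl, rfl⟩
    | loop_false he' => exact absurd he' he
  | loop_false he =>
    cases h₂ with
    | loop_true he' _ _ => exact absurd he he'
    | loop_false _ => exact ⟨rfl, rfl⟩

end RAM

/-! ### Two-dimensional knapsack -/

namespace Knapsack

/-- A rectangle: a pair of positive integers, its width and its height. -/
structure Rectangle where
  w : ℕ
  h : ℕ
  w_pos : 0 < w
  h_pos : 0 < h

/-- A rectangle is wide if its width is at least its height. -/
def Rectangle.IsWide (R : Rectangle) : Prop := R.h ≤ R.w

/-- The placement `[x, x + w] × [y, y + h]` of a rectangle with bottom-left corner `(x, y) ∈ ℤ²`. -/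
def Rectangle.placed (R : Rectangle) (p : ℤ × ℤ) : Set (ℝ × ℝ) :=
  Set.Icc (p.1 : ℝ) ((p.1 : ℝ) + (R.w : ℝ)) ×ˢ Set.Icc (p.2 : ℝ) ((p.2 : ℝ) + (R.h : ℝ))

/-- The interior `(x, x + w) × (y, y + h)` of the placement at `(x, y)`. -/
def Rectangle.placedInterior (R : Rectangle) (p : ℤ × ℤ) : Set (ℝ × ℝ) :=
  Set.Ioo (p.1 : ℝ) ((p.1 : ℝ) + (R.w : ℝ)) ×ˢ Set.Ioo (p.2 : ℝ) ((p.2 : ℝ) + (R.h : ℝ))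

/-- An instance: a box `[0, N₁] × [0, N₂]` with positive integer sides, a finite collection of
items (distinct items may have the same dimensions), and the sought size `k`. -/
structure Instance where
  N₁ : ℕ
  N₂ : ℕ
  N₁_pos : 0 < N₁
  N₂_pos : 0 < N₂
  numItems : ℕ
  item : Fin numItems → Rectangle
  k : ℕ

def Instance.box (I : Instance) : Set (ℝ × ℝ) :=
  Set.Icc (0 : ℝ) (I.N₁ : ℝ) ×ˢ Set.Icc (0 : ℝ) (I.N₂ : ℝ)

/-- The size of the box. -/
def Instance.boxSize (I : Instance) : ℕ := I.N₁ + I.N₂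

/-- Placing every item `i ∈ S` with its bottom-left corner at `pos i` is a packing of the set `S`
of items in the box: the placed items lie in the box, and no two of them overlap. -/
structure Instance.IsPacking (I : Instance) (S : Finset (Fin I.numItems))
    (pos : Fin I.numItems → ℤ × ℤ) : Prop where
  subset_box : ∀ i ∈ S, (I.item i).placed (pos i) ⊆ I.box
  no_overlap : ∀ i ∈ S, ∀ j ∈ S, i ≠ j →
    Disjoint ((I.item i).placedInterior (pos i)) ((I.item j).placedInterior (pos j))

/-- There is a packing of exactly `m` of the items. -/
def Instance.HasPackingOfSize (I : Instance) (m : ℕ) : Prop :=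
  ∃ (S : Finset (Fin I.numItems)) (pos : Fin I.numItems → ℤ × ℤ), I.IsPacking S pos ∧ S.card = m

/-- The input of the machine, for the accuracy `ε = p / q`. Registers `0, …, 5` hold `p`, `q`, `N₁`,
`N₂`, `k` and the number of items, arrays `0` and `1` hold the widths and the heights of the items,
and everything else is `0`. -/
def Instance.input (I : Instance) (p q : ℕ) : RAM.State where
  reg r := match r with
    | 0 => p
    | 1 => q
    | 2 => I.N₁
    | 3 => I.N₂
    | 4 => I.k
    | 5 => I.numItems
    | _ => 0
  arr a i := if hi : i < I.numItems then
      match a with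
      | 0 => (I.item ⟨i, hi⟩).w
      | 1 => (I.item ⟨i, hi⟩).h
      | _ => 0
    else 0

/-- The final store `s` reports that there is no packing of size `k`: register `0` holds `0`. -/
def ReportsNone (s : RAM.State) : Prop := s.reg 0 = 0

/-- The final store `s` returns the set of items `S`, placed according to `pos`: register `0`
holds `1`, register `1` holds the number `m` of items in `S`, and cells `0, …, m - 1` of the arrays
`2`, `3` and `4` list the elements of `S`, each exactly once, with the two coordinates of their
positions. -/
def Returns (I : Instance) (s : RAM.State) (S : Finset (Fin I.numItems))
    (pos : Fin I.numItems → ℤ × ℤ) : Prop :=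
  s.reg 0 = 1 ∧ ∃ e : Fin (s.reg 1) ≃ {i // i ∈ S}, ∀ j : Fin (s.reg 1),
    s.arr 2 j = ((e j : Fin I.numItems) : ℕ) ∧
    ((s.arr 3 j : ℕ) : ℤ) = (pos (e j)).1 ∧
    ((s.arr 4 j : ℕ) : ℤ) = (pos (e j)).2

end Knapsack

/-!
Why there is such an algorithm. Let `T` be about `5 / ε`, so that `ε k` items may be deleted from a
packing of `k` wide items, and let `ρ` be a little less than half of the smallest width.

*Structure of packings.* All rectangles are enlarged by `ρ` to both sides, and grouped into levels
(`Layout.level`): a rectangle belongs to the next level if, in some column, it starts below the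
envelope of the present levels or is a lowest one among those that rise above it. The upper
envelopes of the levels are monotone, and every rectangle outside the first `t + 1` levels lies
above the envelope of the first `t` of them. A *chain* is a sequence of rectangles from the left to
the right side of the box that overlap vertically and leave no room for horizontal shifts. By
planarity a chain cannot pass from above a rectangle to below it, and this shows that all chains
between two levels that are `t` levels apart are destroyed by the deletion of `t` rectangles
(`Layout.exists_loose`). A set without chains is *loose*: its rectangles can be shifted by at most
`ρ` such that positions and widths become multiples of a unit `g`, of which only `O(k α)` fit into
the box (`Layout.Loose.exists_rounding`). One chooses a residue class modulo `T` of levels such that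
few rectangles belong to these levels or to the ones directly after them. The levels of the class
with at most `T` rectangles serve as cuts: the rectangles of the next level are deleted, and the
deletions that make the sets between two cuts loose are charged to the levels of the class that are
not cuts. What remains is a union of sets, separated by envelopes of at most `T` rectangles, each of
which is loose or has at most `T ^ 2` elements (`Layout.exists_decomposition`).

*Search.* The items of a solution are assigned to slots, sorted by their sets and by height. One
guesses a hash function that gives the items of the solution different colours
(`exists_hash`), and for every slot the colour, the rounded width and the rounded position of
its item, whether its set is small, and whether a new set begins; there are
`n ^ O(1) (k α) ^ O(k)` guesses. Given the guess, the sets are packed one after the other by a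
search in a graph whose nodes are pairs of a slot and a contour, that is, an envelope of at most `T`
steps. In a small set the items and their positions are chosen exhaustively. In the other ones, each
slot receives an item of least height among those with the guessed colour that are narrow enough for
the guessed width, and it is dropped as far as possible; by induction nothing ends up higher than in
the given packing (`Par.Plan.path`). Hence the search succeeds if there is a packing of size `k`
(`Par.exists_guess`), and whatever it finds is a packing (`Par.Partial.extend`), because colours
tell the items apart and contours separate the sets.

*Machine.* `RAM.PolyTime` and `RAM.PolyDec` are classes of functions and predicates, closed under
bounded recursion, that expressions of the search fall into; they come with programs whose time is
polynomial in a bound for the numbers involved. `RAM.Spec` adds variables, arrays and loops. The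
search takes time polynomial in the number of guesses and in the numbers of nodes and choices
(`exists_program`), which is bounded in `Instance.search_le`.
-/

/-! ### Running programs within a time bound -/

namespace RAM

/-- `Runs P s τ Q`: started in `s`, the program `P` halts within `τ` steps in a store
satisfying `Q`. -/
def Runs (P : Prog) (s : State) (τ : ℕ) (Q : State → Prop) : Prop :=
  ∃ s' t, Exec P s s' t ∧ t ≤ τ ∧ Q s'

theorem Runs.mono {P : Prog} {s : State} {τ τ' : ℕ} {Q Q' : State → Prop}
    (h : Runs P s τ Q) (hτ : τ ≤ τ') (hQ : ∀ s', Q s' → Q' s') : Runs P s τ' Q' := by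
  obtain ⟨s', t, h1, h2, h3⟩ := h
  exact ⟨s', t, h1, h2.trans hτ, hQ _ h3⟩

theorem runs_skip {s : State} {Q : State → Prop} (h : Q s) : Runs .skip s 1 Q :=
  ⟨_, _, .skip s, le_rfl, h⟩

theorem runs_set {r : ℕ} {e : Expr} {s : State} {Q : State → Prop}
    (h : Q (s.setReg r (e.eval s))) : Runs (.set r e) s (e.cost + 1) Q :=
  ⟨_, _, .set r e s, le_rfl, h⟩

theorem runs_store {a : ℕ} {i e : Expr} {s : State} {Q : State → Prop}
    (h : Q (s.setArr a (i.eval s) (e.eval s))) :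
    Runs (.store a i e) s (i.cost + e.cost + 1) Q :=
  ⟨_, _, .store a i e s, le_rfl, h⟩

theorem Runs.seq {P P' : Prog} {s : State} {τ τ' : ℕ} {Q Q' : State → Prop}
    (h : Runs P s τ Q) (h' : ∀ s', Q s' → Runs P' s' τ' Q') :
    Runs (.seq P P') s (τ + τ') Q' := by
  obtain ⟨s', t, h1, h2, h3⟩ := h
  obtain ⟨s'', t', h4, h5, h6⟩ := h' _ h3
  exact ⟨s'', t + t', .seq h1 h4, add_le_add h2 h5, h6⟩

theorem runs_branch {e : Expr} {P P' : Prog} {s : State} {τ : ℕ} {Q : State → Prop}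
    (h : e.eval s ≠ 0 → Runs P s τ Q) (h' : e.eval s = 0 → Runs P' s τ Q) :
    Runs (.branch e P P') s (e.cost + 1 + τ) Q := by
  by_cases he : e.eval s = 0
  · obtain ⟨s', t, h1, h2, h3⟩ := h' he
    exact ⟨s', _, .branch_false he h1, by omega, h3⟩
  · obtain ⟨s', t, h1, h2, h3⟩ := h he
    exact ⟨s', _, .branch_true he h1, by omega, h3⟩

/-- A loop with a known number `n` of iterations, where `I i` holds before iteration `i`. -/
theorem runs_loop {e : Expr} {P : Prog} {τ : ℕ} {I : ℕ → State → Prop} {n : ℕ}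
    (hI : ∀ i < n, ∀ s, I i s → e.eval s ≠ 0 ∧ Runs P s τ (I (i + 1)))
    (hn : ∀ s, I n s → e.eval s = 0) {s : State} (h : I 0 s) :
    Runs (.loop e P) s (n * (e.cost + 1 + τ) + (e.cost + 1)) (I n) := by
  suffices H : ∀ j i s, i + j = n → I i s →
      Runs (.loop e P) s (j * (e.cost + 1 + τ) + (e.cost + 1)) (I n) from H n 0 s (by omega) h
  intro j
  induction j with
  | zero =>
    intro i s hij hi
    obtain rfl : i = n := by omega
    exact ⟨s, _, .loop_false (hn s hi), by omega, hi⟩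
  | succ j ih =>
    intro i s hij hi
    obtain ⟨he, s', t, h1, h2, h3⟩ := hI i (by omega) s hi
    obtain ⟨s'', u, h4, h5, h6⟩ := ih (i + 1) s' (by omega) h3
    refine ⟨s'', _, .loop_true he h1 h4, ?_, h6⟩
    rw [Nat.succ_mul]
    omega

/-! ### Expressions evaluated in polynomial time -/

/-- The memory: the contents of all arrays. -/
abbrev Mem := ℕ → ℕ → ℕ

/-- Sums of powers are absorbed into a higher power; this keeps all time bounds in the form
`X ^ d`. -/
theorem pow_add_pow_le {X a b : ℕ} (hX : 2 ≤ X) : X ^ a + X ^ b ≤ X ^ (a + b + 1) := by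
  have h1 : X ^ a ≤ X ^ (a + b) := Nat.pow_le_pow_right (by omega) (by omega)
  have h2 : X ^ b ≤ X ^ (a + b) := Nat.pow_le_pow_right (by omega) (by omega)
  calc X ^ a + X ^ b ≤ X ^ (a + b) * 2 := by omega
    _ ≤ X ^ (a + b) * X := Nat.mul_le_mul_left _ hX
    _ = X ^ (a + b + 1) := (pow_succ _ _).symm

theorem le_pow_self_of_two_le {X c : ℕ} (hX : 2 ≤ X) : c ≤ X ^ c :=
  (Nat.lt_pow_self (by omega)).le

/-- `PolyTime m f`: the function `f` of an environment and of the memory depends on the first `m`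
variables of the environment only; both its value and the number of steps that a program needs to
compute it are polynomial in an upper bound `X ≥ 2` for these variables. The variables may be kept
in arbitrary registers `ρ i` below `w`; the program leaves the result in register `w`, and changes
neither the registers below `w` nor the memory. -/
structure PolyTime (m : ℕ) (f : (ℕ → ℕ) → Mem → ℕ) : Prop where
  congr : ∀ e e' a, (∀ i < m, e i = e' i) → f e a = f e' a
  bound : ∃ d : ℕ, ∀ e a X, 2 ≤ X → (∀ i < m, e i ≤ X) → f e a ≤ X ^ d
  prog : ∃ d : ℕ, ∀ (ρ : ℕ → ℕ) (w : ℕ), (∀ i < m, ρ i < w) → ∃ P : Prog, ∀ (s : State) (X : ℕ),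
    2 ≤ X → (∀ i < m, s.reg (ρ i) ≤ X) →
      Runs P s (X ^ d) fun s' => s'.reg w = f (fun i => s.reg (ρ i)) s.arr ∧
        (∀ r < w, s'.reg r = s.reg r) ∧ s'.arr = s.arr

namespace PolyTime

variable {m : ℕ} {f g h : (ℕ → ℕ) → Mem → ℕ}

theorem const (c : ℕ) : PolyTime m fun _ _ => c := by
  refine ⟨fun _ _ _ _ => rfl, ⟨c, fun e a X hX _ => le_pow_self_of_two_le hX⟩,
    1, fun ρ w _ => ⟨.set w (.lit c), ?_⟩⟩
  intro s X hX _
  refine (runs_set (r := w) (e := .lit c) ?_).mono ?_ fun s' h => h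
  · refine ⟨by simp [State.setReg, Expr.eval], fun r hr => ?_, rfl⟩
    simp [State.setReg, Function.update_of_ne hr.ne]
  · simpa [Expr.cost] using hX

theorem var {i : ℕ} (hi : i < m) : PolyTime m fun e _ => e i := by
  refine ⟨fun _ _ _ h => h i hi, ⟨1, fun e a X hX h => by simpa using h i hi⟩,
    1, fun ρ w _ => ⟨.set w (.reg (ρ i)), ?_⟩⟩
  intro s X hX _
  refine (runs_set (r := w) (e := .reg (ρ i)) ?_).mono ?_ fun s' h => h
  · refine ⟨by simp [State.setReg, Expr.eval], fun r hr => ?_, rfl⟩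
    simp [State.setReg, Function.update_of_ne hr.ne]
  · simpa [Expr.cost] using hX

/-- Insertion of a new variable `0`. -/
theorem weaken (hf : PolyTime m f) : PolyTime (m + 1) fun e a => f (fun i => e (i + 1)) a := by
  obtain ⟨h1, ⟨d, h2⟩, d', h3⟩ := hf
  refine ⟨fun e e' a h => h1 _ _ a fun i hi => h _ (by omega),
    ⟨d, fun e a X hX h => h2 _ a X hX fun i hi => h _ (by omega)⟩, d', fun ρ w hw => ?_⟩
  obtain ⟨P, hP⟩ := h3 (fun i => ρ (i + 1)) w fun i hi => hw _ (by omega)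
  exact ⟨P, fun s X hX h => hP s X hX fun i hi => h _ (by omega)⟩

/-- Two operands are evaluated one after the other, into the registers `w` and `w + 1`. -/
theorem binary {op : ℕ → ℕ → Mem → ℕ} {E : ℕ → Expr} {c : ℕ} (hf : PolyTime m f)
    (hg : PolyTime m g) (hop : ∀ x y a, op x y a ≤ x + y)
    (hE : ∀ w s, (E w).eval s = op (s.reg w) (s.reg (w + 1)) s.arr)
    (hc : ∀ w, (E w).cost ≤ c) : PolyTime m fun e a => op (f e a) (g e a) a := by
  obtain ⟨f1, ⟨b, f2⟩, d, f3⟩ := hf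
  obtain ⟨g1, ⟨b', g2⟩, d', g3⟩ := hg
  have key : ∀ X, 2 ≤ X → X ^ d + (X ^ d' + (c + 1)) ≤ X ^ (d + (d' + (c + 1) + 1) + 1) := by
    intro X hX
    refine le_trans (Nat.add_le_add_left ?_ _) (pow_add_pow_le hX)
    exact (Nat.add_le_add_left (le_pow_self_of_two_le hX) _).trans (pow_add_pow_le hX)
  refine ⟨fun e e' a h => ?_, ⟨b + b' + 1, fun e a X hX h => ?_⟩, d + (d' + (c + 1) + 1) + 1,
    fun ρ w hw => ?_⟩
  · rw [f1 e e' a h, g1 e e' a h]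
  · exact (hop _ _ _).trans ((add_le_add (f2 e a X hX h) (g2 e a X hX h)).trans
      (pow_add_pow_le hX))
  · obtain ⟨P, hP⟩ := f3 ρ w hw
    obtain ⟨P', hP'⟩ := g3 ρ (w + 1) fun i hi => (hw i hi).trans (Nat.lt_succ_self _)
    refine ⟨.seq P (.seq P' (.set w (E w))), fun s X hX h => ?_⟩
    have hcw := hc w
    refine Runs.mono ((hP s X hX h).seq (τ' := X ^ d' + ((E w).cost + 1)) ?_)
      (by have := key X hX; omega) fun _ h => h
    rintro s1 ⟨r1, r2, r3⟩
    have henv : ∀ i < m, s1.reg (ρ i) = s.reg (ρ i) := fun i hi => r2 _ (hw i hi)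
    refine (hP' s1 X hX fun i hi => by rw [henv i hi]; exact h i hi).seq ?_
    rintro s2 ⟨q1, q2, q3⟩
    refine runs_set ⟨?_, fun r hr => ?_, ?_⟩
    · have e1 := q2 w (by omega)
      have e2 := g1 (fun i => s1.reg (ρ i)) (fun i => s.reg (ρ i)) s.arr henv
      simp only [State.setReg, Function.update_self, hE, q1, e1, r1, q3, r3, e2]
    · simp only [State.setReg, Function.update_of_ne hr.ne]
      rw [q2 r (by omega), r2 r hr]
    · simp [State.setReg, q3, r3]

theorem add (hf : PolyTime m f) (hg : PolyTime m g) : PolyTime m fun e a => f e a + g e a :=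
  binary (op := fun x y _ => x + y) (E := fun w => .add (.reg w) (.reg (w + 1))) (c := 3) hf hg
    (fun _ _ _ => le_rfl) (fun _ _ => rfl) fun _ => le_rfl

theorem sub (hf : PolyTime m f) (hg : PolyTime m g) : PolyTime m fun e a => f e a - g e a :=
  binary (op := fun x y _ => x - y) (E := fun w => .sub (.reg w) (.reg (w + 1))) (c := 3) hf hg
    (fun _ _ _ => by omega) (fun _ _ => rfl) fun _ => le_rfl

/-- A memory access is capped, since nothing is known about the numbers in the memory. -/
theorem read (A : ℕ) (hf : PolyTime m f) (hg : PolyTime m g) :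
    PolyTime m fun e a => min (a A (f e a)) (g e a) :=
  binary (op := fun x y a => min (a A x) y)
    (E := fun w => .sub (.reg (w + 1)) (.sub (.reg (w + 1)) (.arr A (.reg w)))) (c := 6) hf hg
    (fun _ _ _ => by omega) (fun _ _ => by simp only [Expr.eval]; omega)
    fun _ => by simp [Expr.cost]

/-- Bounded recursion, for accumulated values that are known to be polynomially bounded. In the
body, variable `0` is the accumulated value and variable `1` is the index. -/
theorem fold {n init : (ℕ → ℕ) → Mem → ℕ} {body : (ℕ → ℕ) → Mem → ℕ → ℕ → ℕ}
    (hn : PolyTime m n) (hi : PolyTime m init)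
    (hb : PolyTime (m + 2) fun e a => body (fun i => e (i + 2)) a (e 1) (e 0))
    (hB : ∃ d, ∀ e a X, 2 ≤ X → (∀ i < m, e i ≤ X) → ∀ j ≤ n e a,
      Nat.rec (motive := fun _ => ℕ) (init e a) (body e a) j ≤ X ^ d) :
    PolyTime m fun e a => Nat.rec (motive := fun _ => ℕ) (init e a) (body e a) (n e a) := by
  obtain ⟨n1, ⟨dn', n2⟩, dn, n3⟩ := hn
  obtain ⟨i1, -, di, i3⟩ := hi
  obtain ⟨b1, -, db, b3⟩ := hb
  obtain ⟨dB, hB⟩ := hB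
  have bloc : ∀ e e' a i x, (∀ i < m, e i = e' i) → body e a i x = body e' a i x := by
    intro e e' a i x h
    refine b1 (fun j => if j = 0 then x else if j = 1 then i else e (j - 2))
      (fun j => if j = 0 then x else if j = 1 then i else e' (j - 2)) a fun j hj => ?_
    rcases j with _ | _ | j
    · rfl
    · rfl
    · simpa using h j (by omega)
  let D := dn' + dB + 1
  let d := dn + (di + (dn' + D * db + 30) + 30) + 30
  have hDn : ∀ X, 2 ≤ X → X ^ dn' ≤ X ^ D := fun X hX =>
    Nat.pow_le_pow_right (by omega) (by simp only [D]; omega)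
  have hDB : ∀ X, 2 ≤ X → X ^ dB ≤ X ^ D := fun X hX =>
    Nat.pow_le_pow_right (by omega) (by simp only [D]; omega)
  have hD1 : ∀ X, 2 ≤ X → X ≤ X ^ D := fun X hX => by
    calc X = X ^ 1 := (pow_one X).symm
      _ ≤ X ^ D := Nat.pow_le_pow_right (by omega) (by simp only [D]; omega)
  have htime : ∀ X N, 2 ≤ X → N ≤ X ^ dn' →
      X ^ dn + (X ^ di + (2 + ((N * (4 + ((X ^ D) ^ db + 6)) + 4) + 2))) ≤ X ^ d := by
    intro X N hX hN
    have hp := fun a b => pow_add_pow_le (X := X) (a := a) (b := b) hX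
    have h16 : 16 ≤ X ^ 4 := by
      calc 16 = 2 ^ 4 := rfl
        _ ≤ X ^ 4 := Nat.pow_le_pow_left hX 4
    have e1 : 4 + ((X ^ D) ^ db + 6) ≤ X ^ (D * db + 5) := by
      rw [← pow_mul]
      calc 4 + (X ^ (D * db) + 6) ≤ X ^ (D * db) + X ^ 4 := by omega
        _ ≤ X ^ (D * db + 5) := hp _ _
    have e2 : N * (4 + ((X ^ D) ^ db + 6)) ≤ X ^ (dn' + D * db + 5) := by
      calc _ ≤ X ^ dn' * X ^ (D * db + 5) := Nat.mul_le_mul hN e1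
        _ = _ := by rw [← pow_add]; congr 1
    have e3 : 2 + ((N * (4 + ((X ^ D) ^ db + 6)) + 4) + 2) ≤ X ^ (dn' + D * db + 30) := by
      calc _ ≤ X ^ (dn' + D * db + 5) + X ^ 4 := by omega
        _ ≤ X ^ (dn' + D * db + 5 + 4 + 1) := hp _ _
        _ ≤ _ := Nat.pow_le_pow_right (by omega) (by omega)
    have e4 : X ^ di + (2 + ((N * (4 + ((X ^ D) ^ db + 6)) + 4) + 2)) ≤
        X ^ (di + (dn' + D * db + 30) + 1) := (Nat.add_le_add_left e3 _).trans (hp _ _)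
    refine (Nat.add_le_add_left e4 _).trans ((hp _ _).trans ?_)
    exact Nat.pow_le_pow_right (by omega) (by simp only [d]; omega)
  refine ⟨fun e e' a h => ?_, ⟨dB, fun e a X hX h => hB e a X hX h _ le_rfl⟩, d,
    fun ρ w hw => ?_⟩
  · have : body e a = body e' a := by
      funext i x; exact bloc e e' a i x h
    rw [n1 e e' a h, i1 e e' a h, this]
  · obtain ⟨Pn, hPn⟩ := n3 ρ w hw
    obtain ⟨Pi, hPi⟩ := i3 ρ (w + 1) fun i hi => (hw i hi).trans (Nat.lt_succ_self _)
    let σ : ℕ → ℕ := fun j => if j = 0 then w + 1 else if j = 1 then w + 2 else ρ (j - 2)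
    have hσ : ∀ i < m + 2, σ i < w + 3 := by
      intro i hi
      rcases i with _ | _ | i
      · simp [σ]
      · simp [σ]
      · have := hw i (by omega)
        simp only [σ]
        simp
        omega
    obtain ⟨Pb, hPb⟩ := b3 σ (w + 3) hσ
    let step : Prog := .seq Pb (.seq (.set (w + 1) (.reg (w + 3)))
      (.set (w + 2) (.add (.reg (w + 2)) (.lit 1))))
    refine ⟨.seq Pn (.seq Pi (.seq (.set (w + 2) (.lit 0))
      (.seq (.loop (.sub (.reg w) (.reg (w + 2))) step) (.set w (.reg (w + 1)))))), ?_⟩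
    intro s X hX h
    set E : ℕ → ℕ := fun i => s.reg (ρ i) with hE
    have hN : n E s.arr ≤ X ^ dn' := n2 _ _ _ hX h
    refine Runs.mono ((hPn s X hX h).seq (τ' := X ^ di + (2 + ((n E s.arr *
      (4 + ((X ^ D) ^ db + 6)) + 4) + 2))) ?_) (htime X _ hX hN) fun _ h => h
    rintro s1 ⟨p1, p2, p3⟩
    have he1 : ∀ i < m, s1.reg (ρ i) = s.reg (ρ i) := fun i hi => p2 _ (hw i hi)
    refine (hPi s1 X hX fun i hi => by rw [he1 i hi]; exact h i hi).seq ?_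
    rintro s2 ⟨q1, q2, q3⟩
    rw [i1 _ E _ he1, p3] at q1
    let V : ℕ → ℕ := fun j => Nat.rec (motive := fun _ => ℕ) (init E s.arr) (body E s.arr) j
    let I : ℕ → State → Prop := fun i t => t.reg w = n E s.arr ∧ t.reg (w + 1) = V i ∧
      t.reg (w + 2) = i ∧ (∀ r < w, t.reg r = s.reg r) ∧ t.arr = s.arr
    refine (runs_set (Q := I 0) ?_).seq ?_
    · refine ⟨?_, ?_, ?_, fun r hr => ?_, ?_⟩
      · simp [State.setReg, q2 w (by omega), p1, hE]
      · simp [State.setReg, q1, V]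
      · simp [State.setReg, Expr.eval]
      · have : r ≠ w + 2 := by omega
        simp [State.setReg, this, q2 r (by omega), p2 r hr]
      · simp [State.setReg, q3, p3]
    · intro s3 h3
      refine (runs_loop (I := I) (n := n E s.arr) ?_ ?_ h3).seq ?_
      · rintro i hin t ⟨t1, t2, t3, t4, t5⟩
        refine ⟨by simp only [Expr.eval]; omega, ?_⟩
        have hV : V i ≤ X ^ D := (hB E s.arr X hX h i hin.le).trans (hDB X hX)
        have hiX : i ≤ X ^ D := (hin.le.trans hN).trans (hDn X hX)
        have hXD : 2 ≤ X ^ D := hX.trans (hD1 X hX)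
        refine (hPb t (X ^ D) hXD ?_).seq ?_
        · intro j hj
          rcases j with _ | _ | j
          · simpa [σ, t2] using hV
          · simpa [σ, t3] using hiX
          · have := t4 (ρ j) (hw j (by omega))
            simp only [σ]
            simp only [Nat.add_eq_zero_iff, one_ne_zero, and_false, if_false]
            simp
            rw [this]
            exact (h j (by omega)).trans (hD1 X hX)
        · rintro u ⟨u1, u2, u3⟩
          have hval : u.reg (w + 3) = V (i + 1) := by
            rw [u1, t5]
            simp only [σ]
            simp only [if_true, one_ne_zero, if_false, t2, t3]
            refine bloc _ _ _ _ _ fun j hj => ?_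
            simpa using t4 (ρ j) (hw j hj)
          refine Runs.seq (τ := 2) (τ' := 4) (runs_set (Q := fun u' => u'.reg w = n E s.arr ∧
            u'.reg (w + 1) = V (i + 1) ∧ u'.reg (w + 2) = i ∧ (∀ r < w, u'.reg r = s.reg r) ∧
            u'.arr = s.arr) ?_) ?_
          · refine ⟨?_, ?_, ?_, fun r hr => ?_, ?_⟩
            · simp [State.setReg, u2 w (by omega), t1]
            · simp [State.setReg, Expr.eval, hval]
            · simp [State.setReg, u2 (w + 2) (by omega), t3]
            · have : r ≠ w + 1 := by omega
              simp [State.setReg, this, u2 r (by omega), t4 r hr]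
            · simp [State.setReg, u3, t5]
          · rintro v ⟨v1, v2, v3, v4, v5⟩
            refine runs_set ⟨?_, ?_, ?_, fun r hr => ?_, ?_⟩
            · simp [State.setReg, v1]
            · simp [State.setReg, v2]
            · simp [State.setReg, Expr.eval, v3]
            · have : r ≠ w + 2 := by omega
              simp [State.setReg, this, v4 r hr]
            · simp [State.setReg, v5]
      · rintro t ⟨t1, -, t3, -⟩
        simp only [Expr.eval]
        omega
      · rintro t ⟨t1, t2, t3, t4, t5⟩
        refine runs_set ⟨?_, fun r hr => ?_, ?_⟩
        · simp [State.setReg, Expr.eval, t2, V]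
        · simp [State.setReg, hr.ne, t4 r hr]
        · simp [State.setReg, t5]

end PolyTime

end RAM

/-! ### Arithmetic in polynomial time -/

namespace RAM

/-- The indicator of a proposition. -/
noncomputable def ind (p : Prop) : ℕ := by classical exact if p then 1 else 0

theorem ind_of_true {p : Prop} (h : p) : ind p = 1 := by simp [ind, h]

theorem ind_of_false {p : Prop} (h : ¬p) : ind p = 0 := by simp [ind, h]

theorem ind_eq_zero {p : Prop} : ind p = 0 ↔ ¬p := by simp [ind]

theorem ind_le_one (p : Prop) : ind p ≤ 1 := by
  by_cases h : p <;> simp [ind, h]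

/-- The digit with index `i` of `x` in base `b`. -/
def digit (b x i : ℕ) : ℕ := x / b ^ i % b

namespace PolyTime

variable {m : ℕ} {f g h : (ℕ → ℕ) → Mem → ℕ}

theorem of_eq (hf : PolyTime m f) (h : ∀ e a, g e a = f e a) : PolyTime m g := by
  have : g = f := funext fun e => funext fun a => h e a
  rwa [this]

theorem max (hf : PolyTime m f) (hg : PolyTime m g) :
    PolyTime m fun e a => Max.max (f e a) (g e a) :=
  (hf.add (hg.sub hf)).of_eq fun e a => by omega

theorem min (hf : PolyTime m f) (hg : PolyTime m g) :
    PolyTime m fun e a => Min.min (f e a) (g e a) :=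
  (hf.sub (hf.sub hg)).of_eq fun e a => by omega

/-- Multiplication is repeated addition. -/
theorem mul (hf : PolyTime m f) (hg : PolyTime m g) : PolyTime m fun e a => f e a * g e a := by
  have hrec : ∀ x n : ℕ, Nat.rec (motive := fun _ => ℕ) 0 (fun _ acc => acc + x) n = x * n := by
    intro x n
    induction n with
    | zero => rfl
    | succ n ih => simp only [ih]; ring
  refine (fold (n := g) (init := fun _ _ => 0) (body := fun e a _ acc => acc + f e a) hg (const 0)
    (add (var (by omega)) hf.weaken.weaken) ?_).of_eq fun e a => (hrec _ _).symm
  obtain ⟨d, hd⟩ := hf.bound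
  obtain ⟨d', hd'⟩ := hg.bound
  refine ⟨d + d', fun e a X hX he j hj => ?_⟩
  rw [hrec, pow_add]
  exact Nat.mul_le_mul (hd e a X hX he) (hj.trans (hd' e a X hX he))

/-- The maximum of finitely many values, as many as a polynomially bounded number says. -/
theorem sup {n : (ℕ → ℕ) → Mem → ℕ} {F : (ℕ → ℕ) → Mem → ℕ → ℕ} (hn : PolyTime m n)
    (hF : PolyTime (m + 1) fun e a => F (fun i => e (i + 1)) a (e 0)) :
    PolyTime m fun e a => (Finset.range (n e a)).sup (F e a) := by
  have hrec : ∀ (G : ℕ → ℕ) (n : ℕ), Nat.rec (motive := fun _ => ℕ) 0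
      (fun i acc => Max.max acc (G i)) n = (Finset.range n).sup G := by
    intro G n
    induction n with
    | zero => rfl
    | succ n ih => simp only [ih]; rw [Finset.range_add_one, Finset.sup_insert, max_comm]
  refine (fold (n := n) (init := fun _ _ => 0) (body := fun e a i acc => Max.max acc (F e a i)) hn
    (const 0) (max (var (by omega)) hF.weaken) ?_).of_eq fun e a => (hrec _ _).symm
  obtain ⟨d, hd⟩ := hF.bound
  obtain ⟨d', hd'⟩ := hn.bound
  refine ⟨(d' + 1) * d, fun e a X hX he j hj => ?_⟩
  rw [hrec, Finset.sup_le_iff, pow_mul]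
  intro i hi
  have hX1 : X ≤ X ^ (d' + 1) := Nat.le_self_pow (by omega) X
  refine hd (fun k => if k = 0 then i else e (k - 1)) a (X ^ (d' + 1)) (hX.trans hX1) ?_
  intro k hk
  rcases k with _ | k
  · have := hd' e a X hX he
    have h2 : X ^ d' ≤ X ^ (d' + 1) := Nat.pow_le_pow_right (by omega) (by omega)
    have := Finset.mem_range.1 hi
    simp only [if_true]
    omega
  · simpa using (he k (by omega)).trans hX1

end PolyTime

/-- Predicates decided in polynomial time. -/
def PolyDec (m : ℕ) (p : (ℕ → ℕ) → Mem → Prop) : Prop := PolyTime m fun e a => ind (p e a)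

namespace PolyDec

variable {m : ℕ} {f g : (ℕ → ℕ) → Mem → ℕ} {p q : (ℕ → ℕ) → Mem → Prop}

theorem of_iff (hp : PolyDec m p) (h : ∀ e a, q e a ↔ p e a) : PolyDec m q :=
  hp.of_eq fun e a => by simp only [h e a]

theorem ne_zero (hf : PolyTime m f) : PolyDec m fun e a => f e a ≠ 0 :=
  ((PolyTime.const 1).min hf).of_eq fun e a => by
    by_cases h : f e a = 0
    · simp [ind, h]
    · rw [ind_of_true h]; omega

theorem not (hp : PolyDec m p) : PolyDec m fun e a => ¬p e a :=
  ((PolyTime.const 1).sub hp).of_eq fun e a => by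
    by_cases h : p e a <;> simp [ind, h]

theorem and (hp : PolyDec m p) (hq : PolyDec m q) : PolyDec m fun e a => p e a ∧ q e a :=
  (PolyTime.mul hp hq).of_eq fun e a => by
    by_cases h : p e a <;> by_cases h' : q e a <;> simp [ind, h, h']

theorem imp (hp : PolyDec m p) (hq : PolyDec m q) : PolyDec m fun e a => p e a → q e a :=
  (hp.and hq.not).not.of_iff fun e a => by tauto

theorem le (hf : PolyTime m f) (hg : PolyTime m g) : PolyDec m fun e a => f e a ≤ g e a :=
  (ne_zero (hf.sub hg)).not.of_iff fun e a => by omega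

theorem lt (hf : PolyTime m f) (hg : PolyTime m g) : PolyDec m fun e a => f e a < g e a :=
  (le hg hf).not.of_iff fun e a => by omega

theorem eq (hf : PolyTime m f) (hg : PolyTime m g) : PolyDec m fun e a => f e a = g e a :=
  ((le hf hg).and (le hg hf)).of_iff fun e a => by omega

theorem ne (hf : PolyTime m f) (hg : PolyTime m g) : PolyDec m fun e a => f e a ≠ g e a :=
  (eq hf hg).not

/-- A bounded quantifier holds if the supremum of the indicators of the negations is `0`. -/
theorem all {n : (ℕ → ℕ) → Mem → ℕ} {F : (ℕ → ℕ) → Mem → ℕ → Prop} (hn : PolyTime m n)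
    (hF : PolyDec (m + 1) fun e a => F (fun i => e (i + 1)) a (e 0)) :
    PolyDec m fun e a => ∀ i < n e a, F e a i := by
  refine (ne_zero (PolyTime.sup (F := fun e a i => ind (¬F e a i)) hn hF.not)).not.of_iff
    fun e a => ?_
  rw [not_not, ← Nat.bot_eq_zero, Finset.sup_eq_bot_iff]
  simp [ind_eq_zero]

end PolyDec

namespace PolyTime

variable {m : ℕ} {f g h : (ℕ → ℕ) → Mem → ℕ} {p : (ℕ → ℕ) → Mem → Prop}

theorem ite {inst : ∀ e a, Decidable (p e a)} (hp : PolyDec m p) (hf : PolyTime m f)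
    (hg : PolyTime m g) : PolyTime m fun e a => @ite _ (p e a) (inst e a) (f e a) (g e a) :=
  ((PolyTime.mul hp hf).add (PolyTime.mul ((const 1).sub hp) hg)).of_eq fun e a => by
    by_cases h : p e a <;> simp [ind, h]

/-- A quotient `x / y` is the largest number `q ≤ x` with `y * q ≤ x`, unless `y = 0`. -/
theorem div (hf : PolyTime m f) (hg : PolyTime m g) : PolyTime m fun e a => f e a / g e a := by
  refine (sup (n := fun e a => f e a + 1)
    (F := fun e a q => if g e a ≠ 0 ∧ g e a * q ≤ f e a then q else 0) (hf.add (const 1))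
    (ite ((PolyDec.ne_zero hg.weaken).and (PolyDec.le (hg.weaken.mul (var (by omega)))
      hf.weaken)) (var (by omega)) (const 0))).of_eq fun e a => ?_
  rcases Nat.eq_zero_or_pos (g e a) with h0 | h0
  · rw [h0, Nat.div_zero, eq_comm, ← Nat.bot_eq_zero, Finset.sup_eq_bot_iff]
    simp
  · apply le_antisymm
    · refine le_trans ?_ (Finset.le_sup (b := f e a / g e a)
        (Finset.mem_range.2 (Nat.lt_succ_of_le (Nat.div_le_self _ _))))
      rw [if_pos ⟨h0.ne', Nat.mul_div_le _ _⟩]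
    · rw [Finset.sup_le_iff]
      intro q _
      split_ifs with h
      · rw [Nat.le_div_iff_mul_le h0, mul_comm]
        exact h.2
      · exact Nat.zero_le _

theorem mod (hf : PolyTime m f) (hg : PolyTime m g) : PolyTime m fun e a => f e a % g e a :=
  (hf.sub (hg.mul (hf.div hg))).of_eq fun e a => by
    have := Nat.div_add_mod (f e a) (g e a)
    omega

/-- The digit is found by repeated division, which keeps all intermediate values small. -/
theorem digit (hf : PolyTime m f) (hg : PolyTime m g) (hh : PolyTime m h) :
    PolyTime m fun e a => digit (f e a) (g e a) (h e a) := by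
  have hrec : ∀ b x n : ℕ, Nat.rec (motive := fun _ => ℕ) x (fun _ acc => acc / b) n =
      x / b ^ n := by
    intro b x n
    induction n with
    | zero => simp
    | succ n ih => simp only [ih]; rw [Nat.div_div_eq_div_mul, pow_succ]
  refine ((fold (n := h) (init := g) (body := fun e a _ acc => acc / f e a) hh hg
    (div (var (by omega)) hf.weaken.weaken) ?_).mod hf).of_eq fun e a => by
      rw [hrec]; rfl
  obtain ⟨d, hd⟩ := hg.bound
  refine ⟨d, fun e a X hX he j hj => ?_⟩
  rw [hrec]
  exact (Nat.div_le_self _ _).trans (hd e a X hX he)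

end PolyTime

/-- Every sequence of `l` digits is the sequence of digits of a number. -/
theorem exists_digits {b : ℕ} (l : ℕ) (d : ℕ → ℕ) (hd : ∀ i < l, d i < b) :
    ∃ x < b ^ l, ∀ i < l, digit b x i = d i := by
  induction l generalizing d with
  | zero => exact ⟨0, by simp, by simp⟩
  | succ l ih =>
    obtain ⟨x, hx, hx'⟩ := ih (fun i => d (i + 1)) fun i hi => hd _ (by omega)
    have h0 := hd 0 (by omega)
    have hb : 0 < b := by omega
    refine ⟨d 0 + b * x, ?_, fun i hi => ?_⟩
    · rw [pow_succ']
      calc d 0 + b * x < b + b * x := by omega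
        _ = b * (x + 1) := by ring
        _ ≤ b * b ^ l := Nat.mul_le_mul_left _ hx
    · rcases i with _ | i
      · simp [digit, Nat.mod_eq_of_lt h0]
      · rw [← hx' i (by omega)]
        simp only [digit]
        rw [pow_succ', ← Nat.div_div_eq_div_mul, Nat.add_mul_div_left _ _ hb,
          Nat.div_eq_of_lt h0, zero_add]

theorem digit_add_mul {b l i c : ℕ} (hc : c < b ^ l) (x : ℕ) :
    digit b (c + b ^ l * x) (l + i) = digit b x i := by
  simp only [digit]
  rw [pow_add, ← Nat.div_div_eq_div_mul, Nat.add_mul_div_left _ _ (by omega),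
    Nat.div_eq_of_lt hc, zero_add]

end RAM

/-! ### Specifications of programs -/

namespace RAM

/-- A store as seen by a program with `M` variables: the values of the variables, which are kept in
the registers `2, …, M + 1`, and the memory. -/
structure View where
  e : ℕ → ℕ
  a : Mem

/-- The view of a store. Registers that do not hold variables are hidden. -/
def State.view (M : ℕ) (s : State) : View := ⟨fun i => if i < M then s.reg (i + 2) else 0, s.arr⟩

/-- Assignment of `v` to variable `r`. -/
def View.set (σ : View) (r v : ℕ) : View := ⟨Function.update σ.e r v, σ.a⟩

/-- Assignment of `v` to cell `i` of array `A`. -/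
def View.store (σ : View) (A i v : ℕ) : View :=
  ⟨σ.e, Function.update σ.a A (Function.update (σ.a A) i v)⟩

@[simp] theorem View.set_e_self (σ : View) (r v : ℕ) : (σ.set r v).e r = v := by simp [View.set]

theorem View.set_e_of_ne (σ : View) {r i : ℕ} (v : ℕ) (h : i ≠ r) : (σ.set r v).e i = σ.e i := by
  simp [View.set, h]

@[simp] theorem View.set_a (σ : View) (r v : ℕ) : (σ.set r v).a = σ.a := rfl

@[simp] theorem View.store_e (σ : View) (A i v : ℕ) : (σ.store A i v).e = σ.e := rfl

/-- `Spec M Pre Post`: there is a program with `M` variables that leads from stores with property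
`Pre θ X` to stores with property `Post θ X`, in time polynomial in `X`, for all values of the
auxiliary parameter `θ`. -/
def Spec {Θ : Type*} (M : ℕ) (Pre Post : Θ → ℕ → View → Prop) : Prop :=
  ∃ (P : Prog) (d : ℕ), ∀ (θ : Θ) (X : ℕ) (s : State), 2 ≤ X → Pre θ X (s.view M) →
    Runs P s (X ^ d) fun s' => Post θ X (s'.view M)

namespace Spec

variable {Θ : Type*} {M : ℕ} {Pre Mid Post : Θ → ℕ → View → Prop}

/-- The rule of consequence; the auxiliary parameter may change. -/
theorem conseq {Θ' : Type*} {Pre' Post' : Θ' → ℕ → View → Prop} (h : Spec M Pre Post)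
    (H : ∀ θ' X, ∃ θ, (∀ σ, 2 ≤ X → Pre' θ' X σ → Pre θ X σ) ∧
      ∀ σ, Post θ X σ → Post' θ' X σ) : Spec M Pre' Post' := by
  obtain ⟨P, d, hP⟩ := h
  refine ⟨P, d, fun θ' X s hX hs => ?_⟩
  obtain ⟨θ, h1, h2⟩ := H θ' X
  exact (hP θ X s hX (h1 _ hX hs)).mono le_rfl fun _ => h2 _

theorem skip (h : ∀ θ X σ, 2 ≤ X → Pre θ X σ → Post θ X σ) : Spec M Pre Post :=
  ⟨.skip, 1, fun θ X s hX hs => (runs_skip (Q := fun s => Post θ X (s.view M))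
    (h _ _ _ hX hs)).mono (by rw [pow_one]; omega) fun _ h => h⟩

theorem seq (h : Spec M Pre Mid) (h' : Spec M Mid Post) : Spec M Pre Post := by
  obtain ⟨P, d, hP⟩ := h
  obtain ⟨P', d', hP'⟩ := h'
  refine ⟨.seq P P', d + d' + 1, fun θ X s hX hs => ?_⟩
  exact ((hP θ X s hX hs).seq fun s' hs' => hP' θ X s' hX hs').mono (pow_add_pow_le hX)
    fun _ h => h

/-- A polynomial time function sees only the view of a store. -/
theorem view_env {s : State} {e : ℕ → ℕ} {f : (ℕ → ℕ) → Mem → ℕ} (hf : PolyTime M f)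
    (he : e = fun i => s.reg (i + 2)) : f e s.arr = f (s.view M).e (s.view M).a := by
  subst he
  exact hf.congr _ _ _ fun i hi => by simp [State.view, hi]

/-- Evaluation of `f` into the first register that is not used for a variable. -/
theorem runs_eval {f : (ℕ → ℕ) → Mem → ℕ} (hf : PolyTime M f) : ∃ (P : Prog) (d : ℕ),
    ∀ (X : ℕ) (s : State), 2 ≤ X → (∀ i < M, (s.view M).e i ≤ X) → Runs P s (X ^ d) fun s' =>
      s'.reg (M + 2) = f (s.view M).e (s.view M).a ∧ s'.view M = s.view M := by
  obtain ⟨d, hd⟩ := hf.prog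
  obtain ⟨P, hP⟩ := hd (fun i => i + 2) (M + 2) fun i hi => by omega
  refine ⟨P, d, fun X s hX hs => (hP s X hX fun i hi => ?_).mono le_rfl ?_⟩
  · simpa [State.view, hi] using hs i hi
  · rintro s' ⟨h1, h2, h3⟩
    refine ⟨by rw [h1, ← view_env hf rfl], ?_⟩
    simp only [State.view, h3, View.mk.injEq, and_true]
    funext i
    split_ifs with hi
    · exact h2 _ (by omega)
    · rfl

theorem assign {f : (ℕ → ℕ) → Mem → ℕ} (r : ℕ) (hr : r < M) (hf : PolyTime M f)
    (h : ∀ θ X σ, 2 ≤ X → Pre θ X σ →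
      (∀ i < M, σ.e i ≤ X) ∧ Post θ X (σ.set r (f σ.e σ.a))) : Spec M Pre Post := by
  obtain ⟨P, d, hP⟩ := runs_eval hf
  refine ⟨.seq P (.set (r + 2) (.reg (M + 2))), d + 1 + 1, fun θ X s hX hs => ?_⟩
  obtain ⟨h1, h2⟩ := h _ _ _ hX hs
  refine ((hP X s hX h1).seq (τ' := 2) (Q' := fun s' => Post θ X (s'.view M)) ?_).mono
    ((Nat.add_le_add_left (by simpa using hX) _).trans (pow_add_pow_le hX (b := 1)))
    fun _ h => h
  rintro s' ⟨h3, h4⟩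
  generalize f (s.view M).e (s.view M).a = v at h2 h3
  refine runs_set ?_
  convert h2 using 1
  rw [← h4]
  simp only [State.view, State.setReg, View.set, Expr.eval, View.mk.injEq, and_true]
  funext i
  by_cases hi : i = r
  · subst hi
    simp [hr, h3]
  · by_cases hiM : i < M
    · simp [hi, hiM]
    · simp [hi, hiM]

theorem store {f g : (ℕ → ℕ) → Mem → ℕ} (A : ℕ) (hf : PolyTime M f) (hg : PolyTime M g)
    (h : ∀ θ X σ, 2 ≤ X → Pre θ X σ →
      (∀ i < M, σ.e i ≤ X) ∧ Post θ X (σ.store A (f σ.e σ.a) (g σ.e σ.a))) :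
    Spec M Pre Post := by
  obtain ⟨d, hd⟩ := hf.prog
  obtain ⟨P, hP⟩ := hd (fun i => i + 2) (M + 2) fun i hi => by omega
  obtain ⟨d', hd'⟩ := hg.prog
  obtain ⟨P', hP'⟩ := hd' (fun i => i + 2) (M + 3) fun i hi => by omega
  refine ⟨.seq P (.seq P' (.store A (.reg (M + 2)) (.reg (M + 3)))), d + (d' + 3 + 1) + 1,
    fun θ X s hX hs => ?_⟩
  obtain ⟨h1, h2⟩ := h _ _ _ hX hs
  have h3X : 3 ≤ X ^ 3 := le_pow_self_of_two_le hX
  have h1' : ∀ i < M, s.reg (i + 2) ≤ X := fun i hi => by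
    simpa [State.view, hi] using h1 i hi
  refine ((hP s X hX h1').seq (τ' := X ^ d' + 3) (Q' := fun s' => Post θ X (s'.view M)) ?_).mono
    ?_ fun _ h => h
  · rintro s1 ⟨p1, p2, p3⟩
    refine (hP' s1 X hX fun i hi => by rw [p2 _ (by omega)]; exact h1' i hi).seq ?_
    rintro s2 ⟨q1, q2, q3⟩
    refine runs_store ?_
    have e1 : g (fun i => s1.reg (i + 2)) s1.arr = g (s.view M).e (s.view M).a := by
      rw [p3]
      exact hg.congr _ _ _ fun i hi => by simp [State.view, hi, p2 (i + 2) (by omega)]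
    rw [view_env hf rfl] at p1
    convert h2 using 1
    simp only [State.view, State.setArr, View.store, Expr.eval, View.mk.injEq]
    refine ⟨?_, ?_⟩
    · funext i
      split_ifs with hi
      · rw [q2 _ (by omega), p2 _ (by omega)]
      · rfl
    · rw [q1, e1, q2 _ (by omega), p1, q3, p3]
      rfl
  · refine le_trans (Nat.add_le_add_left ?_ _) (pow_add_pow_le hX)
    exact (Nat.add_le_add_left h3X _).trans (pow_add_pow_le hX)

theorem ite {p : (ℕ → ℕ) → Mem → Prop} (hp : PolyDec M p)
    (hX : ∀ θ X σ, Pre θ X σ → ∀ i < M, σ.e i ≤ X)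
    (h : Spec M (fun θ X σ => Pre θ X σ ∧ p σ.e σ.a) Post)
    (h' : Spec M (fun θ X σ => Pre θ X σ ∧ ¬p σ.e σ.a) Post) : Spec M Pre Post := by
  obtain ⟨Pc, dc, hPc⟩ := runs_eval hp
  obtain ⟨P, d, hP⟩ := h
  obtain ⟨P', d', hP'⟩ := h'
  refine ⟨.seq Pc (.branch (.reg (M + 2)) P P'), dc + (1 + (d + d') + 1) + 1,
    fun θ X s h2X hs => ?_⟩
  refine ((hPc X s h2X (hX _ _ _ hs)).seq (τ' := 2 + X ^ (d + d'))
    (Q' := fun s' => Post θ X (s'.view M)) ?_).mono ?_ fun _ h => h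
  · rintro s1 ⟨h1, h2⟩
    refine runs_branch (fun he => ?_) fun he => ?_
    · refine (hP θ X s1 h2X ⟨h2 ▸ hs, ?_⟩).mono (Nat.pow_le_pow_right (by omega) (by omega))
        fun _ h => h
      by_contra hc
      exact he (by simp only [Expr.eval]; rw [h1, ← h2, ind_of_false hc])
    · refine (hP' θ X s1 h2X ⟨h2 ▸ hs, fun hc => ?_⟩).mono
        (Nat.pow_le_pow_right (by omega) (by omega)) fun _ h => h
      simp only [Expr.eval] at he
      rw [h1, ← h2, ind_of_true hc] at he
      exact one_ne_zero he
  · refine le_trans (Nat.add_le_add_left ?_ _) (pow_add_pow_le h2X)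
    exact (Nat.add_le_add_right (by simpa using h2X) _).trans (pow_add_pow_le h2X (a := 1))

/-- A loop in which variable `r` runs up to the value of variable `l`, with `n θ` iterations. -/
theorem loop {n : Θ → ℕ} {Inv : Θ → ℕ → ℕ → View → Prop} (r l : ℕ) (hr : r < M) (hl : l < M)
    (hInv : ∀ θ X i σ, Inv θ X i σ → i ≤ n θ → (σ.e r < σ.e l ↔ i < n θ))
    (hn : ∀ θ X σ, Inv θ X 0 σ → n θ ≤ X)
    (h : Spec (Θ := Θ × ℕ) M (fun θ X σ => Inv θ.1 X θ.2 σ ∧ θ.2 < n θ.1)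
      fun θ X σ => Inv θ.1 X (θ.2 + 1) (σ.set r (σ.e r + 1))) :
    Spec M (fun θ X σ => Inv θ X 0 σ) fun θ X σ => Inv θ X (n θ) σ := by
  obtain ⟨P, d, hP⟩ := h
  refine ⟨.loop (.sub (.reg (l + 2)) (.reg (r + 2)))
    (.seq P (.set (r + 2) (.add (.reg (r + 2)) (.lit 1)))), (1 + (d + 4)) + 2 + 1,
    fun θ X s hX hs => ?_⟩
  have hv : ∀ (s : State) (i : ℕ), i < M → (s.view M).e i = s.reg (i + 2) := fun s i hi => by
    simp [State.view, hi]
  refine (runs_loop (I := fun i s => Inv θ X i (s.view M) ∧ i ≤ n θ) (n := n θ) (τ := X ^ d + 4)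
    ?_ ?_ ⟨hs, Nat.zero_le _⟩).mono ?_ fun _ h => h.1
  · rintro i hi s1 ⟨h1, h2⟩
    have h3 := (hInv _ _ _ _ h1 h2).2 hi
    rw [hv _ _ hr, hv _ _ hl] at h3
    refine ⟨by simp only [Expr.eval]; omega, ?_⟩
    refine (hP (θ, i) X s1 hX ⟨h1, hi⟩).seq fun s2 h4 => ?_
    refine runs_set ⟨?_, hi⟩
    convert h4 using 1
    simp only [State.view, State.setReg, View.set, Expr.eval, View.mk.injEq, and_true]
    funext j
    by_cases hj : j = r
    · subst hj
      simp [hr]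
    · by_cases hjM : j < M
      · simp [hj, hjM]
      · simp [hj, hjM]
  · rintro s1 ⟨h1, h2⟩
    have h3 := (hInv _ _ _ _ h1 h2).not.2 (lt_irrefl _)
    rw [hv _ _ hr, hv _ _ hl] at h3
    simp only [Expr.eval]
    omega
  · have h1 := hn _ _ _ hs
    have h8 : 8 ≤ X ^ 3 := by
      calc 8 = 2 ^ 3 := rfl
        _ ≤ X ^ 3 := Nat.pow_le_pow_left hX 3
    have h4 : 4 ≤ X ^ 2 := by
      calc 4 = 2 ^ 2 := rfl
        _ ≤ X ^ 2 := Nat.pow_le_pow_left hX 2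
    have h5 : (Expr.sub (.reg (l + 2)) (.reg (r + 2))).cost + 1 + (X ^ d + 4) ≤ X ^ (d + 4) := by
      calc _ = X ^ d + 8 := by simp only [Expr.cost]; omega
        _ ≤ X ^ d + X ^ 3 := by omega
        _ ≤ X ^ (d + 3 + 1) := pow_add_pow_le hX
        _ = X ^ (d + 4) := rfl
    calc _ ≤ X * X ^ (d + 4) + X ^ 2 := by
          refine add_le_add (Nat.mul_le_mul h1 h5) ?_
          simpa [Expr.cost] using h4
      _ = X ^ (1 + (d + 4)) + X ^ 2 := by rw [pow_add X 1, pow_one]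
      _ ≤ X ^ (1 + (d + 4) + 2 + 1) := pow_add_pow_le hX

end Spec

end RAM

namespace RAM.Spec

variable {Θ : Type*} {M : ℕ} {Pre Post : Θ → ℕ → View → Prop}

/-- An assignment followed by a program that starts from its strongest postcondition. -/
theorem assign_seq {f : (ℕ → ℕ) → Mem → ℕ} (r : ℕ) (hr : r < M) (hf : PolyTime M f)
    (hX : ∀ θ X σ, 2 ≤ X → Pre θ X σ → ∀ i < M, σ.e i ≤ X)
    (h : Spec M (fun θ X σ' => ∃ σ, Pre θ X σ ∧ σ' = σ.set r (f σ.e σ.a)) Post) :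
    Spec M Pre Post :=
  (assign r hr hf fun θ X σ h2 hs => ⟨hX θ X σ h2 hs, σ, hs, rfl⟩).seq h

theorem store_seq {f g : (ℕ → ℕ) → Mem → ℕ} (A : ℕ) (hf : PolyTime M f) (hg : PolyTime M g)
    (hX : ∀ θ X σ, 2 ≤ X → Pre θ X σ → ∀ i < M, σ.e i ≤ X)
    (h : Spec M (fun θ X σ' => ∃ σ, Pre θ X σ ∧ σ' = σ.store A (f σ.e σ.a) (g σ.e σ.a)) Post) :
    Spec M Pre Post :=
  (store A hf hg fun θ X σ h2 hs => ⟨hX θ X σ h2 hs, σ, hs, rfl⟩).seq h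

end RAM.Spec

/-! ### Segments of slots -/

namespace Knapsack

open RAM

/-- The data that the search works with. The box has sides `N₁` and `N₂`, there are `n` items with
widths `w` and heights `h`, and `J` of them are to be packed; they are assigned to `J` slots.
The number `T` bounds the number of steps of a contour, `g` is the unit of rounded lengths, `bi` and
`bo` are the bases in which positions and properties of slots are encoded, `Bc = bi ^ (3 * T)` is
the number of contours, and `Γ` encodes the current guess: a colouring of the items, and the
properties of the slots. -/
structure Par where
  N₁ : ℕ
  N₂ : ℕ
  k : ℕ
  n : ℕ
  T : ℕ
  J : ℕ
  g : ℕ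
  bi : ℕ
  bo : ℕ
  Bc : ℕ
  Γ : ℕ
  w : ℕ → ℕ
  h : ℕ → ℕ

namespace Par

variable (Q : Par)

/-- The colour of item `i`: a linear hash function with values below `k * k`. -/
def color (i : ℕ) : ℕ :=
  Q.Γ / (2 * Q.n + 1) % (2 * Q.n + 1) * i % (Q.Γ % (2 * Q.n + 1)) % (Q.k * Q.k)

/-- The guessed properties of slot `i`: the colour of its item (`f = 0`), its rounded width
(`f = 1`) and position (`f = 2`), whether its item and position are free (`f = 3`), and whether it
starts a new segment (`f = 4`). -/
def slot (f i : ℕ) : ℕ := digit Q.bo (Q.Γ / (2 * Q.n + 1) / (2 * Q.n + 1)) (5 * i + f)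

/-- Slot `i` belongs to the segment that starts with slot `j`. -/
def InSeg (j i : ℕ) : Prop := j ≤ i ∧ ∀ i' < i + 1, j < i' → ¬Q.slot 4 i' ≠ 0

open Classical in
/-- The end of the segment that starts with slot `j`. -/
noncomputable def next (j : ℕ) : ℕ :=
  (Finset.range Q.J).sup fun i => if Q.InSeg j i then i + 1 else 0

/-- The height at `x` of the contour with code `c`: the contour is the upper envelope of `T`
steps, which are horizontal segments given by three digits of `c` each. -/
def cont (c x : ℕ) : ℕ :=
  (Finset.range Q.T).sup fun t => if digit Q.bi c (3 * t) ≤ x ∧ x < digit Q.bi c (3 * t + 1)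
    then digit Q.bi c (3 * t + 2) else 0

/-- Item `i` may be used in a slot with colour `γ` and rounded width `κ`. -/
def Cand (γ κ i : ℕ) : Prop := Q.color i = γ ∧ Q.w i ≤ Q.g * κ

open Classical in
/-- An item of least height among those that may be used in a slot with colour `γ` and rounded
width `κ`. If there is none, the value is `0`, which is harmless because `Par.Ok`
checks all constraints. -/
noncomputable def best (γ κ : ℕ) : ℕ :=
  (Finset.range Q.n).sup fun i =>
    if Q.Cand γ κ i ∧ ∀ i' < Q.n, Q.Cand γ κ i' → Q.h i ≤ Q.h i' then i else 0

/-- The item in slot `i` of the segment that starts with slot `j`, if `v` encodes the choices made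
for the free slots of the segment. -/
noncomputable def it (j v i : ℕ) : ℕ :=
  if Q.slot 3 i ≠ 0 then digit Q.bi v (3 * Q.T + 2 * (i - j)) else Q.best (Q.slot 0 i) (Q.slot 1 i)

/-- The horizontal position of the item in slot `i`. -/
noncomputable def xx (j v i : ℕ) : ℕ :=
  if Q.slot 3 i ≠ 0 then digit Q.bi v (3 * Q.T + 2 * (i - j) + 1) else Q.g * Q.slot 2 i

/-- The vertical position of the item in slot `i`, if it is dropped onto the contour `c` and
the items in the earlier slots of the segment, whose vertical positions are given by `Y`. They are
cut off at the top of the box, which keeps the computation polynomial and does not affect positions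
inside the box. -/
noncomputable def yy (c j v : ℕ) (Y : ℕ → ℕ) (i : ℕ) : ℕ :=
  max ((Finset.range Q.N₁).sup fun x =>
      if Q.xx j v i ≤ x ∧ x < Q.xx j v i + Q.w (Q.it j v i) then Q.cont c x else 0)
    ((Finset.range i).sup fun i' =>
      if j ≤ i' ∧ Q.xx j v i < Q.xx j v i' + Q.w (Q.it j v i') ∧
          Q.xx j v i' < Q.xx j v i + Q.w (Q.it j v i)
        then min (Y i') Q.N₂ + Q.h (Q.it j v i') else 0)

/-- The item in slot `i` at height `y` obeys all constraints: it has the guessed colour, which is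
not the colour of an earlier slot, it lies in the box and below the contour with code `v % Bc` at
the end of the segment, which is nowhere below the contour `c` at its beginning. -/
def Ok (c j v y i : ℕ) : Prop :=
  Q.it j v i < Q.n ∧ Q.color (Q.it j v i) = Q.slot 0 i ∧ (∀ i' < i, Q.slot 0 i' ≠ Q.slot 0 i) ∧
  Q.xx j v i + Q.w (Q.it j v i) ≤ Q.N₁ ∧ y + Q.h (Q.it j v i) ≤ Q.N₂ ∧
  (∀ x < Q.N₁, Q.xx j v i ≤ x → x < Q.xx j v i + Q.w (Q.it j v i) →
    y + Q.h (Q.it j v i) ≤ Q.cont (v % Q.Bc) x) ∧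
  ∀ x < Q.N₁, Q.cont c x ≤ Q.cont (v % Q.Bc) x

end Par

/-- The numerical data are polynomial time functions of an environment, and the sizes of the items
are read from the memory. -/
structure PolyPar (m : ℕ) (Q : (ℕ → ℕ) → Mem → Par) : Prop where
  N₁ : PolyTime m fun e a => (Q e a).N₁
  N₂ : PolyTime m fun e a => (Q e a).N₂
  k : PolyTime m fun e a => (Q e a).k
  n : PolyTime m fun e a => (Q e a).n
  T : PolyTime m fun e a => (Q e a).T
  J : PolyTime m fun e a => (Q e a).J
  g : PolyTime m fun e a => (Q e a).g
  bi : PolyTime m fun e a => (Q e a).bi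
  bo : PolyTime m fun e a => (Q e a).bo
  Bc : PolyTime m fun e a => (Q e a).Bc
  Γ : PolyTime m fun e a => (Q e a).Γ
  w_eq : ∀ e a, (Q e a).w = fun i => min (a 0 i) ((Q e a).N₁ + 1)
  h_eq : ∀ e a, (Q e a).h = fun i => min (a 1 i) ((Q e a).N₂ + 1)

namespace PolyPar

variable {m : ℕ} {Q : (ℕ → ℕ) → Mem → Par}

theorem weaken (hQ : PolyPar m Q) : PolyPar (m + 1) fun e a => Q (fun i => e (i + 1)) a :=
  ⟨hQ.N₁.weaken, hQ.N₂.weaken, hQ.k.weaken, hQ.n.weaken, hQ.T.weaken, hQ.J.weaken, hQ.g.weaken,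
    hQ.bi.weaken, hQ.bo.weaken, hQ.Bc.weaken, hQ.Γ.weaken, fun _ _ => hQ.w_eq _ _,
    fun _ _ => hQ.h_eq _ _⟩

variable {f c j v i x γ κ y : (ℕ → ℕ) → Mem → ℕ}

theorem w (hQ : PolyPar m Q) (hi : PolyTime m i) : PolyTime m fun e a => (Q e a).w (i e a) :=
  (PolyTime.read 0 hi (hQ.N₁.add (.const 1))).of_eq fun e a => by rw [hQ.w_eq]

theorem h (hQ : PolyPar m Q) (hi : PolyTime m i) : PolyTime m fun e a => (Q e a).h (i e a) :=
  (PolyTime.read 1 hi (hQ.N₂.add (.const 1))).of_eq fun e a => by rw [hQ.h_eq]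

theorem color (hQ : PolyPar m Q) (hi : PolyTime m i) :
    PolyTime m fun e a => (Q e a).color (i e a) := by
  have h1 : PolyTime m fun e a => 2 * (Q e a).n + 1 := ((PolyTime.const 2).mul hQ.n).add (.const 1)
  exact ((((hQ.Γ.div h1).mod h1).mul hi).mod (hQ.Γ.mod h1)).mod (hQ.k.mul hQ.k)

theorem slot (hQ : PolyPar m Q) (f : ℕ) (hi : PolyTime m i) :
    PolyTime m fun e a => (Q e a).slot f (i e a) := by
  have h1 : PolyTime m fun e a => 2 * (Q e a).n + 1 := ((PolyTime.const 2).mul hQ.n).add (.const 1)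
  exact PolyTime.digit hQ.bo ((hQ.Γ.div h1).div h1) (((PolyTime.const 5).mul hi).add (.const f))

theorem inSeg (hQ : PolyPar m Q) (hj : PolyTime m j) (hi : PolyTime m i) :
    PolyDec m fun e a => (Q e a).InSeg (j e a) (i e a) :=
  (PolyDec.le hj hi).and (PolyDec.all
    (F := fun e a i' => j e a < i' → ¬(Q e a).slot 4 i' ≠ 0) (hi.add (.const 1))
    ((PolyDec.lt hj.weaken (.var (by omega))).imp
      (PolyDec.ne_zero (hQ.weaken.slot 4 (.var (by omega)))).not))

theorem next (hQ : PolyPar m Q) (hj : PolyTime m j) :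
    PolyTime m fun e a => (Q e a).next (j e a) := by
  unfold Par.next
  exact PolyTime.sup (F := fun e a i => @ite _ ((Q e a).InSeg (j e a) i) (Classical.propDecidable _)
      (i + 1) 0) hQ.J
    (.ite (hQ.weaken.inSeg hj.weaken (.var (by omega))) ((PolyTime.var (by omega)).add (.const 1))
      (.const 0))

theorem cont (hQ : PolyPar m Q) (hc : PolyTime m c) (hx : PolyTime m x) :
    PolyTime m fun e a => (Q e a).cont (c e a) (x e a) := by
  have h3 : PolyTime (m + 1) fun e a => 3 * e 0 := (PolyTime.const 3).mul (.var (by omega))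
  exact PolyTime.sup (F := fun e a t => if RAM.digit (Q e a).bi (c e a) (3 * t) ≤ x e a ∧
      x e a < RAM.digit (Q e a).bi (c e a) (3 * t + 1)
      then RAM.digit (Q e a).bi (c e a) (3 * t + 2) else 0) hQ.T
    (.ite ((PolyDec.le (.digit hQ.bi.weaken hc.weaken h3) hx.weaken).and
        (PolyDec.lt hx.weaken (.digit hQ.bi.weaken hc.weaken (h3.add (.const 1)))))
      (.digit hQ.bi.weaken hc.weaken (h3.add (.const 2))) (.const 0))

theorem cand (hQ : PolyPar m Q) (hγ : PolyTime m γ) (hκ : PolyTime m κ) (hi : PolyTime m i) :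
    PolyDec m fun e a => (Q e a).Cand (γ e a) (κ e a) (i e a) :=
  (PolyDec.eq (hQ.color hi) hγ).and (PolyDec.le (hQ.w hi) (hQ.g.mul hκ))

open Classical in
theorem best (hQ : PolyPar m Q) (hγ : PolyTime m γ) (hκ : PolyTime m κ) :
    PolyTime m fun e a => (Q e a).best (γ e a) (κ e a) := by
  unfold Par.best
  refine PolyTime.sup (F := fun e a i => if (Q e a).Cand (γ e a) (κ e a) i ∧
      ∀ i' < (Q e a).n, (Q e a).Cand (γ e a) (κ e a) i' → (Q e a).h i ≤ (Q e a).h i' then i else 0)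
    hQ.n
    (.ite ((hQ.weaken.cand hγ.weaken hκ.weaken (.var (by omega))).and ?_) (.var (by omega))
      (.const 0))
  refine PolyDec.all (F := fun e a i' => (Q (fun i => e (i + 1)) a).Cand
    (γ (fun i => e (i + 1)) a) (κ (fun i => e (i + 1)) a) i' →
    (Q (fun i => e (i + 1)) a).h (e 0) ≤ (Q (fun i => e (i + 1)) a).h i') hQ.n.weaken ?_
  exact (hQ.weaken.weaken.cand hγ.weaken.weaken hκ.weaken.weaken (.var (by omega))).imp
    (PolyDec.le (hQ.weaken.weaken.h (.var (by omega))) (hQ.weaken.weaken.h (.var (by omega))))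

theorem it (hQ : PolyPar m Q) (hj : PolyTime m j) (hv : PolyTime m v) (hi : PolyTime m i) :
    PolyTime m fun e a => (Q e a).it (j e a) (v e a) (i e a) :=
  .ite (PolyDec.ne_zero (hQ.slot 3 hi))
    (.digit hQ.bi hv (((PolyTime.const 3).mul hQ.T).add ((PolyTime.const 2).mul (hi.sub hj))))
    (hQ.best (hQ.slot 0 hi) (hQ.slot 1 hi))

theorem xx (hQ : PolyPar m Q) (hj : PolyTime m j) (hv : PolyTime m v) (hi : PolyTime m i) :
    PolyTime m fun e a => (Q e a).xx (j e a) (v e a) (i e a) :=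
  .ite (PolyDec.ne_zero (hQ.slot 3 hi))
    (.digit hQ.bi hv ((((PolyTime.const 3).mul hQ.T).add
      ((PolyTime.const 2).mul (hi.sub hj))).add (.const 1)))
    (hQ.g.mul (hQ.slot 2 hi))

theorem yy (hQ : PolyPar m Q) (hc : PolyTime m c) (hj : PolyTime m j) (hv : PolyTime m v)
    (hi : PolyTime m i) :
    PolyTime m fun e a => (Q e a).yy (c e a) (j e a) (v e a) (a 4) (i e a) := by
  have h0 : PolyTime (m + 1) fun e _ => e 0 := .var (by omega)
  have hx := hQ.xx hj hv hi
  have hx' := hQ.weaken.xx hj.weaken hv.weaken h0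
  have hw := hQ.w (hQ.it hj hv hi)
  have hit' := hQ.weaken.it hj.weaken hv.weaken h0
  refine PolyTime.max (PolyTime.sup (F := fun e a x => if (Q e a).xx (j e a) (v e a) (i e a) ≤ x ∧
      x < (Q e a).xx (j e a) (v e a) (i e a) + (Q e a).w ((Q e a).it (j e a) (v e a) (i e a))
      then (Q e a).cont (c e a) x else 0) hQ.N₁
    (.ite ((PolyDec.le hx.weaken h0).and (PolyDec.lt h0 (hx.weaken.add hw.weaken)))
      (hQ.weaken.cont hc.weaken h0) (.const 0)))
    (PolyTime.sup (F := fun e a i' =>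
      if j e a ≤ i' ∧ (Q e a).xx (j e a) (v e a) (i e a) < (Q e a).xx (j e a) (v e a) i' +
          (Q e a).w ((Q e a).it (j e a) (v e a) i') ∧
          (Q e a).xx (j e a) (v e a) i' < (Q e a).xx (j e a) (v e a) (i e a) +
            (Q e a).w ((Q e a).it (j e a) (v e a) (i e a))
        then Min.min (a 4 i') (Q e a).N₂ + (Q e a).h ((Q e a).it (j e a) (v e a) i') else 0) hi
    (.ite ((PolyDec.le hj.weaken h0).and ((PolyDec.lt hx.weaken
        (hx'.add (hQ.weaken.w hit'))).and (PolyDec.lt hx' (hx.weaken.add hw.weaken))))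
      ((PolyTime.read 4 h0 hQ.N₂.weaken).add (hQ.weaken.h hit')) (.const 0)))

theorem ok (hQ : PolyPar m Q) (hc : PolyTime m c) (hj : PolyTime m j) (hv : PolyTime m v)
    (hy : PolyTime m y) (hi : PolyTime m i) :
    PolyDec m fun e a => (Q e a).Ok (c e a) (j e a) (v e a) (y e a) (i e a) := by
  have h0 : PolyTime (m + 1) fun e _ => e 0 := .var (by omega)
  have hx := hQ.xx hj hv hi
  have hit := hQ.it hj hv hi
  have hw := hQ.w hit
  have hh := hQ.h hit
  have hc2 := hv.mod hQ.Bc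
  exact (PolyDec.lt hit hQ.n).and <| (PolyDec.eq (hQ.color hit) (hQ.slot 0 hi)).and <|
    (PolyDec.all (F := fun e a i' => (Q e a).slot 0 i' ≠ (Q e a).slot 0 (i e a)) hi
      (PolyDec.ne (hQ.weaken.slot 0 h0) (hQ.slot 0 hi).weaken)).and <|
    (PolyDec.le (hx.add hw) hQ.N₁).and <| (PolyDec.le (hy.add hh) hQ.N₂).and <|
    (PolyDec.all (F := fun e a x => (Q e a).xx (j e a) (v e a) (i e a) ≤ x →
      x < (Q e a).xx (j e a) (v e a) (i e a) + (Q e a).w ((Q e a).it (j e a) (v e a) (i e a)) →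
      y e a + (Q e a).h ((Q e a).it (j e a) (v e a) (i e a)) ≤
        (Q e a).cont (v e a % (Q e a).Bc) x) hQ.N₁
      ((PolyDec.le hx.weaken h0).imp ((PolyDec.lt h0 (hx.add hw).weaken).imp
        (PolyDec.le (hy.add hh).weaken (hQ.weaken.cont hc2.weaken h0))))).and
    (PolyDec.all (F := fun e a x => (Q e a).cont (c e a) x ≤
      (Q e a).cont (v e a % (Q e a).Bc) x) hQ.N₁
      (PolyDec.le (hQ.weaken.cont hc.weaken h0) (hQ.weaken.cont hc2.weaken h0)))

end PolyPar

end Knapsack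

/-! ### The search program -/

namespace Knapsack

open RAM

/-- The data of the search, as kept in the variables `0, …, 11` and in the arrays `0` and `1`; sizes
of items are cut off above the sides of the box.

Of the other variables, `12` and `13` hold the numbers of choices for a segment and of guesses, `14`
the number of nodes, and `15` tells whether a packing has been found. The current node, choice and
slot are in `17`, `18` and `19`, the end of the current segment in `20`, the indicator of its
validity in `21`, and the next node in `22`; the variables `16` and `23` count nodes and segments.
Arrays `2`, `3` and `4` receive the items and their positions, and array `5` is the table of the
search. -/
def par (e : ℕ → ℕ) (a : Mem) : Par where
  N₁ := e 0
  N₂ := e 1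
  k := e 2
  n := e 3
  T := e 4
  J := e 5
  g := e 7
  bi := e 8
  bo := e 9
  Bc := e 10
  Γ := e 11
  w := fun i => min (a 0 i) (e 0 + 1)
  h := fun i => min (a 1 i) (e 1 + 1)

theorem polyPar_par {m : ℕ} (hm : 12 ≤ m) : PolyPar m par := by
  constructor
  case w_eq => exact fun _ _ => rfl
  case h_eq => exact fun _ _ => rfl
  all_goals exact PolyTime.var (by omega)

theorem par_congr {e e' : ℕ → ℕ} {a a' : Mem} (he : ∀ i < 12, e i = e' i) (h0 : a 0 = a' 0)
    (h1 : a 1 = a' 1) : par e a = par e' a' := by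
  simp [par, he 0, he 1, he 2, he 3, he 4, he 5, he 7, he 8, he 9, he 10, he 11, h0, h1]

namespace Par

variable (Q : Par)

/-- `Y` gives the vertical positions of the items in the segment that starts at node `a`, if `v`
encodes the choices for this segment; they obey all constraints. A node consists of the first slot
of a segment and of a contour. -/
def Run (a v : ℕ) (Y : ℕ → ℕ) : Prop :=
  ∀ i, a / Q.Bc ≤ i → i < Q.next (a / Q.Bc) →
    Y i = Q.yy (a % Q.Bc) (a / Q.Bc) v Y i ∧ Q.Ok (a % Q.Bc) (a / Q.Bc) v (Y i) i

/-- The node at the end of the segment. -/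
noncomputable def target (a v : ℕ) : ℕ := Q.next (a / Q.Bc) * Q.Bc + v % Q.Bc

theorem yy_congr {c j v i : ℕ} {Y Y' : ℕ → ℕ} (h : ∀ i', j ≤ i' → i' < i → Y i' = Y' i') :
    Q.yy c j v Y i = Q.yy c j v Y' i := by
  unfold yy
  congr 1
  refine Finset.sup_congr rfl fun i' hi' => ?_
  split_ifs with hc
  · rw [h i' hc.1 (Finset.mem_range.1 hi')]
  · rfl

/-- The vertical positions of the items of a segment are determined by recursion. -/
theorem yy_unique {c j v e : ℕ} {Y Y' : ℕ → ℕ}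
    (h : ∀ i, j ≤ i → i < e → Y i = Q.yy c j v Y i)
    (h' : ∀ i, j ≤ i → i < e → Y' i = Q.yy c j v Y' i) :
    ∀ i, j ≤ i → i < e → Y i = Y' i := by
  intro i
  induction i using Nat.strong_induction_on with
  | _ i ih =>
    intro h1 h2
    rw [h i h1 h2, h' i h1 h2]
    exact Q.yy_congr fun i' h3 h4 => ih i' h4 h3 (h4.trans h2)

theorem next_le {j : ℕ} : Q.next j ≤ Q.J := by
  refine Finset.sup_le fun i hi => ?_
  have := Finset.mem_range.1 hi
  split_ifs <;> omega

theorem lt_next {j : ℕ} (hj : j < Q.J) : j < Q.next j := by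
  refine lt_of_lt_of_le (Nat.lt_succ_self j) ?_
  refine le_trans ?_ (Finset.le_sup (b := j) (Finset.mem_range.2 hj))
  rw [if_pos ⟨le_rfl, fun i' h1 h2 => by omega⟩]

/-- The constraints do not distinguish heights above the box, so they can be tested on a capped
value. -/
theorem ok_min {c j v y i : ℕ} : Q.Ok c j v (min y (Q.N₂ + 1)) i ↔ Q.Ok c j v y i := by
  unfold Ok
  rcases le_total y (Q.N₂ + 1) with h | h
  · rw [min_eq_left h]
  · rw [min_eq_right h]
    constructor <;> rintro ⟨-, -, -, -, h5, -⟩ <;> omega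

end Par

/-- The state of the computation of a segment that has been started in `σ₀`, when the slots before
`hi` have been processed. -/
structure SegState (σ₀ : View) (hi : ℕ) (σ : View) : Prop where
  e_eq : ∀ r, r ≠ 19 → r ≠ 20 → r ≠ 21 → r ≠ 22 → σ.e r = σ₀.e r
  a_eq : ∀ A, A ≠ 2 → A ≠ 3 → A ≠ 4 → σ.a A = σ₀.a A
  out : ∀ A i, i < σ₀.e 17 / σ₀.e 10 ∨ hi ≤ i → σ.a A i = σ₀.a A i
  it : ∀ i, σ₀.e 17 / σ₀.e 10 ≤ i → i < hi →
    σ.a 2 i = (par σ₀.e σ₀.a).it (σ₀.e 17 / σ₀.e 10) (σ₀.e 18) i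
  xx : ∀ i, σ₀.e 17 / σ₀.e 10 ≤ i → i < hi →
    σ.a 3 i = (par σ₀.e σ₀.a).xx (σ₀.e 17 / σ₀.e 10) (σ₀.e 18) i
  yy : ∀ i, σ₀.e 17 / σ₀.e 10 ≤ i → i < hi →
    σ.a 4 i = (par σ₀.e σ₀.a).yy (σ₀.e 17 % σ₀.e 10) (σ₀.e 17 / σ₀.e 10) (σ₀.e 18) (σ.a 4) i
  ok : σ.e 21 = ind (∀ i, σ₀.e 17 / σ₀.e 10 ≤ i → i < hi →
    (par σ₀.e σ₀.a).Ok (σ₀.e 17 % σ₀.e 10) (σ₀.e 17 / σ₀.e 10) (σ₀.e 18) (σ.a 4 i) i)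

theorem SegState.par_eq {σ₀ σ : View} {hi : ℕ} (h : SegState σ₀ hi σ) :
    par σ.e σ.a = par σ₀.e σ₀.a :=
  par_congr (fun i hi => h.e_eq i (by omega) (by omega) (by omega) (by omega))
    (h.a_eq 0 (by omega) (by omega) (by omega)) (h.a_eq 1 (by omega) (by omega) (by omega))

/-- The state after the computation of a segment. -/
structure SegPost (σ₀ σ : View) : Prop where
  e_eq : ∀ r, r ≠ 19 → r ≠ 20 → r ≠ 21 → r ≠ 22 → σ.e r = σ₀.e r
  a_eq : ∀ A, A ≠ 2 → A ≠ 3 → A ≠ 4 → σ.a A = σ₀.a A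
  out : ∀ A i, i < σ₀.e 17 / σ₀.e 10 → σ.a A i = σ₀.a A i
  it : ∀ i, σ₀.e 17 / σ₀.e 10 ≤ i → i < (par σ₀.e σ₀.a).next (σ₀.e 17 / σ₀.e 10) →
    σ.a 2 i = (par σ₀.e σ₀.a).it (σ₀.e 17 / σ₀.e 10) (σ₀.e 18) i
  xx : ∀ i, σ₀.e 17 / σ₀.e 10 ≤ i → i < (par σ₀.e σ₀.a).next (σ₀.e 17 / σ₀.e 10) →
    σ.a 3 i = (par σ₀.e σ₀.a).xx (σ₀.e 17 / σ₀.e 10) (σ₀.e 18) i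
  target : σ.e 22 = (par σ₀.e σ₀.a).target (σ₀.e 17) (σ₀.e 18)
  run : σ.e 21 ≠ 0 → (par σ₀.e σ₀.a).Run (σ₀.e 17) (σ₀.e 18) (σ.a 4)
  ok : ∀ Y, (par σ₀.e σ₀.a).Run (σ₀.e 17) (σ₀.e 18) Y → σ.e 21 ≠ 0

/-- What a computation of a segment needs: all variables are at most `X`, and so are the nodes. -/
def SegPre (X : ℕ) (σ : View) : Prop :=
  (∀ i < 32, σ.e i ≤ X) ∧ (σ.e 5 + 1) * σ.e 10 ≤ X ∧ σ.e 17 < σ.e 5 * σ.e 10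

theorem SegState.step {σ₀ σ : View} {i : ℕ} (hs : SegState σ₀ i σ) (h19 : σ.e 19 = i)
    (hji : σ₀.e 17 / σ₀.e 10 ≤ i) {σ1 σ2 σ3 : View}
    (h1 : σ1 = σ.store 2 (σ.e 19) ((par σ.e σ.a).it (σ.e 17 / σ.e 10) (σ.e 18) (σ.e 19)))
    (h2 : σ2 = σ1.store 3 (σ1.e 19) ((par σ1.e σ1.a).xx (σ1.e 17 / σ1.e 10) (σ1.e 18) (σ1.e 19)))
    (h3 : σ3 = σ2.store 4 (σ2.e 19) ((par σ2.e σ2.a).yy (σ2.e 17 % σ2.e 10) (σ2.e 17 / σ2.e 10)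
      (σ2.e 18) (σ2.a 4) (σ2.e 19))) :
    SegState σ₀ (i + 1) (((σ3.set 21 (σ3.e 21 * ind ((par σ3.e σ3.a).Ok (σ3.e 17 % σ3.e 10)
      (σ3.e 17 / σ3.e 10) (σ3.e 18) (min (σ3.a 4 (σ3.e 19)) (σ3.e 1 + 1)) (σ3.e 19)))).set 19
      (i + 1))) := by
  have e1 : σ1.e = σ.e := by rw [h1]; rfl
  have e2 : σ2.e = σ.e := by rw [h2]; exact e1
  have e3 : σ3.e = σ.e := by rw [h3]; exact e2
  have a1 : ∀ A, A ≠ 2 → σ1.a A = σ.a A := fun A hA => by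
    rw [h1]; simp [View.store, hA]
  have a2 : ∀ A, A ≠ 2 → A ≠ 3 → σ2.a A = σ.a A := fun A hA hA' => by
    rw [h2, ← a1 A hA]; simp [View.store, hA']
  have a3 : ∀ A, A ≠ 2 → A ≠ 3 → A ≠ 4 → σ3.a A = σ.a A := fun A hA hA' hA'' => by
    rw [h3, ← a2 A hA hA']; simp [View.store, hA'']
  have p1 : par σ1.e σ1.a = par σ₀.e σ₀.a := by
    rw [← hs.par_eq, e1]; exact par_congr (fun _ _ => rfl) (a1 0 (by omega)) (a1 1 (by omega))
  have p2 : par σ2.e σ2.a = par σ₀.e σ₀.a := by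
    rw [← hs.par_eq, e2]
    exact par_congr (fun _ _ => rfl) (a2 0 (by omega) (by omega)) (a2 1 (by omega) (by omega))
  have p3 : par σ3.e σ3.a = par σ₀.e σ₀.a := by
    rw [← hs.par_eq, e3]
    exact par_congr (fun _ _ => rfl) (a3 0 (by omega) (by omega) (by omega))
      (a3 1 (by omega) (by omega) (by omega))
  have x17 : σ.e 17 = σ₀.e 17 := hs.e_eq 17 (by omega) (by omega) (by omega) (by omega)
  have x10 : σ.e 10 = σ₀.e 10 := hs.e_eq 10 (by omega) (by omega) (by omega) (by omega)
  have x18 : σ.e 18 = σ₀.e 18 := hs.e_eq 18 (by omega) (by omega) (by omega) (by omega)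
  have x1 : σ.e 1 = σ₀.e 1 := hs.e_eq 1 (by omega) (by omega) (by omega) (by omega)
  rw [hs.par_eq, h19, x17, x10, x18] at h1
  rw [p1, e1, h19, x17, x10, x18] at h2
  rw [p2, e2, h19, x17, x10, x18, a2 4 (by omega) (by omega)] at h3
  rw [p3, e3, h19, x17, x10, x18, x1]
  have hN : σ₀.e 1 = (par σ₀.e σ₀.a).N₂ := rfl
  rw [hN, Par.ok_min]
  set j := σ₀.e 17 / σ₀.e 10
  set c := σ₀.e 17 % σ₀.e 10
  set v := σ₀.e 18
  set Q := par σ₀.e σ₀.a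
  have b2 : σ3.a 2 = Function.update (σ.a 2) i (Q.it j v i) := by
    rw [h3, h2, h1]; simp [View.store]
  have b3 : σ3.a 3 = Function.update (σ.a 3) i (Q.xx j v i) := by
    rw [h3]
    have := a1 3 (by omega)
    rw [h2]; simp [View.store, this]
  have b4 : σ3.a 4 = Function.update (σ.a 4) i (Q.yy c j v (σ.a 4) i) := by
    have := a2 4 (by omega) (by omega)
    rw [h3]; simp [View.store, this]
  have b4' : ∀ i' < i, σ3.a 4 i' = σ.a 4 i' := fun i' hi' => by
    rw [b4, Function.update_of_ne (by omega)]
  refine ⟨fun r h1 h2 h3 h4 => ?_, fun A h1 h2 h3 => ?_, fun A i' hi' => ?_, fun i' hj hi' => ?_,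
    fun i' hj hi' => ?_, fun i' hj hi' => ?_, ?_⟩
  · rw [View.set_e_of_ne _ _ h1, View.set_e_of_ne _ _ h3, e3]
    exact hs.e_eq r h1 h2 h3 h4
  · exact (a3 A h1 h2 h3).trans (hs.a_eq A h1 h2 h3)
  · have : i' ≠ i := by rintro rfl; omega
    rw [View.set_a, View.set_a, ← hs.out A i' (by omega)]
    by_cases hA2 : A = 2
    · rw [hA2, b2, Function.update_of_ne this]
    by_cases hA3 : A = 3
    · rw [hA3, b3, Function.update_of_ne this]
    by_cases hA4 : A = 4
    · rw [hA4, b4, Function.update_of_ne this]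
    rw [a3 A hA2 hA3 hA4]
  · rw [View.set_a, View.set_a, b2]
    rcases Nat.lt_succ_iff_lt_or_eq.1 hi' with h | rfl
    · rw [Function.update_of_ne h.ne, hs.it i' hj h]
    · rw [Function.update_self]
  · rw [View.set_a, View.set_a, b3]
    rcases Nat.lt_succ_iff_lt_or_eq.1 hi' with h | rfl
    · rw [Function.update_of_ne h.ne, hs.xx i' hj h]
    · rw [Function.update_self]
  · rw [View.set_a, View.set_a]
    rw [Q.yy_congr (Y := σ3.a 4) (Y' := σ.a 4) fun i'' _ h => b4' i'' (by omega)]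
    rcases Nat.lt_succ_iff_lt_or_eq.1 hi' with h | rfl
    · rw [b4' i' h]
      exact hs.yy i' hj h
    · rw [b4, Function.update_self]
  · rw [View.set_e_of_ne _ _ (by omega), View.set_e_self, View.set_a, View.set_a, hs.ok]
    by_cases hall : ∀ i', j ≤ i' → i' < i → Q.Ok c j v (σ.a 4 i') i'
    · rw [ind_of_true hall, one_mul]
      congr 1
      refine propext ⟨fun h i' hj hi' => ?_, fun h => h i hji (by omega)⟩
      rcases Nat.lt_succ_iff_lt_or_eq.1 hi' with h' | rfl
      · rw [b4' i' h']; exact hall i' hj h'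
      · exact h
    · rw [ind_of_false hall, zero_mul, ind_of_false fun h => hall fun i' hj hi' => ?_]
      rw [← b4' i' hi']
      exact h i' hj (by omega)

/-- For a given node and a given choice, the items of the segment are placed one after the other. -/
theorem spec_segment :
    Spec 32 (fun (σ₀ : View) X σ => σ = σ₀ ∧ SegPre X σ₀) fun σ₀ X σ =>
      SegPost σ₀ σ ∧ ∀ i < 32, σ.e i ≤ X := by
  have v (i : ℕ) (hi : i < 32 := by omega) : PolyTime 32 fun e _ => e i := .var hi
  have hQ : PolyPar 32 par := polyPar_par (by omega)
  have hj : PolyTime 32 fun e _ => e 17 / e 10 := (v 17).div (v 10)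
  have hc : PolyTime 32 fun e _ => e 17 % e 10 := (v 17).mod (v 10)
  refine Spec.assign_seq 19 (by omega) hj ?_ ?_
  · rintro σ₀ X _ - ⟨rfl, h⟩ i hi
    exact h.1 i hi
  refine Spec.assign_seq 20 (by omega) (hQ.next hj) ?_ ?_
  · rintro σ₀ X _ - ⟨σ, ⟨rfl, h⟩, rfl⟩ i hi
    by_cases h19 : i = 19
    · subst h19
      rw [View.set_e_self]
      exact (Nat.div_le_self _ _).trans (h.1 17 (by omega))
    · rw [View.set_e_of_ne _ _ h19]
      exact h.1 i hi
  let Inv : View → ℕ → ℕ → View → Prop := fun σ₀ X t σ =>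
    SegPre X σ₀ ∧ SegState σ₀ (σ₀.e 17 / σ₀.e 10 + t) σ ∧ σ.e 19 = σ₀.e 17 / σ₀.e 10 + t ∧
      σ.e 20 = (par σ₀.e σ₀.a).next (σ₀.e 17 / σ₀.e 10) ∧ ∀ i < 32, σ.e i ≤ X
  let n : View → ℕ := fun σ₀ =>
    (par σ₀.e σ₀.a).next (σ₀.e 17 / σ₀.e 10) - σ₀.e 17 / σ₀.e 10
  have hlt : ∀ (X : ℕ) (σ : View), SegPre X σ →
      σ.e 17 / σ.e 10 < (par σ.e σ.a).next (σ.e 17 / σ.e 10) := by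
    intro X σ h
    exact Par.lt_next _ (Nat.div_lt_of_lt_mul (by rw [mul_comm]; exact h.2.2))
  have hle : ∀ (X : ℕ) (σ : View), SegPre X σ →
      (par σ.e σ.a).next (σ.e 17 / σ.e 10) ≤ X :=
    fun X σ h => (Par.next_le _).trans (h.1 5 (by omega))
  refine Spec.seq (Mid := fun σ₀ X σ => Inv σ₀ X 0 σ) (Spec.assign 21 (by omega) (.const 1) ?_) ?_
  · rintro σ₀ X _ h2 ⟨_, ⟨σ, ⟨rfl, h⟩, rfl⟩, rfl⟩
    have hp : par (σ.set 19 (σ.e 17 / σ.e 10)).e σ.a = par σ.e σ.a :=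
      par_congr (fun i hi => View.set_e_of_ne _ _ (by omega)) rfl rfl
    have e17 : ∀ x, (σ.set 19 x).e 17 = σ.e 17 := fun x => View.set_e_of_ne _ _ (by omega)
    have e10 : ∀ x, (σ.set 19 x).e 10 = σ.e 10 := fun x => View.set_e_of_ne _ _ (by omega)
    have hb : ∀ i < 32, ((σ.set 19 (σ.e 17 / σ.e 10)).set 20
        ((par σ.e σ.a).next (σ.e 17 / σ.e 10))).e i ≤ X := by
      intro i hi
      by_cases h20 : i = 20
      · subst h20
        rw [View.set_e_self]
        exact hle X σ h
      rw [View.set_e_of_ne _ _ h20]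
      by_cases h19 : i = 19
      · subst h19
        rw [View.set_e_self]
        exact (Nat.div_le_self _ _).trans (h.1 17 (by omega))
      · rw [View.set_e_of_ne _ _ h19]
        exact h.1 i hi
    rw [View.set_a, hp, e17, e10]
    refine ⟨hb, h, ⟨?_, fun _ _ _ _ => rfl, fun _ _ _ => rfl, fun i h1 h2 => ?_,
      fun i h1 h2 => ?_, fun i h1 h2 => ?_, ?_⟩, ?_, ?_, ?_⟩
    · intro r h1 h2 h3 h4
      rw [View.set_e_of_ne _ _ h3, View.set_e_of_ne _ _ h2, View.set_e_of_ne _ _ h1]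
    · omega
    · omega
    · omega
    · rw [View.set_e_self, ind_of_true fun i h1 h2 => by omega]
    · rw [View.set_e_of_ne _ _ (by omega), View.set_e_of_ne _ _ (by omega), View.set_e_self,
        add_zero]
    · rw [View.set_e_of_ne _ _ (by omega), View.set_e_self]
    · intro i hi
      by_cases h21 : i = 21
      · subst h21
        rw [View.set_e_self]
        omega
      · rw [View.set_e_of_ne _ _ h21]
        exact hb i hi
  refine Spec.seq (Spec.loop (n := n) (Inv := Inv) 19 20 (by omega) (by omega) ?_ ?_ ?_) ?_
  · rintro σ₀ X i σ ⟨h1, h2, h3, h4, h5⟩ hi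
    have := hlt X σ₀ h1
    rw [h3, h4]
    simp only [n]
    omega
  · rintro σ₀ X σ ⟨h1, -⟩
    exact (Nat.sub_le _ _).trans (hle X σ₀ h1)
  · refine Spec.store_seq 2 (v 19) (hQ.it hj (v 18) (v 19)) ?_ ?_
    · rintro ⟨σ₀, t⟩ X σ - ⟨⟨h1, h2, h3, h4, h5⟩, h6⟩
      exact h5
    refine Spec.store_seq 3 (v 19) (hQ.xx hj (v 18) (v 19)) ?_ ?_
    · rintro ⟨σ₀, t⟩ X _ - ⟨σ, ⟨⟨h1, h2, h3, h4, h5⟩, h6⟩, rfl⟩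
      exact h5
    refine Spec.store_seq 4 (v 19) (hQ.yy hc hj (v 18) (v 19)) ?_ ?_
    · rintro ⟨σ₀, t⟩ X _ - ⟨_, ⟨σ, ⟨⟨h1, h2, h3, h4, h5⟩, h6⟩, rfl⟩, rfl⟩
      exact h5
    refine Spec.assign 21 (by omega) ((v 21).mul (hQ.ok hc hj (v 18)
      (.read 4 (v 19) ((v 1).add (.const 1))) (v 19))) ?_
    rintro ⟨σ₀, t⟩ X σ3 h2X ⟨σ2, ⟨σ1, ⟨σ, ⟨⟨h1, h2, h3, h4, h5⟩, h6⟩, hσ1⟩, hσ2⟩, hσ3⟩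
    dsimp only at h1 h2 h3 h4 h5 h6 ⊢
    have e3 : σ3.e = σ.e := by
      rw [hσ3, View.store_e, hσ2, View.store_e, hσ1, View.store_e]
    refine ⟨by rw [e3]; exact h5, h1, ?_, ?_, ?_, ?_⟩
    · rw [← add_assoc]
      convert SegState.step h2 h3 (by omega) hσ1 hσ2 hσ3 using 2
      rw [View.set_e_of_ne _ _ (by omega), e3, h3]
    · rw [View.set_e_self, View.set_e_of_ne _ _ (by omega), e3, h3, add_assoc]
    · rw [View.set_e_of_ne _ _ (by omega), View.set_e_of_ne _ _ (by omega), e3, h4]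
    · intro i hi
      by_cases h19 : i = 19
      · subst h19
        rw [View.set_e_self, View.set_e_of_ne _ _ (by omega), e3, h3]
        have := hle X σ₀ h1
        simp only [n] at h6
        omega
      rw [View.set_e_of_ne _ _ h19]
      by_cases h21 : i = 21
      · subst h21
        rw [View.set_e_self, e3, h2.ok]
        refine (Nat.mul_le_mul (ind_le_one _) (ind_le_one _)).trans (by omega)
      · rw [View.set_e_of_ne _ _ h21, e3]
        exact h5 i hi
  · refine Spec.assign 22 (by omega) (((v 20).mul (v 10)).add ((v 18).mod (v 10))) ?_
    rintro σ₀ X σ h2X ⟨h1, h2, h3, h4, h5⟩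
    have hl := hlt X σ₀ h1
    have hend : σ₀.e 17 / σ₀.e 10 + n σ₀ = (par σ₀.e σ₀.a).next (σ₀.e 17 / σ₀.e 10) := by
      simp only [n]
      omega
    rw [hend] at h2 h3
    have x10 : σ.e 10 = σ₀.e 10 := h2.e_eq 10 (by omega) (by omega) (by omega) (by omega)
    have x18 : σ.e 18 = σ₀.e 18 := h2.e_eq 18 (by omega) (by omega) (by omega) (by omega)
    have hpos : 0 < σ₀.e 10 := by
      rcases Nat.eq_zero_or_pos (σ₀.e 10) with h0 | h0
      · have := h1.2.2
        rw [h0] at this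
        omega
      · exact h0
    refine ⟨h5, ⟨fun r q1 q2 q3 q4 => ?_, fun A q1 q2 q3 => h2.a_eq A q1 q2 q3,
      fun A i hi => h2.out A i (.inl hi), h2.it, h2.xx, ?_, fun h0 => ?_, fun Y hY => ?_⟩, ?_⟩
    · rw [View.set_e_of_ne _ _ q4]
      exact h2.e_eq r q1 q2 q3 q4
    · rw [View.set_e_self, x10, x18, h4]
      rfl
    · rw [View.set_e_of_ne _ _ (by omega), h2.ok, Ne, ind_eq_zero, not_not] at h0
      exact fun i q1 q2 => ⟨h2.yy i q1 q2, h0 i q1 q2⟩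
    · rw [View.set_e_of_ne _ _ (by omega), h2.ok, Ne, ind_eq_zero, not_not]
      intro i q1 q2
      rw [Par.yy_unique _ h2.yy (fun i q1 q2 => (hY i q1 q2).1) i q1 q2]
      exact (hY i q1 q2).2
    · intro i hi
      by_cases h22 : i = 22
      · subst h22
        rw [View.set_e_self, x10, x18, h4]
        refine le_trans ?_ h1.2.1
        have hm : σ₀.e 18 % σ₀.e 10 < σ₀.e 10 := Nat.mod_lt _ hpos
        have : (par σ₀.e σ₀.a).next (σ₀.e 17 / σ₀.e 10) * σ₀.e 10 ≤ σ₀.e 5 * σ₀.e 10 :=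
          Nat.mul_le_mul_right _ (Par.next_le _)
        rw [add_mul, one_mul]
        omega
      · rw [View.set_e_of_ne _ _ h22]
        exact h5 i hi

end Knapsack

/-! ### The table of the search -/

namespace Knapsack

open RAM

namespace Par

variable (Q : Par)

/-- The end of the packing can be reached from the node `a`, with choices below `V` for every
segment. -/
inductive Path (V : ℕ) : ℕ → Prop
  | done {a : ℕ} (h : Q.J * Q.Bc ≤ a) : Path V a
  | step {a v : ℕ} {Y : ℕ → ℕ} (hv : v < V) (ha : a < Q.J * Q.Bc) (h : Q.Run a v Y)
      (hp : Path V (Q.target a v)) : Path V a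

/-- Node `a` is final, or the table `G` contains choices for the segment that starts there. -/
def Live (G : ℕ → ℕ) (a : ℕ) : Prop := Q.J * Q.Bc ≤ a ∨ G a ≠ 0

/-- The entry of the table `G` for node `a` is correct as far as choices below `V` are concerned:
it is `0` or the successor of a choice below `B` that leads to a live node; in the former case
no choice below `V` does. -/
def GoodAt (B : ℕ) (G : ℕ → ℕ) (a V : ℕ) : Prop :=
  (G a = 0 → ∀ v < V, ∀ Y, Q.Run a v Y → ¬Q.Live G (Q.target a v)) ∧
    (G a ≠ 0 → G a ≤ B ∧ (∃ Y, Q.Run a (G a - 1) Y) ∧ Q.Live G (Q.target a (G a - 1)))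

variable {Q}

theorem lt_target {a : ℕ} (v : ℕ) (ha : a < Q.J * Q.Bc) : a < Q.target a v := by
  have h1 : a / Q.Bc < Q.next (a / Q.Bc) :=
    Q.lt_next (Nat.div_lt_of_lt_mul (by rw [mul_comm]; exact ha))
  have hpos : 0 < Q.Bc := by
    rcases Nat.eq_zero_or_pos Q.Bc with h0 | h0
    · rw [h0] at ha; omega
    · exact h0
  calc a < (a / Q.Bc + 1) * Q.Bc := by
        have := Nat.lt_div_mul_add (a := a) hpos
        rw [add_mul]
        omega
    _ ≤ Q.next (a / Q.Bc) * Q.Bc := Nat.mul_le_mul_right _ h1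
    _ ≤ Q.target a v := Nat.le_add_right _ _

theorem GoodAt.congr {B a V : ℕ} {G G' : ℕ → ℕ} (h : Q.GoodAt B G a V) (ha : a < Q.J * Q.Bc)
    (hG : ∀ b, a ≤ b → G' b = G b) : Q.GoodAt B G' a V := by
  have hl : ∀ v, Q.Live G' (Q.target a v) ↔ Q.Live G (Q.target a v) := fun v => by
    unfold Live
    rw [hG _ (lt_target v ha).le]
  unfold GoodAt
  simp only [hl, hG a le_rfl]
  exact h

theorem Path.live {B a : ℕ} {G : ℕ → ℕ} (hG : ∀ b < Q.J * Q.Bc, Q.GoodAt B G b B)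
    (h : Q.Path B a) : Q.Live G a := by
  induction h with
  | done h => exact .inl h
  | step hv ha h _ ih =>
    right
    intro h0
    exact (hG _ ha).1 h0 _ hv _ h ih

/-- The first slots, up to the node `a`, have been filled with items `I i` at positions
`(Xs i, Ys i)`. -/
structure Partial (Q : Par) (a : ℕ) (I Xs Ys : ℕ → ℕ) : Prop where
  lt : ∀ i < a / Q.Bc, I i < Q.n
  col : ∀ i < a / Q.Bc, Q.color (I i) = Q.slot 0 i
  ne : ∀ i < a / Q.Bc, ∀ i' < i, Q.slot 0 i' ≠ Q.slot 0 i
  right : ∀ i < a / Q.Bc, Xs i + Q.w (I i) ≤ Q.N₁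
  top : ∀ i < a / Q.Bc, Ys i + Q.h (I i) ≤ Q.N₂
  below : ∀ i < a / Q.Bc, ∀ x < Q.N₁, Xs i ≤ x → x < Xs i + Q.w (I i) →
    Ys i + Q.h (I i) ≤ Q.cont (a % Q.Bc) x
  sep : ∀ i < a / Q.Bc, ∀ i' < i, Xs i' + Q.w (I i') ≤ Xs i ∨ Xs i + Q.w (I i) ≤ Xs i' ∨
    Ys i' + Q.h (I i') ≤ Ys i ∨ Ys i + Q.h (I i) ≤ Ys i'

/-- The items `I i`, `i < J`, are distinct, and placed at `(Xs i, Ys i)` they form a packing. -/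
structure Solution (Q : Par) (I Xs Ys : ℕ → ℕ) : Prop where
  lt : ∀ i < Q.J, I i < Q.n
  ne : ∀ i < Q.J, ∀ i' < i, I i' ≠ I i
  right : ∀ i < Q.J, Xs i + Q.w (I i) ≤ Q.N₁
  top : ∀ i < Q.J, Ys i + Q.h (I i) ≤ Q.N₂
  sep : ∀ i < Q.J, ∀ i' < i, Xs i' + Q.w (I i') ≤ Xs i ∨ Xs i + Q.w (I i) ≤ Xs i' ∨
    Ys i' + Q.h (I i') ≤ Ys i ∨ Ys i + Q.h (I i) ≤ Ys i'

theorem Partial.solution {a : ℕ} {I Xs Ys : ℕ → ℕ} (h : Q.Partial a I Xs Ys)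
    (ha : Q.J * Q.Bc ≤ a) (hB : 0 < Q.Bc) : Q.Solution I Xs Ys := by
  have hJ : Q.J ≤ a / Q.Bc := (Nat.le_div_iff_mul_le hB).2 ha
  refine ⟨fun i hi => h.lt i (by omega), fun i hi i' hi' he => ?_, fun i hi => h.right i (by omega),
    fun i hi => h.top i (by omega), fun i hi => h.sep i (by omega)⟩
  refine h.ne i (by omega) i' hi' ?_
  rw [← h.col i (by omega), ← h.col i' (by omega), he]

/-- The items of a segment do not overlap the items of earlier segments, which lie below the
contour on which they are placed, and they do not overlap each other. -/
theorem Partial.extend {a v : ℕ} {I Xs Ys I' Xs' Ys' : ℕ → ℕ} (h : Q.Partial a I Xs Ys)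
    (hw : ∀ i < Q.n, 0 < Q.w i) (ha : a < Q.J * Q.Bc) (hr : Q.Run a v Ys')
    (hI : ∀ i < a / Q.Bc, I' i = I i) (hXs : ∀ i < a / Q.Bc, Xs' i = Xs i)
    (hYs : ∀ i < a / Q.Bc, Ys' i = Ys i)
    (hI' : ∀ i, a / Q.Bc ≤ i → i < Q.next (a / Q.Bc) → I' i = Q.it (a / Q.Bc) v i)
    (hXs' : ∀ i, a / Q.Bc ≤ i → i < Q.next (a / Q.Bc) → Xs' i = Q.xx (a / Q.Bc) v i) :
    Q.Partial (Q.target a v) I' Xs' Ys' := by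
  have hpos : 0 < Q.Bc := by
    rcases Nat.eq_zero_or_pos Q.Bc with h0 | h0
    · rw [h0] at ha; omega
    · exact h0
  have hmod : v % Q.Bc < Q.Bc := Nat.mod_lt _ hpos
  have hd : Q.target a v / Q.Bc = Q.next (a / Q.Bc) := by
    unfold target
    rw [add_comm, Nat.add_mul_div_right _ _ hpos, Nat.div_eq_of_lt hmod, zero_add]
  have hm : Q.target a v % Q.Bc = v % Q.Bc := by
    unfold target
    rw [add_comm, Nat.add_mul_mod_self_right, Nat.mod_mod]
  have hjn : a / Q.Bc < Q.next (a / Q.Bc) :=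
    Q.lt_next (Nat.div_lt_of_lt_mul (by rw [mul_comm]; exact ha))
  have hmono := (hr _ le_rfl hjn).2.2.2.2.2.2.2
  unfold Run at hr
  set j := a / Q.Bc
  have old : ∀ i < j, I' i = I i ∧ Xs' i = Xs i ∧ Ys' i = Ys i := fun i hi =>
    ⟨hI i hi, hXs i hi, hYs i hi⟩
  have new : ∀ i, j ≤ i → i < Q.next j → I' i = Q.it j v i ∧ Xs' i = Q.xx j v i ∧
      Ys' i = Q.yy (a % Q.Bc) j v Ys' i ∧ Q.Ok (a % Q.Bc) j v (Ys' i) i := fun i h1 h2 =>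
    ⟨hI' i h1 h2, hXs' i h1 h2, hr i h1 h2⟩
  constructor
  · rw [hd]
    intro i hi
    rcases lt_or_ge i j with hij | hij
    · rw [hI i hij]; exact h.lt i hij
    · rw [hI' i hij hi]; exact (new i hij hi).2.2.2.1
  · rw [hd]
    intro i hi
    rcases lt_or_ge i j with hij | hij
    · rw [hI i hij]; exact h.col i hij
    · rw [hI' i hij hi]; exact (new i hij hi).2.2.2.2.1
  · rw [hd]
    intro i hi
    rcases lt_or_ge i j with hij | hij
    · exact h.ne i hij
    · exact (new i hij hi).2.2.2.2.2.1
  · rw [hd]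
    intro i hi
    rcases lt_or_ge i j with hij | hij
    · rw [hI i hij, hXs i hij]; exact h.right i hij
    · rw [hI' i hij hi, hXs' i hij hi]; exact (new i hij hi).2.2.2.2.2.2.1
  · rw [hd]
    intro i hi
    rcases lt_or_ge i j with hij | hij
    · rw [hI i hij, hYs i hij]; exact h.top i hij
    · rw [hI' i hij hi]; exact (new i hij hi).2.2.2.2.2.2.2.1
  · rw [hd, hm]
    intro i hi x hx
    rcases lt_or_ge i j with hij | hij
    · rw [hI i hij, hXs i hij, hYs i hij]
      exact fun h1 h2 => (h.below i hij x hx h1 h2).trans (hmono x hx)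
    · rw [hI' i hij hi, hXs' i hij hi]
      exact (new i hij hi).2.2.2.2.2.2.2.2.1 x hx
  · rw [hd]
    intro i hi i' hi'
    rcases lt_or_ge i j with hij | hij
    · rw [hI i hij, hXs i hij, hYs i hij, hI i' (by omega), hXs i' (by omega), hYs i' (by omega)]
      exact h.sep i hij i' hi'
    obtain ⟨n1, n2, n3, n4⟩ := new i hij hi
    by_contra hcon
    push Not at hcon
    obtain ⟨c1, c2, c3, c4⟩ := hcon
    rcases lt_or_ge i' j with hij' | hij'
    · have hwi := hw _ (h.lt i' hij')
      have hwi' := hw _ n4.1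
      rw [hI i' hij', hXs i' hij', n2] at c1
      rw [hXs i' hij', n1, n2] at c2
      rw [hI i' hij', hYs i' hij'] at c3
      have hr1 := h.right i' hij'
      have hb := h.below i' hij' (max (Xs i') (Q.xx j v i)) (by omega) (by omega) (by omega)
      have hle : Q.cont (a % Q.Bc) (max (Xs i') (Q.xx j v i)) ≤ Ys' i := by
        rw [n3]
        refine le_trans ?_ (le_max_left _ _)
        refine le_trans ?_ (Finset.le_sup (b := max (Xs i') (Q.xx j v i))
          (Finset.mem_range.2 (by omega)))
        rw [if_pos (by constructor <;> omega)]
      omega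
    · obtain ⟨m1, m2, m3, m4⟩ := new i' hij' (by omega)
      rw [m1, m2, n2] at c1
      rw [m2, n1, n2] at c2
      have h5 := m4.2.2.2.2.1
      have hle : min (Ys' i') Q.N₂ + Q.h (Q.it j v i') ≤ Ys' i := by
        conv_rhs => rw [n3]
        refine le_trans ?_ (le_max_right _ _)
        refine le_trans ?_ (Finset.le_sup (b := i') (Finset.mem_range.2 hi'))
        rw [if_pos ⟨hij', by omega, by omega⟩]
      rw [m1] at c3
      omega

end Par

/-- Only the variables in `R` and the arrays in `A` have been changed. -/
def Frame (R A : List ℕ) (σ₀ σ : View) : Prop :=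
  (∀ r, r ∉ R → σ.e r = σ₀.e r) ∧ ∀ i, i ∉ A → σ.a i = σ₀.a i

namespace Frame

variable {R R' A A' : List ℕ} {σ₀ σ σ' : View}

theorem rfl' : Frame R A σ σ := ⟨fun _ _ => rfl, fun _ _ => rfl⟩

theorem mono (h : Frame R A σ₀ σ) (hR : R ⊆ R') (hA : A ⊆ A') : Frame R' A' σ₀ σ :=
  ⟨fun r hr => h.1 r fun h' => hr (hR h'), fun r hr => h.2 r fun h' => hr (hA h')⟩

theorem trans (h : Frame R A σ₀ σ) (h' : Frame R A σ σ') : Frame R A σ₀ σ' :=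
  ⟨fun r hr => (h'.1 r hr).trans (h.1 r hr), fun r hr => (h'.2 r hr).trans (h.2 r hr)⟩

theorem set (h : Frame R A σ₀ σ) {r : ℕ} (v : ℕ) (hr : r ∈ R) : Frame R A σ₀ (σ.set r v) :=
  ⟨fun r' hr' => by
    rw [View.set_e_of_ne _ _ fun e => hr' (by rw [e]; exact hr)]; exact h.1 r' hr',
    fun i hi => h.2 i hi⟩

theorem store (h : Frame R A σ₀ σ) {B : ℕ} (i v : ℕ) (hB : B ∈ A) :
    Frame R A σ₀ (σ.store B i v) :=
  ⟨fun r' hr' => h.1 r' hr', fun B' hB' => by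
    have : B' ≠ B := fun e => hB' (by rw [e]; exact hB)
    simp only [View.store, Function.update_of_ne this]
    exact h.2 B' hB'⟩

theorem par_eq (h : Frame R A σ₀ σ) (hR : ∀ r ∈ R, 12 ≤ r) (hA : ∀ r ∈ A, 2 ≤ r) :
    par σ.e σ.a = par σ₀.e σ₀.a :=
  par_congr (fun i hi => h.1 i fun h' => by have := hR i h'; omega)
    (h.2 0 fun h' => by have := hA 0 h'; omega) (h.2 1 fun h' => by have := hA 1 h'; omega)

end Frame

theorem SegPost.frame {σ₀ σ : View} (h : SegPost σ₀ σ) :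
    Frame [19, 20, 21, 22] [2, 3, 4] σ₀ σ :=
  ⟨fun r hr => by simp at hr; exact h.e_eq r (by omega) (by omega) (by omega) (by omega),
    fun r hr => by simp at hr; exact h.a_eq r (by omega) (by omega) (by omega)⟩

theorem set_le {σ : View} {X r v : ℕ} (h : ∀ i < 32, σ.e i ≤ X) (hv : v ≤ X) :
    ∀ i < 32, (σ.set r v).e i ≤ X := by
  intro i hi
  by_cases h' : i = r
  · rw [h', View.set_e_self]; exact hv
  · rw [View.set_e_of_ne _ _ h']; exact h i hi

/-- All variables and all nodes are at most `X`. -/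
def Bounded (X : ℕ) (σ : View) : Prop :=
  (∀ i < 32, σ.e i ≤ X) ∧ (σ.e 5 + 1) * σ.e 10 ≤ X ∧ σ.e 14 = σ.e 5 * σ.e 10

theorem Bounded.frame {X : ℕ} {R A : List ℕ} {σ₀ σ : View} (h : Bounded X σ₀)
    (hf : Frame R A σ₀ σ) (hX : ∀ i < 32, σ.e i ≤ X) (hR : ∀ r ∈ R, 15 ≤ r) : Bounded X σ := by
  have e (i : ℕ) (hi : i < 15) : σ.e i = σ₀.e i := hf.1 i fun h' => by have := hR i h'; omega
  refine ⟨hX, ?_, ?_⟩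
  · rw [e 5 (by omega), e 10 (by omega)]; exact h.2.1
  · rw [e 5 (by omega), e 10 (by omega), e 14 (by omega)]; exact h.2.2

/-- The entry of the table for one node is computed by going through all choices. -/
theorem spec_node :
    Spec 32 (fun (σ₀ : View) X σ => σ = σ₀ ∧ Bounded X σ₀ ∧ σ₀.e 17 < σ₀.e 14)
      fun σ₀ X σ => Frame [18, 19, 20, 21, 22] [2, 3, 4, 5] σ₀ σ ∧ (∀ i < 32, σ.e i ≤ X) ∧
        (∀ b, b ≠ σ₀.e 17 → σ.a 5 b = σ₀.a 5 b) ∧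
        (par σ₀.e σ₀.a).GoodAt (σ₀.e 12) (σ.a 5) (σ₀.e 17) (σ₀.e 12) := by
  have v (i : ℕ) (hi : i < 32 := by omega) : PolyTime 32 fun e _ => e i := .var hi
  let R := [18, 19, 20, 21, 22]
  let A := [2, 3, 4, 5]
  let Inv : View → ℕ → ℕ → View → Prop := fun σ₀ X t σ =>
    Bounded X σ₀ ∧ σ₀.e 17 < σ₀.e 14 ∧ Frame R A σ₀ σ ∧ (∀ i < 32, σ.e i ≤ X) ∧ σ.e 18 = t ∧
      (∀ b, b ≠ σ₀.e 17 → σ.a 5 b = σ₀.a 5 b) ∧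
      (par σ₀.e σ₀.a).GoodAt (σ₀.e 12) (σ.a 5) (σ₀.e 17) t
  refine Spec.store_seq 5 (v 17) (.const 0) ?_ ?_
  · rintro σ₀ X _ - ⟨rfl, h⟩
    exact h.1.1
  refine Spec.seq (Mid := fun σ₀ X σ => Inv σ₀ X 0 σ) (Spec.assign 18 (by omega) (.const 0) ?_) ?_
  · rintro σ₀ X _ - ⟨σ, ⟨rfl, h1, h2⟩, rfl⟩
    refine ⟨h1.1, h1, h2, (Frame.rfl'.store _ _ (by decide)).set _ (by decide),
      set_le (by exact h1.1) (by omega), ?_, fun b hb => ?_, fun _ v hv => by omega, fun h => ?_⟩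
    · rw [View.set_e_self]
    · simp [View.store, hb]
    · exact absurd (by simp [View.store]) h
  refine (Spec.loop (n := fun σ₀ => σ₀.e 12) (Inv := Inv) 18 12 (by omega) (by omega) ?_ ?_
    ?_).conseq ?_
  · rintro σ₀ X i σ ⟨-, -, h3, -, h5, -⟩ hi
    rw [h5, h3.1 12 (by decide)]
  · rintro σ₀ X σ ⟨h1, -⟩
    exact h1.1 12 (by omega)
  · -- one choice
    refine Spec.seq (Mid := fun (θ : View × ℕ) X σ' => ∃ σ, (Inv θ.1 X θ.2 σ ∧ θ.2 < θ.1.e 12) ∧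
      SegPost σ σ' ∧ ∀ i < 32, σ'.e i ≤ X) ?_ ?_
    · obtain ⟨P, d, hP⟩ := spec_segment
      refine ⟨P, d, fun θ X s hX hs => (hP _ X s hX ⟨rfl, ?_⟩).mono le_rfl fun s' h => ⟨_, hs, h⟩⟩
      obtain ⟨⟨h1, h2, h3, h4, h5, -⟩, -⟩ := hs
      have hB := h1.frame h3 h4 (by decide)
      refine ⟨h4, hB.2.1, ?_⟩
      rw [← hB.2.2, h3.1 17 (by decide), h3.1 14 (by decide)]
      exact h2
    · refine Spec.ite (p := fun e a => e 21 ≠ 0 ∧ (¬(e 22 < e 14 ∧ ¬min (a 5 (e 22)) 1 ≠ 0)))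
        ((PolyDec.ne_zero (v 21)).and ((PolyDec.lt (v 22) (v 14)).and
          (PolyDec.ne_zero (.read 5 (v 22) (.const 1))).not).not) ?_ ?_ ?_
      · rintro θ X σ ⟨_, -, -, h⟩
        exact h
      · refine Spec.store 5 (v 17) ((v 18).add (.const 1)) ?_
        rintro ⟨σ₀, t⟩ X σ' - ⟨⟨σ, ⟨⟨h1, h2, h3, h4, h5, h6, h7⟩, h8⟩, h9, h10⟩, h11, h12⟩
        dsimp only at h1 h2 h3 h4 h5 h6 h7 h8 ⊢
        have hf : Frame R A σ₀ σ' := h3.trans (h9.frame.mono (by decide) (by decide))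
        have hp := h3.par_eq (by decide) (by decide)
        have e17 : σ'.e 17 = σ₀.e 17 := hf.1 17 (by decide)
        have e18 : σ'.e 18 = t := (h9.frame.1 18 (by decide)).trans h5
        have a5 : σ'.a 5 = σ.a 5 := h9.a_eq 5 (by decide) (by decide) (by decide)
        have hrun := h9.run h11
        have htar := h9.target
        rw [hp, h3.1 17 (by decide), h5] at hrun htar
        have ha : σ₀.e 17 < (par σ₀.e σ₀.a).J * (par σ₀.e σ₀.a).Bc := by
          have := h1.2.2
          rw [this] at h2
          exact h2
        have hne := (Par.lt_target t ha).ne'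
        rw [e17, e18]
        refine ⟨h10, h1, h2, (hf.store _ _ (by decide)).set _ (by decide), set_le h10 ?_, ?_, ?_,
          ?_, ?_⟩
        · have := h1.1 12 (by omega)
          rw [View.store_e, e18]
          omega
        · rw [View.set_e_self, View.store_e, e18]
        · intro b hb
          rw [← h6 b hb, ← a5]
          simp [View.store, hb]
        · intro h0
          simp [View.store] at h0
        · intro _
          have hs : ((σ'.store 5 (σ₀.e 17) (t + 1)).set 18
            ((σ'.store 5 (σ₀.e 17) (t + 1)).e 18 + 1)).a 5 (σ₀.e 17) = t + 1 := by
            simp [View.store]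
          rw [hs, Nat.add_sub_cancel]
          refine ⟨h8, ⟨_, hrun⟩, ?_⟩
          by_cases hfin : σ'.e 22 < σ'.e 14
          · right
            have : σ'.a 5 (σ'.e 22) ≠ 0 := fun h0 => h12 ⟨hfin, by simp [h0]⟩
            rw [htar] at this
            simpa [View.store, hne] using this
          · left
            rw [htar, hf.1 14 (by decide), h1.2.2] at hfin
            exact not_lt.1 hfin
      · refine Spec.skip ?_
        rintro ⟨σ₀, t⟩ X σ' - ⟨⟨σ, ⟨⟨h1, h2, h3, h4, h5, h6, h7⟩, h8⟩, h9, h10⟩, h11⟩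
        dsimp only at h1 h2 h3 h4 h5 h6 h7 h8 ⊢
        have hf : Frame R A σ₀ σ' := h3.trans (h9.frame.mono (by decide) (by decide))
        have hp := h3.par_eq (by decide) (by decide)
        have e18 : σ'.e 18 = t := (h9.frame.1 18 (by decide)).trans h5
        have a5 : σ'.a 5 = σ.a 5 := h9.a_eq 5 (by decide) (by decide) (by decide)
        have htar := h9.target
        have hok := h9.ok
        rw [hp, h3.1 17 (by decide), h5] at htar hok
        refine ⟨h1, h2, hf.set _ (by decide), set_le h10 ?_, ?_, ?_, ?_⟩
        · have := h1.1 12 (by omega)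
          rw [e18]
          omega
        · rw [View.set_e_self, e18]
        · intro b hb
          rw [View.set_a, a5]
          exact h6 b hb
        · rw [View.set_a, a5]
          refine ⟨fun h0 w hw Y hY => ?_, h7.2⟩
          rcases Nat.lt_succ_iff_lt_or_eq.1 hw with hw | rfl
          · exact h7.1 h0 w hw Y hY
          · intro hlive
            refine h11 ⟨hok Y hY, fun hc => ?_⟩
            rw [htar, a5, hf.1 14 (by decide), h1.2.2] at hc
            rcases hlive with hl | hl
            · exact absurd hc.1 (not_lt.2 hl)
            · have := hc.2
              omega
  · intro σ₀ X
    exact ⟨σ₀, fun σ _ h => h, fun σ ⟨_, _, h3, h4, _, h6, h7⟩ => ⟨h3, h4, h6, h7⟩⟩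

end Knapsack

/-! ### The search -/

namespace Knapsack

open RAM

namespace Par

variable {Q : Par}

theorem target_div {a v : ℕ} (hB : 0 < Q.Bc) : Q.target a v / Q.Bc = Q.next (a / Q.Bc) := by
  unfold target
  rw [add_comm, Nat.add_mul_div_right _ _ hB, Nat.div_eq_of_lt (Nat.mod_lt _ hB), zero_add]

end Par

/-- The table is filled from its last entry down to its first one. -/
theorem spec_table :
    Spec 32 (fun (σ₀ : View) X σ => σ = σ₀ ∧ Bounded X σ₀)
      fun σ₀ X σ => Frame [16, 17, 18, 19, 20, 21, 22] [2, 3, 4, 5] σ₀ σ ∧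
        (∀ i < 32, σ.e i ≤ X) ∧
        ∀ a < σ₀.e 14, (par σ₀.e σ₀.a).GoodAt (σ₀.e 12) (σ.a 5) a (σ₀.e 12) := by
  have v (i : ℕ) (hi : i < 32 := by omega) : PolyTime 32 fun e _ => e i := .var hi
  let R := [16, 17, 18, 19, 20, 21, 22]
  let A := [2, 3, 4, 5]
  let Inv : View → ℕ → ℕ → View → Prop := fun σ₀ X t σ =>
    Bounded X σ₀ ∧ Frame R A σ₀ σ ∧ (∀ i < 32, σ.e i ≤ X) ∧ σ.e 16 = t ∧
      ∀ a < σ₀.e 14, σ₀.e 14 ≤ a + t →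
        (par σ₀.e σ₀.a).GoodAt (σ₀.e 12) (σ.a 5) a (σ₀.e 12)
  refine Spec.seq (Mid := fun σ₀ X σ => Inv σ₀ X 0 σ) (Spec.assign 16 (by omega) (.const 0) ?_) ?_
  · rintro σ₀ X _ - ⟨rfl, h1⟩
    refine ⟨h1.1, h1, Frame.rfl'.set _ (by decide), set_le h1.1 (by omega), ?_, fun a h2 h3 => ?_⟩
    · rw [View.set_e_self]
    · omega
  refine (Spec.loop (n := fun σ₀ => σ₀.e 14) (Inv := Inv) 16 14 (by omega) (by omega) ?_ ?_
    ?_).conseq ?_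
  · rintro σ₀ X i σ ⟨-, h3, -, h5, -⟩ hi
    rw [h5, h3.1 14 (by decide)]
  · rintro σ₀ X σ ⟨h1, -⟩
    exact h1.1 14 (by omega)
  · refine Spec.assign_seq 17 (by omega) (((v 14).sub (.const 1)).sub (v 16)) ?_ ?_
    · rintro θ X σ - ⟨⟨-, -, h, -⟩, -⟩
      exact h
    obtain ⟨P, d, hP⟩ := spec_node
    refine ⟨P, d, ?_⟩
    rintro ⟨σ₀, t⟩ X s hX ⟨σ, ⟨⟨h1, h2, h3, h4, h5⟩, h6⟩, hs⟩
    dsimp only at h1 h2 h3 h4 h5 h6 ⊢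
    have e14 : σ.e 14 = σ₀.e 14 := h2.1 14 (by decide)
    have hf : Frame R A σ₀ (s.view 32) := by rw [hs]; exact h2.set _ (by decide)
    have h17 : (s.view 32).e 17 = σ₀.e 14 - 1 - t := by rw [hs, View.set_e_self, e14, h4]
    have hX : ∀ i < 32, (s.view 32).e i ≤ X := by
      rw [hs]
      exact set_le h3 (by have := h3 14 (by omega); omega)
    have ha5 : (s.view 32).a = σ.a := by rw [hs, View.set_a]
    have hB := h1.frame hf hX (by decide)
    have s14 : (s.view 32).e 14 = σ₀.e 14 := hf.1 14 (by decide)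
    have s12 : (s.view 32).e 12 = σ₀.e 12 := hf.1 12 (by decide)
    have s16 : (s.view 32).e 16 = t := by
      rw [hs, View.set_e_of_ne _ _ (by omega), h4]
    have sp := hf.par_eq (by decide) (by decide)
    refine (hP _ X s (by assumption) ⟨rfl, hB, ?_⟩).mono le_rfl ?_
    · rw [h17, s14]
      omega
    · rintro s' ⟨q1, q2, q3, q4⟩
      rw [h17] at q3 q4
      rw [s12, sp] at q4
      have e16 : (s'.view 32).e 16 = t := (q1.1 16 (by decide)).trans s16
      have hf' : Frame R A σ₀ (s'.view 32) := hf.trans (q1.mono (by decide) (by decide))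
      refine ⟨h1, hf'.set _ (by decide), set_le q2 ?_, ?_, fun a ha hat => ?_⟩
      · have := h1.1 14 (by omega)
        rw [e16]; omega
      · rw [View.set_e_self, e16]
      · rw [View.set_a]
        rcases eq_or_ne a (σ₀.e 14 - 1 - t) with rfl | hne
        · exact q4
        · refine (h5 a ha (by omega)).congr (by have := h1.2.2; rw [this] at ha; exact ha)
            fun b hb => ?_
          rw [q3 b (by omega), ha5]
  · intro σ₀ X
    exact ⟨σ₀, fun σ _ h => h, fun σ ⟨_, h3, h4, _, h7⟩ =>
      ⟨h3, h4, fun a ha => h7 a ha (by omega)⟩⟩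

/-- A packing is read off from a table whose entry for the first node is not `0`. -/
theorem spec_rebuild :
    Spec 32 (fun (σ₀ : View) X σ => σ = σ₀ ∧ Bounded X σ₀ ∧ 0 < σ₀.e 10 ∧
        (∀ i < (par σ₀.e σ₀.a).n, 0 < (par σ₀.e σ₀.a).w i) ∧
        (∀ a < σ₀.e 14, (par σ₀.e σ₀.a).GoodAt (σ₀.e 12) (σ₀.a 5) a (σ₀.e 12)) ∧
        (par σ₀.e σ₀.a).Live (σ₀.a 5) 0)
      fun σ₀ X σ => Frame [17, 18, 19, 20, 21, 22, 23] [2, 3, 4] σ₀ σ ∧ (∀ i < 32, σ.e i ≤ X) ∧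
        (par σ₀.e σ₀.a).Solution (σ.a 2) (σ.a 3) (σ.a 4) := by
  have v (i : ℕ) (hi : i < 32 := by omega) : PolyTime 32 fun e _ => e i := .var hi
  let R := [17, 18, 19, 20, 21, 22, 23]
  let A := [2, 3, 4]
  let Hyp : View → ℕ → Prop := fun σ₀ X => Bounded X σ₀ ∧ 0 < σ₀.e 10 ∧
        (∀ i < (par σ₀.e σ₀.a).n, 0 < (par σ₀.e σ₀.a).w i) ∧
        (∀ a < σ₀.e 14, (par σ₀.e σ₀.a).GoodAt (σ₀.e 12) (σ₀.a 5) a (σ₀.e 12))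
  let Inv : View → ℕ → ℕ → View → Prop := fun σ₀ X t σ =>
    Hyp σ₀ X ∧ Frame R A σ₀ σ ∧ (∀ i < 32, σ.e i ≤ X) ∧ σ.e 23 = t ∧
      (par σ₀.e σ₀.a).Live (σ₀.a 5) (σ.e 17) ∧
      (par σ₀.e σ₀.a).Partial (σ.e 17) (σ.a 2) (σ.a 3) (σ.a 4) ∧
      (σ₀.e 14 ≤ σ.e 17 ∨ t ≤ σ.e 17 / σ₀.e 10)
  refine Spec.assign_seq 17 (by omega) (.const 0) ?_ ?_
  · rintro σ₀ X _ - ⟨rfl, h, -⟩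
    exact h.1
  refine Spec.seq (Mid := fun σ₀ X σ => Inv σ₀ X 0 σ) (Spec.assign 23 (by omega) (.const 0) ?_) ?_
  · rintro σ₀ X _ - ⟨σ, ⟨rfl, h1, h2, h3, h4, h5⟩, rfl⟩
    have h17 : ((σ.set 17 0).set 23 0).e 17 = 0 := by
      rw [View.set_e_of_ne _ _ (by omega), View.set_e_self]
    refine ⟨set_le h1.1 (by omega), ⟨h1, h2, h3, h4⟩,
      (Frame.rfl'.set _ (by decide)).set _ (by decide),
      set_le (set_le h1.1 (by omega)) (by omega), ?_, ?_, ?_, ?_⟩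
    · rw [View.set_e_self]
    · rw [h17]; exact h5
    · rw [h17]
      constructor <;> simp
    · right; exact Nat.zero_le _
  refine (Spec.loop (n := fun σ₀ => σ₀.e 5) (Inv := Inv) 23 5 (by omega) (by omega) ?_ ?_
    ?_).conseq ?_
  · rintro σ₀ X i σ ⟨-, h3, -, h5, -⟩ hi
    rw [h5, h3.1 5 (by decide)]
  · rintro σ₀ X σ ⟨h1, -⟩
    exact h1.1.1 5 (by omega)
  · refine Spec.ite (PolyDec.lt (v 17) (v 14)) ?_ ?_ ?_
    · rintro θ X σ ⟨⟨-, -, h, -⟩, -⟩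
      exact h
    · refine Spec.assign_seq 18 (by omega) ((PolyTime.read 5 (v 17) (v 12)).sub (.const 1)) ?_ ?_
      · rintro θ X σ - ⟨⟨⟨-, -, h, -⟩, -⟩, -⟩
        exact h
      refine Spec.seq (Mid := fun (θ : View × ℕ) X σ' => ∃ σ1 σ, ((Inv θ.1 X θ.2 σ ∧
        θ.2 < θ.1.e 5) ∧ σ.e 17 < σ.e 14) ∧ σ1 = σ.set 18 (min (σ.a 5 (σ.e 17)) (σ.e 12) - 1) ∧
        SegPost σ1 σ' ∧ ∀ i < 32, σ'.e i ≤ X) ?_ ?_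
      · obtain ⟨P, d, hP⟩ := spec_segment
        refine ⟨P, d, ?_⟩
        rintro ⟨σ₀, t⟩ X s hX ⟨σ, hσ, hs⟩
        refine (hP _ X s hX ⟨rfl, ?_⟩).mono le_rfl fun s' h => ⟨_, _, hσ, hs, h⟩
        obtain ⟨⟨⟨h1, h2, h3, h4, h5, h6, h7⟩, h8⟩, h9⟩ := hσ
        dsimp only at h1 h2 h3 h4 h5 h6 h7 h8 h9
        have hf : Frame R A σ₀ (s.view 32) := by rw [hs]; exact h2.set _ (by decide)
        have hX : ∀ i < 32, (s.view 32).e i ≤ X := by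
          rw [hs]
          exact set_le h3 (by have := h3 12 (by omega); omega)
        have hB := h1.1.frame hf hX (by decide)
        refine ⟨hX, hB.2.1, ?_⟩
        rw [← hB.2.2, hs, View.set_e_of_ne _ _ (by omega), View.set_e_of_ne _ _ (by omega)]
        exact h9
      · refine Spec.assign 17 (by omega) (v 22) ?_
        rintro ⟨σ₀, t⟩ X σ' - ⟨σ1, σ, ⟨⟨⟨h1, h2, h3, h4, h5, h6, h7⟩, h8⟩, h9⟩, hs, h10, h11⟩
        dsimp only at h1 h2 h3 h4 h5 h6 h7 h8 h9 ⊢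
        have e14 : σ.e 14 = σ₀.e 14 := h2.1 14 (by decide)
        have e12 : σ.e 12 = σ₀.e 12 := h2.1 12 (by decide)
        have e10 : σ.e 10 = σ₀.e 10 := h2.1 10 (by decide)
        have a5 : σ.a 5 = σ₀.a 5 := h2.2 5 (by decide)
        have hf1 : Frame R A σ₀ σ1 := by rw [hs]; exact h2.set _ (by decide)
        have hf' : Frame R A σ₀ σ' := hf1.trans (h10.frame.mono (by decide) (by decide))
        have hp1 := hf1.par_eq (by decide) (by decide)
        rw [e14] at h9
        have haJ : σ.e 17 < (par σ₀.e σ₀.a).J * (par σ₀.e σ₀.a).Bc := by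
          have := h1.1.2.2
          rw [this] at h9
          exact h9
        have hG := h1.2.2.2 _ h9
        have hne : σ₀.a 5 (σ.e 17) ≠ 0 := by
          rcases h5 with h5 | h5
          · exact absurd haJ (not_lt.2 h5)
          · exact h5
        obtain ⟨g1, ⟨Y, g2⟩, g3⟩ := hG.2 hne
        have s17 : σ1.e 17 = σ.e 17 := by rw [hs, View.set_e_of_ne _ _ (by omega)]
        have s18 : σ1.e 18 = σ₀.a 5 (σ.e 17) - 1 := by
          rw [hs, View.set_e_self, a5, e12, min_eq_left g1]
        have s10 : σ1.e 10 = σ₀.e 10 := hf1.1 10 (by decide)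
        have hA1 : ∀ B, σ1.a B = σ.a B := fun B => by rw [hs, View.set_a]
        have hBc : (par σ₀.e σ₀.a).Bc = σ₀.e 10 := rfl
        have k1 := h10.ok Y (by rw [hp1, s17, s18]; exact g2)
        have k2 := h10.run k1
        have k3 := h10.target
        have k4 := h10.out
        have k5 := h10.it
        have k6 := h10.xx
        rw [hp1, s17, s18] at k2 k3
        rw [s17, s10] at k4
        rw [hp1, s17, s10, s18, ← hBc] at k5 k6
        refine ⟨h11, h1, hf'.set _ (by decide) |>.set _ (by decide), set_le (set_le h11
          (h11 22 (by omega))) ?_, ?_, ?_, ?_, ?_⟩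
        · have : σ'.e 23 = t := by
            rw [h10.e_eq 23 (by omega) (by omega) (by omega) (by omega), hs,
              View.set_e_of_ne _ _ (by omega), h4]
          rw [View.set_e_of_ne _ _ (by omega), this]
          have := h1.1.1 5 (by omega)
          omega
        · have : σ'.e 23 = t := by
            rw [h10.e_eq 23 (by omega) (by omega) (by omega) (by omega), hs,
              View.set_e_of_ne _ _ (by omega), h4]
          rw [View.set_e_self, View.set_e_of_ne _ _ (by omega), this]
        · rw [View.set_e_of_ne _ _ (by omega), View.set_e_self, k3]
          exact g3
        · rw [View.set_e_of_ne _ _ (by omega), View.set_e_self, k3]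
          simp only [View.set_a]
          refine h6.extend h1.2.2.1 haJ k2 ?_ ?_ ?_ k5 k6
          · intro i hi; rw [k4 2 i hi, hA1]
          · intro i hi; rw [k4 3 i hi, hA1]
          · intro i hi; rw [k4 4 i hi, hA1]
        · rw [View.set_e_of_ne _ _ (by omega), View.set_e_self, k3, ← hBc,
            Par.target_div h1.2.1]
          right
          rcases h7 with h7 | h7
          · omega
          · rw [← hBc] at h7
            have := (par σ₀.e σ₀.a).lt_next (j := σ.e 17 / (par σ₀.e σ₀.a).Bc)
              (Nat.div_lt_of_lt_mul (by rw [mul_comm]; exact haJ))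
            omega
    · refine Spec.skip ?_
      rintro ⟨σ₀, t⟩ X σ - ⟨⟨⟨h1, h2, h3, h4, h5, h6, h7⟩, h8⟩, h9⟩
      dsimp only at h1 h2 h3 h4 h5 h6 h7 h8 h9 ⊢
      have h17 : (σ.set 23 (σ.e 23 + 1)).e 17 = σ.e 17 := by
        rw [View.set_e_of_ne _ _ (by omega)]
      rw [h2.1 14 (by decide)] at h9
      refine ⟨h1, h2.set _ (by decide), set_le h3 ?_, ?_, ?_, ?_, ?_⟩
      · have := h1.1.1 5 (by omega)
        omega
      · rw [View.set_e_self, h4]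
      · rw [h17]; exact h5
      · rw [h17]; exact h6
      · rw [h17]; left; omega
  · intro σ₀ X
    refine ⟨σ₀, fun σ _ h => h, fun σ ⟨h1, h3, h4, _, _, h6, h7⟩ => ⟨h3, h4, h6.solution ?_ h1.2.1⟩⟩
    have hBc : (par σ₀.e σ₀.a).J * (par σ₀.e σ₀.a).Bc = σ₀.e 14 := h1.1.2.2.symm
    rcases h7 with h7 | h7
    · rw [hBc]; exact h7
    · exact (Nat.le_div_iff_mul_le h1.2.1).1 h7

/-- The search data with the guess `Γ`. -/
def Par.guess (Q : Par) (Γ : ℕ) : Par := { Q with Γ := Γ }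

/-- All guesses are tried, until a packing is found. -/
theorem spec_search :
    Spec 32 (fun (σ₀ : View) X σ => σ = σ₀ ∧ Bounded X σ₀ ∧ 0 < σ₀.e 10 ∧
        (∀ i < (par σ₀.e σ₀.a).n, 0 < (par σ₀.e σ₀.a).w i))
      fun σ₀ _ σ => σ.e 5 = σ₀.e 5 ∧ (σ.e 15 = 0 ∨ σ.e 15 = 1) ∧
        (σ.e 15 = 0 → ∀ Γ < σ₀.e 13, ¬((par σ₀.e σ₀.a).guess Γ).Path (σ₀.e 12) 0) ∧
        (σ.e 15 ≠ 0 → (par σ₀.e σ₀.a).Solution (σ.a 2) (σ.a 3) (σ.a 4)) := by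
  have v (i : ℕ) (hi : i < 32 := by omega) : PolyTime 32 fun e _ => e i := .var hi
  let R := [11, 15, 16, 17, 18, 19, 20, 21, 22, 23]
  let A := [2, 3, 4, 5]
  let Inv : View → ℕ → ℕ → View → Prop := fun σ₀ X t σ =>
    (Bounded X σ₀ ∧ 0 < σ₀.e 10 ∧ (∀ i < (par σ₀.e σ₀.a).n, 0 < (par σ₀.e σ₀.a).w i)) ∧
      Frame R A σ₀ σ ∧ (∀ i < 32, σ.e i ≤ X) ∧ σ.e 11 = t ∧ (σ.e 15 = 0 ∨ σ.e 15 = 1) ∧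
      (σ.e 15 = 0 → ∀ Γ < t, ¬((par σ₀.e σ₀.a).guess Γ).Path (σ₀.e 12) 0) ∧
      (σ.e 15 ≠ 0 → (par σ₀.e σ₀.a).Solution (σ.a 2) (σ.a 3) (σ.a 4))
  have hpar : ∀ {σ₀ σ : View} {t : ℕ}, Frame R A σ₀ σ → σ.e 11 = t →
      par σ.e σ.a = (par σ₀.e σ₀.a).guess t := by
    intro σ₀ σ t hf h11
    have e (i : ℕ) (hi : i ∉ R) : σ.e i = σ₀.e i := hf.1 i hi
    simp only [par, Par.guess, e 0 (by decide), e 1 (by decide), e 2 (by decide), e 3 (by decide),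
      e 4 (by decide), e 5 (by decide), e 7 (by decide), e 8 (by decide), e 9 (by decide),
      e 10 (by decide), h11, hf.2 0 (by decide), hf.2 1 (by decide)]
  have hbd : ∀ {X : ℕ} {σ₀ σ : View}, Bounded X σ₀ → Frame R A σ₀ σ → (∀ i < 32, σ.e i ≤ X) →
      Bounded X σ := by
    intro X σ₀ σ h hf hX
    refine ⟨hX, ?_, ?_⟩
    · rw [hf.1 5 (by decide), hf.1 10 (by decide)]; exact h.2.1
    · rw [hf.1 5 (by decide), hf.1 10 (by decide), hf.1 14 (by decide)]; exact h.2.2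
  refine Spec.assign_seq 15 (by omega) (.const 0) ?_ ?_
  · rintro σ₀ X _ - ⟨rfl, h, -⟩
    exact h.1
  refine Spec.seq (Mid := fun σ₀ X σ => Inv σ₀ X 0 σ) (Spec.assign 11 (by omega) (.const 0) ?_) ?_
  · rintro σ₀ X _ - ⟨σ, ⟨rfl, h1, h2, h3⟩, rfl⟩
    have h15 : ((σ.set 15 0).set 11 0).e 15 = 0 := by
      rw [View.set_e_of_ne _ _ (by omega), View.set_e_self]
    refine ⟨set_le h1.1 (by omega), ⟨h1, h2, h3⟩,
      (Frame.rfl'.set _ (by decide)).set _ (by decide),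
      set_le (set_le h1.1 (by omega)) (by omega), ?_, .inl h15, fun _ Γ hΓ => by omega,
      fun h => absurd h15 h⟩
    rw [View.set_e_self]
  refine (Spec.loop (n := fun σ₀ => σ₀.e 13) (Inv := Inv) 11 13 (by omega) (by omega) ?_ ?_
    ?_).conseq ?_
  · rintro σ₀ X i σ ⟨-, h3, -, h5, -⟩ hi
    rw [h5, h3.1 13 (by decide)]
  · rintro σ₀ X σ ⟨h1, -⟩
    exact h1.1.1 13 (by omega)
  · refine Spec.ite (PolyDec.ne_zero (v 15)) ?_ ?_ ?_
    · rintro θ X σ ⟨⟨-, -, h, -⟩, -⟩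
      exact h
    · refine Spec.skip ?_
      rintro ⟨σ₀, t⟩ X σ - ⟨⟨⟨h1, h2, h3, h4, h5, h6, h7⟩, h8⟩, h9⟩
      dsimp only at h1 h2 h3 h4 h5 h6 h7 h8 h9 ⊢
      have h15 : (σ.set 11 (σ.e 11 + 1)).e 15 = σ.e 15 := by
        rw [View.set_e_of_ne _ _ (by omega)]
      refine ⟨h1, h2.set _ (by decide), set_le h3 ?_, ?_, ?_, ?_, ?_⟩
      · have := h1.1.1 13 (by omega)
        omega
      · rw [View.set_e_self, h4]
      · rw [h15]; exact h5
      · rw [h15]; exact fun h => absurd h h9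
      · rw [h15]; exact h7
    · refine Spec.seq (Mid := fun (θ : View × ℕ) X σ' => (Bounded X θ.1 ∧ 0 < θ.1.e 10 ∧
          (∀ i < (par θ.1.e θ.1.a).n, 0 < (par θ.1.e θ.1.a).w i)) ∧
          Frame R A θ.1 σ' ∧ (∀ i < 32, σ'.e i ≤ X) ∧ σ'.e 11 = θ.2 ∧ σ'.e 15 = 0 ∧
          (∀ Γ < θ.2, ¬((par θ.1.e θ.1.a).guess Γ).Path (θ.1.e 12) 0) ∧ θ.2 < θ.1.e 13 ∧
          ∀ a < θ.1.e 14,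
            ((par θ.1.e θ.1.a).guess θ.2).GoodAt (θ.1.e 12) (σ'.a 5) a (θ.1.e 12)) ?_ ?_
      · obtain ⟨P, d, hP⟩ := spec_table
        refine ⟨P, d, ?_⟩
        rintro ⟨σ₀, t⟩ X s hX ⟨⟨⟨h1, h2, h3, h4, h5, h6, h7⟩, h8⟩, h9⟩
        dsimp only at h1 h2 h3 h4 h5 h6 h7 h8 h9 ⊢
        rw [not_not] at h9
        refine (hP _ X s hX ⟨rfl, hbd h1.1 h2 h3⟩).mono le_rfl ?_
        rintro s' ⟨q1, q2, q3⟩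
        rw [hpar h2 h4, h2.1 14 (by decide), h2.1 12 (by decide)] at q3
        exact ⟨h1, h2.trans (q1.mono (by decide) (by decide)), q2,
          (q1.1 11 (by decide)).trans h4, (q1.1 15 (by decide)).trans h9, h6 h9, h8, q3⟩
      · refine Spec.ite (p := fun e a => ¬(0 < e 14 ∧ ¬min (a 5 0) 1 ≠ 0))
          ((PolyDec.lt (.const 0) (v 14)).and
          (PolyDec.ne_zero (.read 5 (.const 0) (.const 1))).not).not ?_ ?_ ?_
        · rintro θ X σ ⟨-, -, h, -⟩
          exact h
        · refine Spec.seq (Mid := fun (θ : View × ℕ) X σ' => (Bounded X θ.1 ∧ 0 < θ.1.e 10 ∧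
            (∀ i < (par θ.1.e θ.1.a).n, 0 < (par θ.1.e θ.1.a).w i)) ∧
            Frame R A θ.1 σ' ∧ (∀ i < 32, σ'.e i ≤ X) ∧ σ'.e 11 = θ.2 ∧ θ.2 < θ.1.e 13 ∧
            (par θ.1.e θ.1.a).Solution (σ'.a 2) (σ'.a 3) (σ'.a 4)) ?_ ?_
          · obtain ⟨P, d, hP⟩ := spec_rebuild
            refine ⟨P, d, ?_⟩
            rintro ⟨σ₀, t⟩ X s hX ⟨⟨h1, h2, h3, h4, h5, h6, h7, h8⟩, h9⟩
            dsimp only at h1 h2 h3 h4 h5 h6 h7 h8 h9 ⊢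
            have hp := hpar h2 h4
            refine (hP _ X s hX ⟨rfl, hbd h1.1 h2 h3, ?_, ?_, ?_, ?_⟩).mono le_rfl ?_
            · rw [h2.1 10 (by decide)]; exact h1.2.1
            · rw [hp]; exact h1.2.2
            · rw [hp, h2.1 14 (by decide), h2.1 12 (by decide)]; exact h8
            · rw [hp]
              rw [h2.1 14 (by decide)] at h9
              by_cases h0 : (s.view 32).a 5 0 = 0
              · left
                refine Nat.le_of_not_lt fun h10 => h9 ⟨?_, by simp [h0]⟩
                rw [h1.1.2.2]
                exact h10
              · exact .inr h0
            · rintro s' ⟨q1, q2, q3⟩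
              rw [hp] at q3
              exact ⟨h1, h2.trans (q1.mono (by decide) (by decide)), q2,
                (q1.1 11 (by decide)).trans h4, h7, ⟨q3.lt, q3.ne, q3.right, q3.top, q3.sep⟩⟩
          · refine Spec.assign 15 (by omega) (.const 1) ?_
            rintro ⟨σ₀, t⟩ X σ h2X ⟨h1, h2, h3, h4, h5, h6⟩
            dsimp only at h1 h2 h3 h4 h5 h6 ⊢
            have h15 : ((σ.set 15 1).set 11 ((σ.set 15 1).e 11 + 1)).e 15 = 1 := by
              rw [View.set_e_of_ne _ _ (by omega), View.set_e_self]
            have h11 : (σ.set 15 1).e 11 = t := by rw [View.set_e_of_ne _ _ (by omega), h4]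
            refine ⟨h3, h1, (h2.set _ (by decide)).set _ (by decide),
              set_le (set_le h3 (by omega)) ?_, ?_, .inr h15, fun h => ?_, fun _ => h6⟩
            · have := h1.1.1 13 (by omega)
              omega
            · rw [View.set_e_self, h11]
            · rw [h15] at h; exact absurd h one_ne_zero
        · refine Spec.skip ?_
          rintro ⟨σ₀, t⟩ X σ - ⟨⟨h1, h2, h3, h4, h5, h6, h7, h8⟩, h9⟩
          dsimp only at h1 h2 h3 h4 h5 h6 h7 h8 h9 ⊢
          have h15 : (σ.set 11 (σ.e 11 + 1)).e 15 = 0 := by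
            rw [View.set_e_of_ne _ _ (by omega), h5]
          refine ⟨h1, h2.set _ (by decide), set_le h3 ?_, ?_, .inl h15, fun _ Γ hΓ hp => ?_,
            fun h => absurd h15 h⟩
          · have := h1.1.1 13 (by omega)
            omega
          · rw [View.set_e_self, h4]
          · rcases Nat.lt_succ_iff_lt_or_eq.1 hΓ with h | rfl
            · exact h6 Γ h hp
            · rw [not_not, h2.1 14 (by decide)] at h9
              have hl := hp.live (G := σ.a 5) fun b hb => h8 b (by rw [h1.1.2.2]; exact hb)
              rcases hl with hl | hl
              · have h10 := h9.1
                rw [h1.1.2.2] at h10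
                exact absurd h10 (not_lt.2 hl)
              · have := h9.2
                omega
  · intro σ₀ X
    exact ⟨σ₀, fun σ _ h => h, fun σ ⟨_, h3, _, _, h5, h6, h7⟩ =>
      ⟨h3.1 5 (by decide), h5, h6, h7⟩⟩

end Knapsack

/-! ### The initialization of the search -/

namespace Knapsack

open RAM

/-- Assignment of a value that is known as a function `V` of the initial view. -/
theorem set_then {H : View → ℕ → Prop} {F : View → View} {Post : View → ℕ → View → Prop}
    {f : (ℕ → ℕ) → Mem → ℕ} (r : ℕ) (V : View → ℕ) (hr : r < 32) (hf : PolyTime 32 f)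
    (hV : ∀ σ, f (F σ).e (F σ).a = V σ) (hX : ∀ σ X, 2 ≤ X → H σ X → V σ ≤ X)
    (h : Spec 32 (fun σ₀ X σ => σ = (F σ₀).set r (V σ₀) ∧ (∀ i < 32, σ.e i ≤ X) ∧ H σ₀ X) Post) :
    Spec 32 (fun σ₀ X σ => σ = F σ₀ ∧ (∀ i < 32, σ.e i ≤ X) ∧ H σ₀ X) Post := by
  refine Spec.seq (Spec.assign r hr hf ?_) h
  rintro σ₀ X _ h2 ⟨rfl, h3, h4⟩
  refine ⟨h3, by rw [hV], set_le h3 ?_, h4⟩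
  rw [hV]
  exact hX _ _ h2 h4

/-- Computation of a power by repeated multiplication. -/
theorem pow_then {H : View → ℕ → Prop} {F : View → View} {Post : View → ℕ → View → Prop}
    (b l c r : ℕ) (V : View → ℕ) (hr : r < 32) (hc : c < 32) (hb : b < 32) (hl : l < 32)
    (hrc : r ≠ c) (hbr : b ≠ r) (hbc : b ≠ c) (hlr : l ≠ r) (hlc : l ≠ c)
    (hV : ∀ σ, (F σ).e b ^ (F σ).e l = V σ)
    (hX : ∀ σ X, 2 ≤ X → H σ X → 0 < (F σ).e b ∧ V σ ≤ X)
    (h : Spec 32 (fun σ₀ X σ => σ = ((F σ₀).set c ((F σ₀).e l)).set r (V σ₀) ∧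
      (∀ i < 32, σ.e i ≤ X) ∧ H σ₀ X) Post) :
    Spec 32 (fun σ₀ X σ => σ = F σ₀ ∧ (∀ i < 32, σ.e i ≤ X) ∧ H σ₀ X) Post := by
  let Inv : View → ℕ → ℕ → View → Prop := fun σ₀ X t σ =>
    (σ = ((F σ₀).set c t).set r ((F σ₀).e b ^ t) ∧ t ≤ (F σ₀).e l) ∧
      (∀ i < 32, σ.e i ≤ X) ∧ (F σ₀).e l ≤ X ∧ H σ₀ X
  have hle : ∀ {σ : View} {X t : ℕ}, 2 ≤ X → H σ X → t ≤ (F σ).e l → (F σ).e b ^ t ≤ X := by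
    intro σ X t h2 h3 h4
    exact (Nat.pow_le_pow_right (hX σ X h2 h3).1 h4).trans ((hV σ).le.trans (hX σ X h2 h3).2)
  refine Spec.seq (Mid := fun σ₀ X σ => (σ = (F σ₀).set c 0 ∧ (∀ i < 32, σ.e i ≤ X)) ∧
    (F σ₀).e l ≤ X ∧ H σ₀ X) (Spec.assign c hc (.const 0) ?_) ?_
  · rintro σ₀ X _ - ⟨rfl, h3, h4⟩
    exact ⟨h3, ⟨rfl, set_le h3 (Nat.zero_le _)⟩, h3 l hl, h4⟩
  refine Spec.seq (Mid := fun σ₀ X σ => Inv σ₀ X 0 σ) (Spec.assign r hr (.const 1) ?_) ?_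
  · rintro σ₀ X _ h2 ⟨⟨rfl, h3⟩, h4⟩
    exact ⟨h3, ⟨by rw [pow_zero], Nat.zero_le _⟩, set_le h3 (by omega), h4⟩
  refine Spec.seq (Spec.loop (n := fun σ₀ => (F σ₀).e l) (Inv := Inv) c l hc hl ?_ ?_ ?_)
    (h.conseq fun σ₀ X => ⟨σ₀, ?_, fun σ hσ => hσ⟩)
  · rintro σ₀ X i _ ⟨⟨rfl, -⟩, -⟩ -
    rw [View.set_e_of_ne _ _ hrc.symm, View.set_e_self, View.set_e_of_ne _ _ hlr,
      View.set_e_of_ne _ _ hlc]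
  · rintro σ₀ X σ ⟨-, -, h1, -⟩
    exact h1
  · refine Spec.assign r hr ((PolyTime.var hr).mul (.var hb)) ?_
    rintro ⟨σ₀, t⟩ X _ h2 ⟨⟨⟨rfl, h3⟩, h4, h5, h6⟩, h7⟩
    dsimp only at h3 h4 h5 h6 h7 ⊢
    have key : (((((F σ₀).set c t).set r ((F σ₀).e b ^ t)).set r
        ((((F σ₀).set c t).set r ((F σ₀).e b ^ t)).e r *
          (((F σ₀).set c t).set r ((F σ₀).e b ^ t)).e b)).set c
        (((((F σ₀).set c t).set r ((F σ₀).e b ^ t)).set r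
        ((((F σ₀).set c t).set r ((F σ₀).e b ^ t)).e r *
          (((F σ₀).set c t).set r ((F σ₀).e b ^ t)).e b)).e c + 1)) =
        ((F σ₀).set c (t + 1)).set r ((F σ₀).e b ^ (t + 1)) := by
      rw [View.set_e_self, View.set_e_of_ne _ _ hbr, View.set_e_of_ne _ _ hbc,
        View.set_e_of_ne _ _ hrc.symm, View.set_e_of_ne _ _ hrc.symm, View.set_e_self]
      simp only [View.set, View.mk.injEq, and_true]
      funext i
      by_cases h1 : i = r
      · subst h1; simp [hrc, pow_succ]
      · by_cases h2 : i = c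
        · subst h2; simp [h1]
        · simp [h1, h2]
    refine ⟨h4, ⟨key, h7⟩, ?_, h5, h6⟩
    rw [key]
    have hF : ∀ i < 32, i ≠ c → i ≠ r → (F σ₀).e i ≤ X := fun i hi h8 h9 => by
      have := h4 i hi
      rwa [View.set_e_of_ne _ _ h9, View.set_e_of_ne _ _ h8] at this
    intro i hi
    by_cases h1 : i = r
    · rw [h1, View.set_e_self]; exact hle h2 h6 h7
    · rw [View.set_e_of_ne _ _ h1]
      by_cases h8 : i = c
      · rw [h8, View.set_e_self]; omega
      · rw [View.set_e_of_ne _ _ h8]; exact hF i hi h8 h1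
  · rintro σ - ⟨⟨h3, -⟩, h4, -, h6⟩
    exact ⟨by rw [h3, hV], h4, h6⟩

/-- The smallest width of the first `n` items, where widths are cut off at `N + 1`. A minimum is
expressed by a supremum here, because suprema are available in `RAM.PolyTime`. -/
def minWidth (N n : ℕ) (w : ℕ → ℕ) : ℕ :=
  N + 1 - (Finset.range n).sup fun i => N + 1 - min (w i) (N + 1)

/-- The unit of rounded lengths. Unless it is `1`, `k + 2` units fit into `ρ`, which is the largest
number such that all widths exceed `2 * ρ`. -/
def unit (N n k : ℕ) (w : ℕ → ℕ) : ℕ := max 1 ((minWidth N n w - 1) / 2 / (k + 2))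

/-- The data of the search, as determined by the variables `0, …, 5` and by the arrays `0`
and `1`. -/
def initial (e : ℕ → ℕ) (a : Mem) : Par where
  N₁ := e 0
  N₂ := e 1
  k := e 2
  n := e 3
  T := e 4
  J := e 5
  g := unit (e 0) (e 3) (e 2) (a 0)
  bi := e 3 + e 0 + e 1 + 1
  bo := e 2 * e 2 + e 0 / unit (e 0) (e 3) (e 2) (a 0) + 3
  Bc := (e 3 + e 0 + e 1 + 1) ^ (3 * e 4)
  Γ := e 11
  w := fun i => min (a 0 i) (e 0 + 1)
  h := fun i => min (a 1 i) (e 1 + 1)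

/-- The number of codes for the choices made for a segment: a contour, and an item and a position
for each of at most `T * T` free slots. -/
def Par.Bv (Q : Par) : ℕ := Q.bi ^ (3 * Q.T + 2 * (Q.T * Q.T))

/-- The number of guesses: a modulus and a multiplier for the hash function, and five digits for
each slot. -/
def Par.Bo (Q : Par) : ℕ := (2 * Q.n + 1) * (2 * Q.n + 1) * Q.bo ^ (5 * Q.J)

theorem polyTime_unit : PolyTime 32 fun e a => unit (e 0) (e 3) (e 2) (a 0) := by
  have v (i m : ℕ) (hi : i < m := by omega) : PolyTime m fun e _ => e i := .var hi
  have h1 : PolyTime 32 fun e a => minWidth (e 0) (e 3) (a 0) :=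
    ((v 0 32).add (.const 1)).sub (PolyTime.sup (F := fun e a i => e 0 + 1 - min (a 0 i) (e 0 + 1))
      (v 3 32) (((v 1 33).add (.const 1)).sub (PolyTime.read 0 (v 0 33) ((v 1 33).add (.const 1)))))
  exact (PolyTime.const 1).max (((h1.sub (.const 1)).div (.const 2)).div ((v 2 32).add (.const 2)))

/-- The whole search: all data are computed, and then all guesses are tried. -/
theorem spec_program :
    Spec 32 (fun (σ₀ : View) X σ => σ = σ₀ ∧ (∀ i < 32, σ.e i ≤ X) ∧
        (∀ i < σ₀.e 3, 0 < σ₀.a 0 i) ∧ 0 < σ₀.e 5 ∧ σ₀.e 5 ≤ σ₀.e 3 ∧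
        (initial σ₀.e σ₀.a).bi * (initial σ₀.e σ₀.a).Bv * (initial σ₀.e σ₀.a).Bo ≤ X)
      fun σ₀ _ σ => σ.e 5 = σ₀.e 5 ∧ (σ.e 15 = 0 ∨ σ.e 15 = 1) ∧
        (σ.e 15 = 0 → ∀ Γ < (initial σ₀.e σ₀.a).Bo,
          ¬((initial σ₀.e σ₀.a).guess Γ).Path (initial σ₀.e σ₀.a).Bv 0) ∧
        (σ.e 15 ≠ 0 → (initial σ₀.e σ₀.a).Solution (σ.a 2) (σ.a 3) (σ.a 4)) := by
  have v (i : ℕ) (hi : i < 32 := by omega) : PolyTime 32 fun e _ => e i := .var hi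
  let H : View → ℕ → Prop := fun σ₀ X => (∀ i < 32, σ₀.e i ≤ X) ∧
        (∀ i < σ₀.e 3, 0 < σ₀.a 0 i) ∧ 0 < σ₀.e 5 ∧ σ₀.e 5 ≤ σ₀.e 3 ∧
        (initial σ₀.e σ₀.a).bi * (initial σ₀.e σ₀.a).Bv * (initial σ₀.e σ₀.a).Bo ≤ X
  have hb : ∀ σ₀ X, H σ₀ X → (initial σ₀.e σ₀.a).g ≤ X ∧ 0 < (initial σ₀.e σ₀.a).bi ∧
      (initial σ₀.e σ₀.a).bi ≤ X ∧ (initial σ₀.e σ₀.a).bo ≤ X ∧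
      3 * (initial σ₀.e σ₀.a).T ≤ X ∧ (initial σ₀.e σ₀.a).Bc ≤ X ∧
      3 * (initial σ₀.e σ₀.a).T + 2 * ((initial σ₀.e σ₀.a).T * (initial σ₀.e σ₀.a).T) ≤ X ∧
      (initial σ₀.e σ₀.a).Bv ≤ X ∧ 5 * (initial σ₀.e σ₀.a).J ≤ X ∧
      (initial σ₀.e σ₀.a).bo ^ (5 * (initial σ₀.e σ₀.a).J) ≤ X ∧ (initial σ₀.e σ₀.a).Bo ≤ X ∧
      ((initial σ₀.e σ₀.a).J + 1) * (initial σ₀.e σ₀.a).Bc ≤ X ∧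
      (initial σ₀.e σ₀.a).J * (initial σ₀.e σ₀.a).Bc ≤ X ∧ 0 < (initial σ₀.e σ₀.a).Bc := by
    rintro σ₀ X ⟨-, -, h5, h53, h6⟩
    have hJ : (initial σ₀.e σ₀.a).J = σ₀.e 5 := rfl
    have hn : (initial σ₀.e σ₀.a).n = σ₀.e 3 := rfl
    have hbi : (initial σ₀.e σ₀.a).bi = σ₀.e 3 + σ₀.e 0 + σ₀.e 1 + 1 := rfl
    have hbc : (initial σ₀.e σ₀.a).Bc =
      (initial σ₀.e σ₀.a).bi ^ (3 * (initial σ₀.e σ₀.a).T) := rfl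
    have hbo : 3 ≤ (initial σ₀.e σ₀.a).bo := Nat.le_add_left _ _
    have hg : (initial σ₀.e σ₀.a).g ≤ (initial σ₀.e σ₀.a).bi := by
      refine max_le (by omega) ((Nat.div_le_self _ _).trans ((Nat.div_le_self _ _).trans ?_))
      have : minWidth (σ₀.e 0) (σ₀.e 3) (σ₀.a 0) ≤ σ₀.e 0 + 1 := Nat.sub_le _ _
      omega
    unfold Par.Bo Par.Bv at *
    rw [hn] at h6 ⊢
    generalize initial σ₀.e σ₀.a = Q at *
    have b2 : 2 ≤ Q.bi := by omega
    have p1 : 3 * Q.T < Q.bi ^ (3 * Q.T) := Nat.lt_pow_self (by omega)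
    have p2 : 3 * Q.T + 2 * (Q.T * Q.T) < Q.bi ^ (3 * Q.T + 2 * (Q.T * Q.T)) :=
      Nat.lt_pow_self (by omega)
    have p3 : 5 * Q.J < Q.bo ^ (5 * Q.J) := Nat.lt_pow_self (by omega)
    have p4 : Q.bi ^ (3 * Q.T) ≤ Q.bi ^ (3 * Q.T + 2 * (Q.T * Q.T)) :=
      Nat.pow_le_pow_right (by omega) (by omega)
    have p5 : Q.bo ≤ Q.bo ^ (5 * Q.J) := Nat.le_self_pow (by omega) _
    have p6 : 1 ≤ (2 * σ₀.e 3 + 1) * (2 * σ₀.e 3 + 1) := Nat.mul_pos (by omega) (by omega)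
    have p7 : Q.bo ^ (5 * Q.J) ≤ (2 * σ₀.e 3 + 1) * (2 * σ₀.e 3 + 1) * Q.bo ^ (5 * Q.J) :=
      Nat.le_mul_of_pos_left _ p6
    rw [← hbc] at p1 p4
    generalize Q.bo ^ (5 * Q.J) = bJ at *
    generalize (2 * σ₀.e 3 + 1) * (2 * σ₀.e 3 + 1) * bJ = Bo at *
    generalize Q.bi ^ (3 * Q.T + 2 * (Q.T * Q.T)) = Bv at *
    have p8 : Bo ≤ Q.bi * Bv * Bo := Nat.le_mul_of_pos_left _ (Nat.mul_pos (by omega) (by omega))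
    have p9 : Q.bi * Bv ≤ Q.bi * Bv * Bo := Nat.le_mul_of_pos_right _ (by omega)
    have p10 : Bv ≤ Q.bi * Bv := Nat.le_mul_of_pos_left _ (by omega)
    have p11 : Q.bi ≤ Q.bi * Bv := Nat.le_mul_of_pos_right _ (by omega)
    have p12 : (Q.J + 1) * Q.Bc ≤ Q.bi * Bv := Nat.mul_le_mul (by omega) p4
    have p13 : Q.J * Q.Bc ≤ (Q.J + 1) * Q.Bc := Nat.mul_le_mul_right _ (by omega)
    refine ⟨?_, ?_, ?_, ?_, ?_, ?_, ?_, ?_, ?_, ?_, ?_, ?_, ?_, ?_⟩ <;> omega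
  refine Spec.conseq (Pre := fun σ₀ X σ => σ = id σ₀ ∧ (∀ i < 32, σ.e i ≤ X) ∧ H σ₀ X)
    (Post := fun σ₀ X σ => σ.e 5 = σ₀.e 5 ∧ (σ.e 15 = 0 ∨ σ.e 15 = 1) ∧
        (σ.e 15 = 0 → ∀ Γ < (initial σ₀.e σ₀.a).Bo,
          ¬((initial σ₀.e σ₀.a).guess Γ).Path (initial σ₀.e σ₀.a).Bv 0) ∧
        (σ.e 15 ≠ 0 → (initial σ₀.e σ₀.a).Solution (σ.a 2) (σ.a 3) (σ.a 4))) ?_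
    (fun σ₀ X => ⟨σ₀, fun σ _ h => ⟨h.1, h.2.1, h.1 ▸ h.2.1, h.2.2⟩, fun σ h => h⟩)
  refine set_then 7 (fun σ => (initial σ.e σ.a).g) (by omega) polyTime_unit (fun σ => rfl)
    ?_ ?_
  · rintro σ X - hH
    obtain ⟨c1, c2, c3, c4, c5, c6, c7, c8, c9, c10, c11, c12, c13, c14⟩ := hb σ X hH
    exact c1
  refine set_then 8 (fun σ => (initial σ.e σ.a).bi) (by omega)
    ((((v 3).add (v 0)).add (v 1)).add (.const 1)) (fun σ => rfl) ?_ ?_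
  · rintro σ X - hH
    obtain ⟨c1, c2, c3, c4, c5, c6, c7, c8, c9, c10, c11, c12, c13, c14⟩ := hb σ X hH
    exact c3
  refine set_then 9 (fun σ => (initial σ.e σ.a).bo) (by omega)
    ((((v 2).mul (v 2)).add ((v 0).div (v 7))).add (.const 3)) (fun σ => rfl) ?_ ?_
  · rintro σ X - hH
    obtain ⟨c1, c2, c3, c4, c5, c6, c7, c8, c9, c10, c11, c12, c13, c14⟩ := hb σ X hH
    exact c4
  refine set_then 24 (fun σ => 3 * (initial σ.e σ.a).T) (by omega)
    ((PolyTime.const 3).mul (v 4)) (fun σ => rfl) ?_ ?_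
  · rintro σ X - hH
    obtain ⟨c1, c2, c3, c4, c5, c6, c7, c8, c9, c10, c11, c12, c13, c14⟩ := hb σ X hH
    exact c5
  refine pow_then 8 24 25 10 (fun σ => (initial σ.e σ.a).Bc) (by omega) (by omega)
    (by omega) (by omega) (by omega) (by omega) (by omega) (by omega) (by omega)
    (fun σ => rfl) ?_ ?_
  · rintro σ X - hH
    obtain ⟨c1, c2, c3, c4, c5, c6, c7, c8, c9, c10, c11, c12, c13, c14⟩ := hb σ X hH
    exact ⟨c2, c6⟩
  refine set_then 24 (fun σ => 3 * (initial σ.e σ.a).T +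
      2 * ((initial σ.e σ.a).T * (initial σ.e σ.a).T)) (by omega)
    (((PolyTime.const 3).mul (v 4)).add ((PolyTime.const 2).mul ((v 4).mul (v 4))))
    (fun σ => rfl) ?_ ?_
  · rintro σ X - hH
    obtain ⟨c1, c2, c3, c4, c5, c6, c7, c8, c9, c10, c11, c12, c13, c14⟩ := hb σ X hH
    exact c7
  refine pow_then 8 24 25 12 (fun σ => (initial σ.e σ.a).Bv) (by omega) (by omega)
    (by omega) (by omega) (by omega) (by omega) (by omega) (by omega) (by omega)
    (fun σ => rfl) ?_ ?_
  · rintro σ X - hH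
    obtain ⟨c1, c2, c3, c4, c5, c6, c7, c8, c9, c10, c11, c12, c13, c14⟩ := hb σ X hH
    exact ⟨c2, c8⟩
  refine set_then 24 (fun σ => 5 * (initial σ.e σ.a).J) (by omega)
    ((PolyTime.const 5).mul (v 5)) (fun σ => rfl) ?_ ?_
  · rintro σ X - hH
    obtain ⟨c1, c2, c3, c4, c5, c6, c7, c8, c9, c10, c11, c12, c13, c14⟩ := hb σ X hH
    exact c9
  refine pow_then 9 24 25 26 (fun σ => (initial σ.e σ.a).bo ^ (5 * (initial σ.e σ.a).J))
    (by omega) (by omega)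
    (by omega) (by omega) (by omega) (by omega) (by omega) (by omega) (by omega)
    (fun σ => rfl) ?_ ?_
  · rintro σ X - hH
    obtain ⟨c1, c2, c3, c4, c5, c6, c7, c8, c9, c10, c11, c12, c13, c14⟩ := hb σ X hH
    exact ⟨Nat.lt_of_lt_of_le (by omega : 0 < 3) (Nat.le_add_left _ _), c10⟩
  refine set_then 13 (fun σ => (initial σ.e σ.a).Bo) (by omega)
    ((((((PolyTime.const 2).mul (v 3)).add (.const 1)).mul
      (((PolyTime.const 2).mul (v 3)).add (.const 1)))).mul (v 26)) (fun σ => rfl) ?_ ?_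
  · rintro σ X - hH
    obtain ⟨c1, c2, c3, c4, c5, c6, c7, c8, c9, c10, c11, c12, c13, c14⟩ := hb σ X hH
    exact c11
  refine set_then 14 (fun σ => (initial σ.e σ.a).J * (initial σ.e σ.a).Bc) (by omega)
    ((v 5).mul (v 10)) (fun σ => rfl) ?_ ?_
  · rintro σ X - hH
    obtain ⟨c1, c2, c3, c4, c5, c6, c7, c8, c9, c10, c11, c12, c13, c14⟩ := hb σ X hH
    exact c13
  obtain ⟨P, d, hP⟩ := spec_search
  refine ⟨P, d, fun σ₀ X s hX ⟨h1, h2, h3⟩ => ?_⟩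
  have h5 : (s.view 32).e 5 = σ₀.e 5 := by rw [h1]; rfl
  have h10 : (s.view 32).e 10 = (initial σ₀.e σ₀.a).Bc := by rw [h1]; rfl
  have h12 : (s.view 32).e 12 = (initial σ₀.e σ₀.a).Bv := by rw [h1]; rfl
  have h13 : (s.view 32).e 13 = (initial σ₀.e σ₀.a).Bo := by rw [h1]; rfl
  have hp : par (s.view 32).e (s.view 32).a = initial σ₀.e σ₀.a := by rw [h1]; rfl
  obtain ⟨c1, c2, c3, c4, c5, c6, c7, c8, c9, c10, c11, c12, c13, c14⟩ := hb _ _ h3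
  refine (hP _ X s hX ⟨rfl, ⟨h2, ?_, ?_⟩, ?_, ?_⟩).mono le_rfl ?_
  · rw [h5, h10]
    exact c12
  · rw [h5, h10, h1]
    rfl
  · rw [h10]
    exact c14
  · rw [hp]
    intro i hi
    exact lt_min (h3.2.1 i hi) (Nat.succ_pos _)
  · intro s' h
    rw [hp, h5, h12, h13] at h
    exact h

end Knapsack

/-! ### The algorithm -/

namespace RAM

/-- The characterization of quotients that are rounded up. -/
theorem lt_ceilDiv_iff {a b i : ℕ} (hb : 0 < b) : i < (a + b - 1) / b ↔ i * b < a := by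
  rw [Nat.lt_iff_add_one_le, Nat.le_div_iff_mul_le hb, add_mul, one_mul]
  omega

/-- The loop that adds register `z` to register `c` until it reaches register `l`, and adds register
`y` to register `x` each time. -/
def accumulate (l c z x y : ℕ) : Prog :=
  .loop (.sub (.reg l) (.reg c))
    (.seq (.set x (.add (.reg x) (.reg y))) (.set c (.add (.reg c) (.reg z))))

theorem runs_accumulate {l c z x y : ℕ} {s : State} (hlc : l ≠ c) (hlx : l ≠ x) (hzc : z ≠ c)
    (hzx : z ≠ x) (hyc : y ≠ c) (hyx : y ≠ x) (hcx : c ≠ x) (hc : s.reg c = 0) (hx : s.reg x = 0)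
    (hz : 0 < s.reg z) {n : ℕ} (hn : n = (s.reg l + s.reg z - 1) / s.reg z) :
    Runs (accumulate l c z x y) s (12 * n + 4) fun s' =>
      s' = (s.setReg c (n * s.reg z)).setReg x (n * s.reg y) := by
  refine (runs_loop (n := n) (τ := 8)
    (I := fun i s' => s' = (s.setReg c (i * s.reg z)).setReg x (i * s.reg y)) ?_ ?_ ?_).mono ?_
    fun _ h => h
  · rintro i hi _ rfl
    have hi' : i * s.reg z < s.reg l := (lt_ceilDiv_iff hz).1 (hn ▸ hi)
    refine ⟨?_, ?_⟩
    · simp [Expr.eval, State.setReg, hlc, hlx, hcx]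
      omega
    · refine ((runs_set (Q := fun s' => s' = (s.setReg c (i * s.reg z)).setReg x
        ((i + 1) * s.reg y)) ?_).seq (τ' := 4) (Q' := fun s' => s' =
          (s.setReg c ((i + 1) * s.reg z)).setReg x ((i + 1) * s.reg y)) ?_).mono
          (by simp [Expr.cost]) fun _ h => h
      · simp only [Expr.eval, State.setReg, State.mk.injEq, and_true]
        funext r
        by_cases h1 : r = x
        · subst h1; simp [hyc, hyx, add_mul]
        · simp [h1]
      · rintro _ rfl
        refine runs_set ?_
        simp only [Expr.eval, State.setReg, State.mk.injEq, and_true]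
        funext r
        by_cases h1 : r = x
        · subst h1; simp [hcx.symm]
        · by_cases h2 : r = c
          · subst h2; simp [hcx, hzc, hzx, add_mul]
          · simp [h1, h2]
  · rintro _ rfl
    have hi' := (lt_ceilDiv_iff (a := s.reg l) (i := n) hz).not.1 (by omega)
    simp [Expr.eval, State.setReg, hlc, hlx, hcx]
    omega
  · simp only [State.setReg, zero_mul]
    rw [← hc, Function.update_eq_self, hc, ← hx, Function.update_eq_self]
  · simp only [Expr.cost]
    omega

end RAM

namespace Knapsack

open RAM

/-- The widths of the items, with value `0` for indices that do not belong to an item. -/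
def Instance.width (I : Instance) (i : ℕ) : ℕ :=
  if hi : i < I.numItems then (I.item ⟨i, hi⟩).w else 0

/-- The heights of the items, with value `0` for indices that do not belong to an item. -/
def Instance.height (I : Instance) (i : ℕ) : ℕ :=
  if hi : i < I.numItems then (I.item ⟨i, hi⟩).h else 0

/-- The data of the search for a packing of `J` of the items of `I`. -/
def Instance.par (I : Instance) (T J : ℕ) : Par :=
  initial
    (fun i => match i with
      | 0 => I.N₁
      | 1 => I.N₂
      | 2 => I.k
      | 3 => I.numItems
      | 4 => T
      | 5 => J
      | _ => 0)
    fun A => match A with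
      | 0 => I.width
      | 1 => I.height
      | _ => 0

theorem initial_congr {e e' : ℕ → ℕ} {a a' : Mem} (he : ∀ i < 12, e i = e' i) (h0 : a 0 = a' 0)
    (h1 : a 1 = a' 1) : initial e a = initial e' a' := by
  simp [initial, he 0, he 1, he 2, he 3, he 4, he 5, he 11, h0, h1]

/-- The number of items that the algorithm tries to pack: `(1 - p / q) * k`, rounded up. -/
def goal (p q k : ℕ) : ℕ := (k * (q - p) + q - 1) / q

/-- The bound on the number of steps of a contour: `5 * q / p`, rounded up. -/
def steps (p q : ℕ) : ℕ := (5 * q + p - 1) / p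

/-- The program: in trivial cases the answer is immediate; otherwise the bound for the number of
steps of a contour and the number of items to be packed are computed, and the search is
started. -/
theorem exists_program : ∃ (P : Prog) (d : ℕ), ∀ (p q : ℕ), 0 < p → 0 < q → ∀ I : Instance,
    ((I.k = 0 ∨ q ≤ p) → Runs P (I.input p q) 100 fun s => s.reg 0 = 1 ∧ s.reg 1 = 0) ∧
    (0 < I.k → p < q → I.numItems < I.k → Runs P (I.input p q) 100 fun s => s.reg 0 = 0) ∧
    (0 < I.k → p < q → I.k ≤ I.numItems → ∀ X, (I.par (steps p q) (goal p q I.k)).bi *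
      (I.par (steps p q) (goal p q I.k)).Bv * (I.par (steps p q) (goal p q I.k)).Bo ≤ X →
      steps p q ≤ X → Runs P (I.input p q) (X ^ d) fun s =>
        (s.reg 0 = 0 ∧ ∀ Γ < (I.par (steps p q) (goal p q I.k)).Bo,
          ¬((I.par (steps p q) (goal p q I.k)).guess Γ).Path
            (I.par (steps p q) (goal p q I.k)).Bv 0) ∨
        (s.reg 0 = 1 ∧ s.reg 1 = goal p q I.k ∧
          (I.par (steps p q) (goal p q I.k)).Solution (s.arr 2) (s.arr 3) (s.arr 4))) := by
  obtain ⟨P, d, hP⟩ := spec_program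
  -- The variables of the search are in the registers `2, …, 33`. It uses the registers from `34` on
  -- as scratch space, so their contents do not matter to it. Products and quotients are computed by
  -- repeated addition.
  let q5 : Expr := .add (.add (.add (.add (.reg 1) (.reg 1)) (.reg 1)) (.reg 1)) (.reg 1)
  let PD : Prog := .seq (.set 34 (.lit 1)) <| .seq (.set 35 q5) <|
    .seq (accumulate 35 36 0 6 34) <| .seq (.set 37 (.sub (.reg 1) (.reg 0))) <|
    .seq (accumulate 4 38 34 39 37) <| .seq (accumulate 39 40 1 7 34) <|
    .seq P <| .seq (.set 1 (.reg 7)) (.set 0 (.reg 17))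
  -- the report of an empty packing
  let P1 : Prog := .seq (.set 0 (.lit 1)) (.set 1 (.lit 0))
  have hP1 : ∀ s, Runs P1 s 4 fun s => s.reg 0 = 1 ∧ s.reg 1 = 0 := fun s =>
    ((runs_set (Q := fun s => s.reg 0 = 1) rfl).seq (τ' := 2)
      (Q' := fun s => s.reg 0 = 1 ∧ s.reg 1 = 0)
      fun s' hs' => runs_set ⟨by simp [State.setReg, hs'], rfl⟩).mono (by simp [Expr.cost])
      fun _ h => h
  refine ⟨.branch (.reg 4) (.branch (.sub (.reg 1) (.reg 0))
    (.branch (.sub (.add (.reg 5) (.lit 1)) (.reg 4)) PD (.set 0 (.lit 0))) P1) P1, d + 20, ?_⟩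
  intro p q hp hq I
  have r0 : (I.input p q).reg 0 = p := rfl
  have r1 : (I.input p q).reg 1 = q := rfl
  have r4 : (I.input p q).reg 4 = I.k := rfl
  have r5 : (I.input p q).reg 5 = I.numItems := rfl
  refine ⟨?_, ?_, ?_⟩
  · intro h
    refine (runs_branch (τ := 8) (fun h1 => ?_) fun _ => (hP1 _).mono (by omega)
      fun _ h => h).mono (by simp [Expr.cost]) fun _ h => h
    simp only [Expr.eval, r4] at h1
    refine (runs_branch (τ := 4) (fun h2 => ?_) fun _ => hP1 _).mono (by simp [Expr.cost])
      fun _ h => h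
    simp only [Expr.eval, r0, r1] at h2
    omega
  · intro h1 h2 h3
    refine (runs_branch (τ := 50) (fun _ => ?_) fun h4 => ?_).mono (by simp [Expr.cost])
      fun _ h => h
    · refine (runs_branch (τ := 20) (fun _ => ?_) fun h4 => ?_).mono (by simp [Expr.cost])
        fun _ h => h
      · refine (runs_branch (τ := 2) (fun h4 => ?_) fun h4 =>
          runs_set (Q := fun s => s.reg 0 = 0) rfl).mono
          (by simp [Expr.cost]) fun _ h => h
        simp only [Expr.eval, r4, r5] at h4
        omega
      · simp only [Expr.eval, r0, r1] at h4
        omega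
    · simp only [Expr.eval, r4] at h4
      omega
  · intro h1 h2 h3 X hX hTX
    set T := steps p q with hT
    set J := goal p q I.k with hJ
    have hT0 : 0 < T := (lt_ceilDiv_iff hp).2 (by omega)
    have hJ0 : 0 < J := (lt_ceilDiv_iff hq).2 (by
      rw [zero_mul]
      exact Nat.mul_pos h1 (by omega))
    have hJk : J ≤ I.k := by
      by_contra hc
      have := (lt_ceilDiv_iff hq).1 (not_le.1 hc)
      exact absurd (Nat.mul_le_mul_left I.k (Nat.sub_le q p)) (not_le.2 this)
    let s₀ := I.input p q
    let s1 := ((s₀.setReg 34 1).setReg 35 (q + q + q + q + q))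
    let s2 := (s1.setReg 36 (T * p)).setReg 6 (T * 1)
    let s3 := s2.setReg 37 (q - p)
    let s4 := (s3.setReg 38 (I.k * 1)).setReg 39 (I.k * (q - p))
    let s5 := (s4.setReg 40 (J * q)).setReg 7 (J * 1)
    have harr : s5.arr = s₀.arr := rfl
    have hini : initial (s5.view 32).e (s5.view 32).a = I.par T J := by
      refine initial_congr (fun i hi => ?_) rfl rfl
      interval_cases i <;>
        simp [s5, s4, s3, s2, s1, s₀, State.view, State.setReg, Instance.input]
    have hQbi : (I.par T J).bi = I.numItems + I.N₁ + I.N₂ + 1 := rfl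
    have hn : ∀ i < I.numItems, 0 < (I.input p q).arr 0 i := fun i hi => by
      simp only [Instance.input, hi, dif_pos]
      exact (I.item _).w_pos
    have hbd : I.numItems + I.N₁ + I.N₂ + 1 ≤ X := by
      have b1 : 0 < (I.par T J).Bv := Nat.pow_pos (by omega)
      have b2 : 0 < (I.par T J).Bo :=
        Nat.mul_pos (Nat.mul_pos (by omega) (by omega)) (Nat.pow_pos (Nat.succ_pos _))
      rw [mul_assoc] at hX
      rw [hQbi] at hX
      exact (Nat.le_mul_of_pos_right _ (Nat.mul_pos b1 b2)).trans hX
    have hX2 : 2 ≤ X := by have := I.N₁_pos; omega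
    have hv : ∀ i < 32, (s5.view 32).e i ≤ X := by
      intro i hi
      rcases lt_or_ge i 6 with h6 | h6
      · interval_cases i <;>
          simp [s5, s4, s3, s2, s1, s₀, State.view, State.setReg, Instance.input] <;> omega
      · have : (s5.view 32).e i = 0 := by
          have h7 : i + 2 ≠ 7 := by omega
          have h8 : i + 2 ≠ 6 := by omega
          have h9 : i + 2 < 34 := by omega
          simp [s5, s4, s3, s2, s1, s₀, State.view, State.setReg, Instance.input,
            Function.update_of_ne, h7, h8, h9.ne, (show i + 2 ≠ 35 by omega),
            (show i + 2 ≠ 36 by omega), (show i + 2 ≠ 37 by omega), (show i + 2 ≠ 38 by omega),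
            (show i + 2 ≠ 39 by omega), (show i + 2 ≠ 40 by omega)]
          intro _
          split <;> omega
        omega
    have key := hP (s5.view 32) X s5 hX2 ⟨rfl, hv, hn, hJ0.trans_eq (by
        simp [s5, State.view, State.setReg]), ?_, ?_⟩
    · have t1 : Runs (accumulate 35 36 0 6 34) s1 (12 * T + 4) fun s => s = s2 :=
        runs_accumulate (by omega) (by omega) (by omega) (by omega) (by omega) (by omega)
          (by omega) rfl rfl hp (by
            change (5 * q + p - 1) / p = (q + q + q + q + q + p - 1) / p
            congr 1
            omega)
      have t2 : Runs (accumulate 4 38 34 39 37) s3 (12 * I.k + 4) fun s => s = s4 :=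
        runs_accumulate (by omega) (by omega) (by omega) (by omega) (by omega) (by omega)
          (by omega) rfl rfl (Nat.one_pos) (by
            change I.k = (I.k + 1 - 1) / 1
            simp)
      have t3 : Runs (accumulate 39 40 1 7 34) s4 (12 * J + 4) fun s => s = s5 :=
        runs_accumulate (by omega) (by omega) (by omega) (by omega) (by omega) (by omega)
          (by omega) rfl rfl hq rfl
      have run1 : Runs PD s₀ (2 + (10 + (12 * T + 4 + (4 + (12 * I.k + 4 + (12 * J + 4 +
          (X ^ d + (2 + 2)))))))) fun s =>
        (s.reg 0 = 0 ∧ ∀ Γ < (I.par T J).Bo, ¬((I.par T J).guess Γ).Path (I.par T J).Bv 0) ∨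
        (s.reg 0 = 1 ∧ s.reg 1 = J ∧
          (I.par T J).Solution (s.arr 2) (s.arr 3) (s.arr 4)) := by
        refine (runs_set (Q := fun s => s = s₀.setReg 34 1) rfl).seq ?_
        rintro _ rfl
        refine (runs_set (Q := fun s => s = s1) rfl).seq ?_
        rintro _ rfl
        refine t1.seq ?_
        rintro _ rfl
        refine (runs_set (Q := fun s => s = s3) rfl).seq ?_
        rintro _ rfl
        refine t2.seq ?_
        rintro _ rfl
        refine t3.seq ?_
        rintro _ rfl
        refine key.seq fun s hs => ?_
        dsimp only at hs
        rw [hini] at hs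
        obtain ⟨k1, k2, k3, k4⟩ := hs
        have k1' : s.reg 7 = J := by
          have : (s5.view 32).e 5 = J := by simp [s5, State.view, State.setReg]
          exact k1.trans this
        have k2' : (s.view 32).e 15 = s.reg 17 := rfl
        rw [k2'] at k2 k3 k4
        refine (runs_set (Q := fun s' => s' = s.setReg 1 J) (by rw [← k1']; rfl)).seq ?_
        rintro _ rfl
        refine runs_set ?_
        rcases k2 with k2 | k2
        · exact .inl ⟨k2, k3 k2⟩
        · exact .inr ⟨k2, rfl, k4 (by omega)⟩
      refine (runs_branch (fun _ => ?_) fun h4 => ?_).mono (τ := 2 + (4 + (6 + (2 + (10 +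
        (12 * T + 4 + (4 + (12 * I.k + 4 + (12 * J + 4 + (X ^ d + (2 + 2)))))))))))
        ?_ fun _ h => h
      · refine (runs_branch (fun _ => ?_) fun h4 => ?_).mono le_rfl fun _ h => h
        · refine (runs_branch (fun _ => run1) fun h4 => ?_).mono le_rfl fun _ h => h
          have h4' : I.numItems + 1 - I.k = 0 := h4
          omega
        · have h4' : q - p = 0 := h4
          omega
      · have h4' : I.k = 0 := h4
        omega
      · have e1 : X * 64 ≤ X * X ^ 6 := Nat.mul_le_mul_left _ (by
          calc 64 = 2 ^ 6 := rfl
            _ ≤ X ^ 6 := Nat.pow_le_pow_left hX2 6)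
        have e2 : 2 ^ 8 ≤ X ^ 8 := Nat.pow_le_pow_left hX2 8
        have e3 := pow_add_pow_le hX2 (a := 8) (b := 7)
        have e4 := pow_add_pow_le hX2 (a := d) (b := 16)
        have e5 : X ^ (d + 16 + 1) ≤ X ^ (d + 20) := Nat.pow_le_pow_right (by omega) (by omega)
        have e6 : X * X ^ 6 = X ^ 7 := (pow_succ' X 6).symm
        simp only [Nat.reduceAdd] at e3
        omega
    · have h5 : (s5.view 32).e 5 = J := by simp [s5, State.view, State.setReg]
      have h3' : (s5.view 32).e 3 = I.numItems := by
        simp [s5, s4, s3, s2, s1, s₀, State.view, State.setReg, Instance.input]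
      rw [h5, h3']
      omega
    · rw [hini]
      exact hX

end Knapsack

/-! ### Levels and cuts of a packing -/

/-- A packing of the rectangles `i ∈ S`, of width `W i` and height `H i`, at the positions
`(X i, Y i)` in the box `[0, N₁] × [0, N₂]`. All widths exceed `2 * ρ`. -/
structure Layout where
  N₁ : ℕ
  N₂ : ℕ
  ρ : ℕ
  S : Finset ℕ
  X : ℕ → ℕ
  Y : ℕ → ℕ
  W : ℕ → ℕ
  H : ℕ → ℕ
  wide : ∀ i ∈ S, 2 * ρ < W i
  pos : ∀ i ∈ S, 0 < H i
  right : ∀ i ∈ S, X i + W i ≤ N₁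
  top : ∀ i ∈ S, Y i + H i ≤ N₂
  sep : ∀ i ∈ S, ∀ j ∈ S, i ≠ j →
    X i + W i ≤ X j ∨ X j + W j ≤ X i ∨ Y i + H i ≤ Y j ∨ Y j + H j ≤ Y i

namespace Layout

variable (P : Layout)

/-- Rectangle `i` comes within distance `ρ` of the column `[x, x + 1]`. -/
def Touch (i x : ℕ) : Prop := P.X i ≤ x + P.ρ ∧ x < P.X i + P.W i + P.ρ

/-- Some column meets both rectangles. -/
def Meet (i j : ℕ) : Prop := P.X i < P.X j + P.W j ∧ P.X j < P.X i + P.W i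

open Classical in
/-- The upper envelope of the rectangles in `A`, enlarged by `ρ` to both sides. -/
noncomputable def env (A : Finset ℕ) (x : ℕ) : ℕ :=
  A.sup fun i => if P.Touch i x then P.Y i + P.H i else 0

open Classical in
/-- The rectangles of the first `t` levels. A rectangle `Q` belongs to the first `t + 1` levels if,
in some column that it touches, it starts below the upper envelope of the first `t` levels, or no
rectangle that ends above the envelope starts lower than `Q`. -/
noncomputable def level : ℕ → Finset ℕ
  | 0 => ∅
  | t + 1 => {Q ∈ P.S | ∃ x < P.N₁, P.Touch Q x ∧ (P.Y Q < P.env (level t) x ∨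
      ∀ i ∈ P.S, P.Touch i x → P.env (level t) x < P.Y i + P.H i → P.Y Q ≤ P.Y i)}

variable {P}

theorem mem_level_succ {t Q : ℕ} : Q ∈ P.level (t + 1) ↔ Q ∈ P.S ∧ ∃ x < P.N₁, P.Touch Q x ∧
    (P.Y Q < P.env (P.level t) x ∨
      ∀ i ∈ P.S, P.Touch i x → P.env (P.level t) x < P.Y i + P.H i → P.Y Q ≤ P.Y i) := by
  simp only [level, Finset.mem_filter]

theorem le_env {A : Finset ℕ} {i x : ℕ} (hi : i ∈ A) (h : P.Touch i x) :
    P.Y i + P.H i ≤ P.env A x := by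
  refine le_trans ?_ (Finset.le_sup (b := i) hi)
  rw [if_pos h]

theorem env_mono {A B : Finset ℕ} (h : A ⊆ B) (x : ℕ) : P.env A x ≤ P.env B x := Finset.sup_mono h

theorem env_le {A : Finset ℕ} {x c : ℕ} (h : ∀ i ∈ A, P.Touch i x → P.Y i + P.H i ≤ c) :
    P.env A x ≤ c := by
  refine Finset.sup_le fun i hi => ?_
  split_ifs with ht
  · exact h i hi ht
  · exact Nat.zero_le _

theorem exists_eq_env {A : Finset ℕ} {x : ℕ} (h : P.env A x ≠ 0) :
    ∃ i ∈ A, P.Touch i x ∧ P.Y i + P.H i = P.env A x := by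
  by_contra! hc
  have hlt : P.env A x < P.env A x := by
    refine (Finset.sup_lt_iff (Nat.pos_of_ne_zero h)).2 fun i hi => ?_
    split_ifs with ht
    · exact lt_of_le_of_ne (le_env hi ht) (hc i hi ht)
    · exact Nat.pos_of_ne_zero h
  exact lt_irrefl _ hlt

theorem touch_self {i : ℕ} (hi : i ∈ P.S) : P.X i < P.N₁ ∧ P.Touch i (P.X i) := by
  have := P.wide i hi
  have := P.right i hi
  unfold Touch
  omega

theorem level_subset (t : ℕ) : P.level t ⊆ P.S := by
  cases t with
  | zero => exact Finset.empty_subset _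
  | succ t => exact fun i hi => (mem_level_succ.1 hi).1

theorem level_subset_succ (t : ℕ) : P.level t ⊆ P.level (t + 1) := by
  intro i hi
  have hS := level_subset t hi
  obtain ⟨h1, h2⟩ := touch_self hS
  have := le_env hi h2
  have := P.pos i hS
  exact mem_level_succ.2 ⟨hS, _, h1, h2, .inl (by omega)⟩

theorem level_mono : Monotone P.level := monotone_nat_of_le_succ level_subset_succ

/-- Rectangles outside the first `t + 1` levels lie above the envelope of the first `t` levels. -/
theorem env_le_of_notMem {t Q x : ℕ} (hS : Q ∈ P.S) (hQ : Q ∉ P.level (t + 1)) (hx : x < P.N₁)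
    (h : P.Touch Q x) : P.env (P.level t) x ≤ P.Y Q := by
  by_contra hc
  exact hQ (mem_level_succ.2 ⟨hS, x, hx, h, .inl (not_le.1 hc)⟩)

/-- As long as some rectangle rises above the envelope in column `x`, the envelope of the next
level is attained by a rectangle of that level alone. -/
theorem env_sdiff {t x : ℕ} (hx : x < P.N₁)
    (h : ∃ i ∈ P.S, P.Touch i x ∧ P.env (P.level t) x < P.Y i + P.H i) :
    P.env (P.level (t + 1) \ P.level t) x = P.env (P.level (t + 1)) x := by
  classical
  obtain ⟨i, hi, hmin⟩ := Finset.exists_min_image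
    {i ∈ P.S | P.Touch i x ∧ P.env (P.level t) x < P.Y i + P.H i} P.Y (by
      obtain ⟨i, h1, h2⟩ := h
      exact ⟨i, Finset.mem_filter.2 ⟨h1, h2⟩⟩)
  obtain ⟨h1, h2, h3⟩ := Finset.mem_filter.1 hi
  have hl : i ∈ P.level (t + 1) := mem_level_succ.2 ⟨h1, x, hx, h2, .inr fun j hj ht hlt =>
    hmin j (Finset.mem_filter.2 ⟨hj, ht, hlt⟩)⟩
  have hn : i ∉ P.level t := fun h' => absurd (le_env h' h2) (not_le.2 h3)
  have hi' := le_env (Finset.mem_sdiff.2 ⟨hl, hn⟩) h2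
  refine le_antisymm (env_mono Finset.sdiff_subset x) (env_le fun j hj ht => ?_)
  by_cases hjt : j ∈ P.level t
  · exact (le_env hjt ht).trans (h3.le.trans hi')
  · exact le_env (Finset.mem_sdiff.2 ⟨hj, hjt⟩) ht

variable (P)

/-- A chain of rectangles of `Z` that leaves no room for horizontal shifts: it leads from the left
side of the box to the right side, with gaps of at most `ρ` at the sides and at most `2 * ρ` between
consecutive rectangles, which overlap vertically. -/
structure Chain (Z : Finset ℕ) (a : ℕ → ℕ) (r : ℕ) : Prop where
  mem : ∀ i ≤ r, a i ∈ Z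
  left : P.X (a 0) ≤ P.ρ
  right : P.N₁ ≤ P.X (a r) + P.W (a r) + P.ρ
  le : ∀ i < r, P.X (a i) + P.W (a i) ≤ P.X (a (i + 1))
  gap : ∀ i < r, P.X (a (i + 1)) ≤ P.X (a i) + P.W (a i) + 2 * P.ρ
  lt_top : ∀ i < r, P.Y (a i) < P.Y (a (i + 1)) + P.H (a (i + 1))
  lt_top' : ∀ i < r, P.Y (a (i + 1)) < P.Y (a i) + P.H (a i)

/-- No chain of rectangles of `Z` leads from one side of the box to the other one. -/
def Loose (Z : Finset ℕ) : Prop := ∀ a r, ¬P.Chain Z a r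

variable {P}

namespace Chain

variable {Z : Finset ℕ} {a : ℕ → ℕ} {r : ℕ}

theorem mono {Z' : Finset ℕ} (h : P.Chain Z a r) (hZ : Z ⊆ Z') : P.Chain Z' a r :=
  ⟨fun i hi => hZ (h.mem i hi), h.left, h.right, h.le, h.gap, h.lt_top, h.lt_top'⟩

theorem le_of_lt (h : P.Chain Z a r) {i j : ℕ} (hij : i < j) (hj : j ≤ r) :
    P.X (a i) + P.W (a i) ≤ P.X (a j) := by
  induction j with
  | zero => omega
  | succ j ih =>
    have h1 := h.le j (by omega)
    rcases Nat.lt_succ_iff_lt_or_eq.1 hij with h2 | rfl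
    · have := ih h2 (by omega)
      omega
    · exact h1

theorem exists_touch (h : P.Chain Z a r) {x : ℕ} (hx : x < P.N₁) : ∃ i ≤ r, P.Touch (a i) x := by
  by_contra! hc
  have key : ∀ i ≤ r, P.X (a i) ≤ x + P.ρ := by
    intro i
    induction i with
    | zero => intro _; have := h.left; omega
    | succ i ih =>
      intro hi
      have h1 := ih (by omega)
      have h2 := hc i (by omega)
      have h3 := h.gap i (by omega)
      unfold Touch at h2
      omega
  have h1 := key r le_rfl
  have h2 := hc r le_rfl
  have h3 := h.right
  unfold Touch at h2
  omega

theorem exists_meet (h : P.Chain Z a r) {Q : ℕ} (hQ : Q ∈ P.S) : ∃ i ≤ r, P.Meet (a i) Q := by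
  have h1 := P.wide Q hQ
  have h2 := P.right Q hQ
  obtain ⟨i, hi, h3⟩ := h.exists_touch (x := P.X Q + P.ρ) (by omega)
  refine ⟨i, hi, ?_⟩
  unfold Touch at h3
  unfold Meet
  omega

/-- A chain cannot change from above a horizontal line to below it, nor conversely, because
consecutive rectangles overlap vertically. -/
theorem not_cross (h : P.Chain Z a r) (hZ : Z ⊆ P.S) {θ i j : ℕ} (hi : i ≤ r) (hj : j ≤ r)
    (h1 : θ ≤ P.Y (a i)) (h2 : P.Y (a j) + P.H (a j) ≤ θ)
    (hb : ∀ l, min i j ≤ l → l ≤ max i j → θ ≤ P.Y (a l) ∨ P.Y (a l) + P.H (a l) ≤ θ) : False := by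
  have hpos : ∀ l ≤ r, 0 < P.H (a l) := fun l hl => P.pos _ (hZ (h.mem l hl))
  rcases le_total i j with hij | hij
  · have key : ∀ l, i ≤ l → l ≤ j → θ ≤ P.Y (a l) := by
      intro l
      induction l with
      | zero => intro h3 _; obtain rfl : i = 0 := by omega
                exact h1
      | succ l ih =>
        intro h3 h4
        rcases Nat.lt_or_ge l i with h5 | h5
        · obtain rfl : i = l + 1 := by omega
          exact h1
        · have h6 := ih h5 (by omega)
          have h7 := h.lt_top l (by omega)
          rcases hb (l + 1) (by omega) (by omega) with h8 | h8
          · exact h8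
          · omega
    have := key j hij le_rfl
    have := hpos j hj
    omega
  · have key : ∀ l, j ≤ l → l ≤ i → P.Y (a l) + P.H (a l) ≤ θ := by
      intro l
      induction l with
      | zero => intro h3 _; obtain rfl : j = 0 := by omega
                exact h2
      | succ l ih =>
        intro h3 h4
        rcases Nat.lt_or_ge l j with h5 | h5
        · obtain rfl : j = l + 1 := by omega
          exact h2
        · have h6 := ih h5 (by omega)
          have h7 := h.lt_top' l (by omega)
          rcases hb (l + 1) (by omega) (by omega) with h8 | h8
          · omega
          · exact h8
    have := key i hij le_rfl
    have := hpos i hi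
    omega

/-- The rectangles of a chain between two of them that meet `E` and `Q` also meet `E` or `Q`, if
these touch a common column: there is no room for a rectangle between `E` and `Q`. -/
theorem meet_between (h : P.Chain Z a r) (hZ : Z ⊆ P.S) {E Q x i j l : ℕ} (hE : P.Touch E x)
    (hQ : P.Touch Q x) (hj : j ≤ r) (hiE : P.Meet (a i) E) (hjQ : P.Meet (a j) Q) (hil : i ≤ l)
    (hlj : l ≤ j) : P.Meet (a l) E ∨ P.Meet (a l) Q := by
  rcases hil.eq_or_lt with rfl | hil
  · exact .inl hiE
  rcases hlj.eq_or_lt with rfl | hlj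
  · exact .inr hjQ
  have h1 := h.le_of_lt hil (by omega)
  have h2 := h.le_of_lt hlj hj
  have h3 := P.wide _ (hZ (h.mem l (by omega)))
  unfold Meet Touch at *
  omega

/-- If a chain lies above the line `θ` where it meets `E`, and below `θ` where it meets `Q`, then no
column touches both `E` and `Q`. -/
theorem false_of_between (h : P.Chain Z a r) (hZ : Z ⊆ P.S) {E Q x θ : ℕ} (hES : E ∈ P.S)
    (hQS : Q ∈ P.S) (hE : P.Touch E x) (hQ : P.Touch Q x)
    (h1 : ∀ i ≤ r, P.Meet (a i) E → θ ≤ P.Y (a i))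
    (h2 : ∀ i ≤ r, P.Meet (a i) Q → P.Y (a i) + P.H (a i) ≤ θ) : False := by
  obtain ⟨i, hi, hiE⟩ := h.exists_meet hES
  obtain ⟨j, hj, hjQ⟩ := h.exists_meet hQS
  refine h.not_cross hZ hi hj (h1 i hi hiE) (h2 j hj hjQ) fun l hl hl' => ?_
  rcases le_total i j with hij | hij
  · exact (h.meet_between hZ hE hQ hj hiE hjQ (by omega) (by omega)).imp (h1 l (by omega))
      (h2 l (by omega))
  · exact (h.meet_between hZ hQ hE hi hjQ hiE (by omega) (by omega)).symm.imp (h1 l (by omega))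
      (h2 l (by omega))

/-- A chain passes above `Q` if its rectangles that share a column with `Q` lie above `Q`. -/
def Above (P : Layout) (a : ℕ → ℕ) (r Q : ℕ) : Prop :=
  ∀ i ≤ r, P.Meet (a i) Q → P.Y Q + P.H Q ≤ P.Y (a i)

/-- A chain that avoids `Q` passes above `Q` or below `Q`. -/
theorem above_or_below (h : P.Chain Z a r) (hZ : Z ⊆ P.S) {Q : ℕ} (hQS : Q ∈ P.S)
    (hQ : ∀ i ≤ r, a i ≠ Q) :
    Above P a r Q ∨ ∀ i ≤ r, P.Meet (a i) Q → P.Y (a i) + P.H (a i) ≤ P.Y Q := by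
  have hd : ∀ i ≤ r, P.Meet (a i) Q →
      P.Y Q + P.H Q ≤ P.Y (a i) ∨ P.Y (a i) + P.H (a i) ≤ P.Y Q := by
    intro i hi hm
    have := P.sep _ (hZ (h.mem i hi)) Q hQS (hQ i hi)
    unfold Meet at hm
    omega
  by_contra! hc
  obtain ⟨hc1, j, hj, hjm, hc2⟩ := hc
  unfold Above at hc1
  push Not at hc1
  obtain ⟨i, hi, him, hc1⟩ := hc1
  have t := (touch_self hQS).2
  have e1 := (hd i hi him).resolve_left (not_le.2 hc1)
  have e2 := (hd j hj hjm).resolve_right (not_le.2 hc2)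
  have := P.pos Q hQS
  refine h.not_cross hZ (θ := P.Y Q) hj hi (by omega) e1 fun l hl hl' => ?_
  have hm : P.Meet (a l) Q := by
    rcases le_total i j with hij | hij
    · exact or_self_iff.1 (h.meet_between hZ t t hj him hjm (by omega) (by omega))
    · exact or_self_iff.1 (h.meet_between hZ t t hi hjm him (by omega) (by omega))
  have := hd l (by omega) hm
  omega

theorem eq_of_meet (h : P.Chain Z a r) {i j : ℕ} (hi : i ≤ r) (hj : j ≤ r)
    (hm : P.Meet (a i) (a j)) : i = j := by
  unfold Meet at hm
  rcases lt_trichotomy i j with h1 | h1 | h1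
  · have := h.le_of_lt h1 hj
    omega
  · exact h1
  · have := h.le_of_lt h1 hi
    omega

/-- A chain above `E` is above the top of `E` in all columns that `E` touches. -/
theorem lt_top_of_above (h : P.Chain Z a r) (hZ : Z ⊆ P.S) {E x i : ℕ} (hES : E ∈ P.S)
    (hE : P.Touch E x) (hi : i ≤ r) (hx : P.Touch (a i) x) (hab : Above P a r E) :
    P.Y E + P.H E < P.Y (a i) + P.H (a i) := by
  by_contra hc
  refine h.false_of_between hZ hES (hZ (h.mem i hi)) hE hx hab fun j hj hm => ?_
  rw [h.eq_of_meet hj hi hm]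
  exact not_lt.1 hc

end Chain

/-- A rectangle that lies at most `t` levels above the first `s` levels can be kept below all
chains by the deletion of `t` rectangles. -/
theorem exists_above {s : ℕ} {Z : Finset ℕ} (hZ : Z ⊆ P.S)
    (hs : ∀ Q ∈ Z, ∀ x < P.N₁, P.Touch Q x → P.env (P.level s) x ≤ P.Y Q) (t : ℕ) :
    ∀ Q ∈ P.level (s + t), ∃ D : Finset ℕ, D.card ≤ t ∧
      ∀ a r, P.Chain (Z \ D) a r → Chain.Above P a r Q := by
  induction t with
  | zero =>
    -- the rectangles of `Z` already lie above the first `s` levels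
    intro Q hQ
    refine ⟨∅, le_rfl, fun a r h i hi hm => ?_⟩
    rw [Finset.sdiff_empty] at h
    have hiZ := h.mem i hi
    have h1 := P.wide _ (hZ hiZ)
    have h2 := P.wide _ (level_subset _ hQ)
    have h3 := P.right _ (hZ hiZ)
    unfold Meet at hm
    have h4 := hs _ hiZ (max (P.X Q) (P.X (a i))) (by omega) (by unfold Touch; omega)
    exact (le_env (x := max (P.X Q) (P.X (a i))) hQ (by unfold Touch; omega)).trans h4
  | succ t ih =>
    intro Q hQ
    obtain ⟨hQS, x, hx, hQx, hor⟩ := mem_level_succ.1 (show Q ∈ P.level (s + t + 1) from hQ)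
    -- the chain must avoid `Q`, and pass above the rectangle that attains the envelope
    have step : ∀ D : Finset ℕ, D.card ≤ t →
        (∀ a r, P.Chain (Z \ D) a r → ∃ θ, (∃ E ∈ P.S, P.Touch E x ∧
          ∀ i ≤ r, P.Meet (a i) E → θ ≤ P.Y (a i)) ∧ P.Y Q ≤ θ) →
        ∃ D : Finset ℕ, D.card ≤ t + 1 ∧
          ∀ a r, P.Chain (Z \ D) a r → Chain.Above P a r Q := by
      intro D hD hchain
      refine ⟨insert Q D, (Finset.card_insert_le _ _).trans (by omega), fun a r h => ?_⟩
      have h' : P.Chain (Z \ D) a r :=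
        h.mono (Finset.sdiff_subset_sdiff subset_rfl (Finset.subset_insert _ _))
      have hZ' : Z \ D ⊆ P.S := Finset.sdiff_subset.trans hZ
      obtain ⟨θ, ⟨E, hES, hEx, hE⟩, hθ⟩ := hchain a r h'
      refine (h'.above_or_below hZ' hQS fun i hi he => ?_).resolve_right fun hb => ?_
      · have := (Finset.mem_sdiff.1 (h.mem i hi)).2
        rw [he] at this
        exact this (Finset.mem_insert_self _ _)
      · exact h'.false_of_between hZ' hES hQS hEx hQx hE fun i hi hm => (hb i hi hm).trans hθ
    -- that rectangle may also be the one of the chain in column `x`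
    have self : ∀ {D : Finset ℕ} {a : ℕ → ℕ} {r : ℕ}, P.Chain (Z \ D) a r → ∀ i ≤ r,
        P.Touch (a i) x → P.Y Q ≤ P.Y (a i) → ∃ θ, (∃ E ∈ P.S, P.Touch E x ∧
          ∀ i ≤ r, P.Meet (a i) E → θ ≤ P.Y (a i)) ∧ P.Y Q ≤ θ := by
      intro D a r h i hi ht hy
      refine ⟨_, ⟨a i, hZ (Finset.sdiff_subset (h.mem i hi)), ht, fun j hj hm => ?_⟩, hy⟩
      rw [h.eq_of_meet hj hi hm]
    by_cases h0 : P.env (P.level (s + t)) x = 0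
    · refine step ∅ (Nat.zero_le _) fun a r h => ?_
      obtain ⟨i, hi, ht⟩ := h.exists_touch hx
      have hiS : a i ∈ P.S := hZ (Finset.sdiff_subset (h.mem i hi))
      refine self h i hi ht ((hor.resolve_left (by omega)) _ hiS ht ?_)
      have := P.pos _ hiS
      omega
    · obtain ⟨E, hE, hEx, hEeq⟩ := exists_eq_env h0
      have hES := level_subset _ hE
      obtain ⟨D, hD, hab⟩ := ih E hE
      refine step D hD fun a r h => ?_
      rcases hor with hlt | hmin
      · exact ⟨_, ⟨E, hES, hEx, hab a r h⟩, by omega⟩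
      · obtain ⟨i, hi, ht⟩ := h.exists_touch hx
        have hZ' : Z \ D ⊆ P.S := Finset.sdiff_subset.trans hZ
        have := h.lt_top_of_above hZ' hES hEx hi ht (hab a r h)
        exact self h i hi ht (hmin _ (hZ' (h.mem i hi)) ht (by omega))

/-- The rectangles between the first `s` and the first `s + t` levels become loose by the deletion
of `t` of them. It suffices that they lie below the upper envelope in one column. -/
theorem exists_loose {s t x : ℕ} {Z : Finset ℕ} (hZ : Z ⊆ P.S)
    (hs : ∀ Q ∈ Z, ∀ x < P.N₁, P.Touch Q x → P.env (P.level s) x ≤ P.Y Q) (hx : x < P.N₁)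
    (ht : ∀ Q ∈ Z, P.Touch Q x → P.Y Q + P.H Q ≤ P.env (P.level (s + t)) x) :
    ∃ D : Finset ℕ, D.card ≤ t ∧ P.Loose (Z \ D) := by
  by_cases h0 : P.env (P.level (s + t)) x = 0
  · refine ⟨∅, Nat.zero_le _, fun a r h => ?_⟩
    rw [Finset.sdiff_empty] at h
    obtain ⟨i, hi, hix⟩ := h.exists_touch hx
    have := ht _ (h.mem i hi) hix
    have := P.pos _ (hZ (h.mem i hi))
    omega
  · obtain ⟨E, hE, hEx, hEeq⟩ := exists_eq_env h0
    obtain ⟨D, hD, hab⟩ := exists_above hZ hs t E hE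
    refine ⟨D, hD, fun a r h => ?_⟩
    obtain ⟨i, hi, hix⟩ := h.exists_touch hx
    have h1 := h.lt_top_of_above (Finset.sdiff_subset.trans hZ) (level_subset _ hE) hEx hi hix
      (hab a r h)
    have h2 := ht _ (Finset.sdiff_subset (h.mem i hi)) hix
    omega

end Layout

/-! ### Rounding -/

namespace Layout

variable {P : Layout}

variable (P) in
/-- The rectangles of `Z` to which a sequence of rectangles of `Z` leads from the left side of the
box, with small gaps and vertical overlaps as in `Layout.Chain`. -/
inductive Reach (Z : Finset ℕ) : ℕ → Prop
  | left {Q : ℕ} (h : Q ∈ Z) (hX : P.X Q ≤ P.ρ) : Reach Z Q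
  | step {Q R : ℕ} (hQ : Reach Z Q) (hR : R ∈ Z) (h1 : P.X Q + P.W Q ≤ P.X R)
      (h2 : P.X R ≤ P.X Q + P.W Q + 2 * P.ρ) (h3 : P.Y Q < P.Y R + P.H R)
      (h4 : P.Y R < P.Y Q + P.H Q) : Reach Z R

theorem Reach.exists_chain {Z : Finset ℕ} {Q : ℕ} (h : P.Reach Z Q) :
    ∃ a r, a r = Q ∧ (P.N₁ ≤ P.X Q + P.W Q + P.ρ → P.Chain Z a r) := by
  suffices H : ∃ (a : ℕ → ℕ) (r : ℕ), a r = Q ∧ (∀ i ≤ r, a i ∈ Z) ∧ P.X (a 0) ≤ P.ρ ∧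
      ∀ i < r, P.X (a i) + P.W (a i) ≤ P.X (a (i + 1)) ∧
        P.X (a (i + 1)) ≤ P.X (a i) + P.W (a i) + 2 * P.ρ ∧
        P.Y (a i) < P.Y (a (i + 1)) + P.H (a (i + 1)) ∧
        P.Y (a (i + 1)) < P.Y (a i) + P.H (a i) by
    obtain ⟨a, r, rfl, h1, h2, h3⟩ := H
    exact ⟨a, r, rfl, fun hr => ⟨h1, h2, hr, fun i hi => (h3 i hi).1, fun i hi => (h3 i hi).2.1,
      fun i hi => (h3 i hi).2.2.1, fun i hi => (h3 i hi).2.2.2⟩⟩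
  induction h with
  | @left Q h hX => exact ⟨fun _ => Q, 0, rfl, fun _ _ => h, hX, fun i hi => by omega⟩
  | @step Q R hQ hR h1 h2 h3 h4 ih =>
    obtain ⟨a, r, rfl, i1, i2, i3⟩ := ih
    refine ⟨fun i => if i ≤ r then a i else R, r + 1, by simp, fun i hi => ?_, by simpa using i2,
      fun i hi => ?_⟩
    · dsimp only
      split_ifs with hir
      · exact i1 i hir
      · exact hR
    · have hir : i ≤ r := by omega
      dsimp only
      rcases hir.eq_or_lt with rfl | hlt
      · simp only [le_refl, if_true, Nat.not_succ_le_self, if_false]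
        exact ⟨h1, h2, h3, h4⟩
      · rw [if_pos hir, if_pos (by omega)]
        exact i3 i hlt

/-- If positions are rounded down and widths are rounded up, rectangles overlap by at most one
unit. -/
theorem div_add_ceilDiv_le {g x w x' : ℕ} (hg : 0 < g) (h : x + w ≤ x') :
    x / g + (w + g - 1) / g ≤ x' / g + 1 := by
  have h1 := Nat.div_mul_le_self x g
  have h2 := Nat.div_mul_le_self (w + g - 1) g
  have h3 := Nat.lt_div_mul_add (a := x') hg
  refine Nat.le_of_lt_succ (lt_of_mul_lt_mul_right (a := g) ?_ (Nat.zero_le _))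
  simp only [Nat.succ_eq_add_one, add_mul]
  omega

theorem le_mul_ceilDiv {g : ℕ} (w : ℕ) (hg : 0 < g) :
    w ≤ g * ((w + g - 1) / g) ∧ g * ((w + g - 1) / g) < w + g := by
  have h1 := Nat.div_mul_le_self (w + g - 1) g
  have h2 := Nat.lt_div_mul_add (a := w + g - 1) hg
  rw [mul_comm] at h1 h2
  omega

/-- The rectangles of a loose set can be shifted horizontally by at most `ρ`, and widened, such that
their positions and widths become multiples of `g`. The rectangles that are reached from the left
side of the box are shifted to the right, by amounts that increase from left to right; the other
ones are shifted to the left in the same way. There is room for this between the rectangles of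
different type, as the gaps between them are large. -/
theorem Loose.exists_rounding {Z : Finset ℕ} (hL : P.Loose Z) (hZ : Z ⊆ P.S) {g k : ℕ}
    (hg : g = 1 ∨ 0 < g ∧ g * (k + 2) ≤ P.ρ) (hk : Z.card ≤ k) :
    ∃ ξ κ : ℕ → ℕ, ∀ Q ∈ Z, (P.W Q ≤ g * κ Q ∧ P.X Q ≤ g * ξ Q + P.ρ ∧
      g * ξ Q + g * κ Q ≤ P.X Q + P.W Q + P.ρ ∧ g * ξ Q + g * κ Q ≤ P.N₁) ∧
      ∀ R ∈ Z, Q ≠ R → g * ξ Q + g * κ Q ≤ g * ξ R ∨ g * ξ R + g * κ R ≤ g * ξ Q ∨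
        P.Y Q + P.H Q ≤ P.Y R ∨ P.Y R + P.H R ≤ P.Y Q := by
  classical
  rcases hg with rfl | ⟨hg, hgk⟩
  · -- nothing has to be rounded if the unit is `1`
    refine ⟨P.X, P.W, fun Q hQ => ⟨?_, fun R hR hne => ?_⟩⟩
    · have := P.right Q (hZ hQ)
      omega
    · simpa using P.sep Q (hZ hQ) R (hZ hR) hne
  -- the numbers of rectangles of the same type on the left and on the right, respectively, are the
  -- amounts, in units, by which a rectangle is shifted in addition to one unit for the rounding
  let rl : ℕ → ℕ := fun Q => Finset.card {R ∈ Z | P.Reach Z R ∧ P.X R + P.W R ≤ P.X Q}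
  let rr : ℕ → ℕ := fun Q => Finset.card {R ∈ Z | ¬P.Reach Z R ∧ P.X Q + P.W Q ≤ P.X R}
  let κ : ℕ → ℕ := fun Q => (P.W Q + g - 1) / g
  let ξ : ℕ → ℕ := fun Q => if P.Reach Z Q then P.X Q / g + 1 + rl Q else P.X Q / g - 1 - rr Q
  have hpos : ∀ Q ∈ Z, 0 < P.W Q := fun Q hQ => by have := P.wide Q (hZ hQ); omega
  have hrl : ∀ Q ∈ Z, rl Q < k := fun Q hQ => by
    refine lt_of_lt_of_le (Finset.card_lt_card ⟨Finset.filter_subset _ _, fun h => ?_⟩) hk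
    have := (Finset.mem_filter.1 (h hQ)).2.2
    have := hpos Q hQ
    omega
  have hrr : ∀ Q ∈ Z, rr Q < k := fun Q hQ => by
    refine lt_of_lt_of_le (Finset.card_lt_card ⟨Finset.filter_subset _ _, fun h => ?_⟩) hk
    have := (Finset.mem_filter.1 (h hQ)).2.2
    have := hpos Q hQ
    omega
  have hrl' : ∀ Q ∈ Z, ∀ R ∈ Z, P.Reach Z Q → P.X Q + P.W Q ≤ P.X R → rl Q < rl R := by
    intro Q hQ R hR h1 h2
    refine Finset.card_lt_card ⟨fun A hA => ?_, fun h => ?_⟩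
    · obtain ⟨a1, a2, a3⟩ := Finset.mem_filter.1 hA
      exact Finset.mem_filter.2 ⟨a1, a2, by omega⟩
    · have := (Finset.mem_filter.1 (h (Finset.mem_filter.2 ⟨hQ, h1, h2⟩))).2.2
      have := hpos Q hQ
      omega
  have hrr' : ∀ Q ∈ Z, ∀ R ∈ Z, ¬P.Reach Z R → P.X Q + P.W Q ≤ P.X R → rr R < rr Q := by
    intro Q hQ R hR h1 h2
    refine Finset.card_lt_card ⟨fun A hA => ?_, fun h => ?_⟩
    · obtain ⟨a1, a2, a3⟩ := Finset.mem_filter.1 hA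
      exact Finset.mem_filter.2 ⟨a1, a2, by omega⟩
    · have := (Finset.mem_filter.1 (h (Finset.mem_filter.2 ⟨hR, h1, h2⟩))).2.2
      have := hpos R hR
      omega
  have hκ : ∀ Q, P.W Q ≤ g * κ Q ∧ g * κ Q < P.W Q + g := fun Q => le_mul_ceilDiv _ hg
  have hdiv : ∀ Q, g * (P.X Q / g) ≤ P.X Q ∧ P.X Q < g * (P.X Q / g) + g := fun Q =>
    ⟨Nat.mul_div_le _ _, Nat.lt_mul_div_succ _ hg⟩
  -- rectangles that are reached from the left have room on their right, since there is no chain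
  have hl : ∀ Q ∈ Z, P.Reach Z Q → ξ Q = P.X Q / g + 1 + rl Q ∧ P.X Q ≤ g * ξ Q ∧
      g * ξ Q + g * κ Q ≤ P.X Q + P.W Q + P.ρ ∧ P.X Q + P.W Q + P.ρ ≤ P.N₁ := by
    intro Q hQ hr
    have e : ξ Q = P.X Q / g + 1 + rl Q := if_pos hr
    have h1 := hκ Q
    have h2 := hdiv Q
    have h3 : g * (rl Q + 1) ≤ g * k := Nat.mul_le_mul_left _ (hrl Q hQ)
    refine ⟨e, ?_, ?_, ?_⟩
    · rw [e, mul_add, mul_add, mul_one]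
      omega
    · rw [e, mul_add, mul_add, mul_one]
      rw [mul_add] at h3 hgk
      omega
    · obtain ⟨a, r, h4, h5⟩ := hr.exists_chain
      by_contra hc
      exact hL a r (h5 (by omega))
  -- the other rectangles have room on their left, since they are not within `ρ` of the left side
  have hr : ∀ Q ∈ Z, ¬P.Reach Z Q → ξ Q + 1 + rr Q = P.X Q / g ∧ P.X Q ≤ g * ξ Q + P.ρ ∧
      g * ξ Q + g * κ Q ≤ P.X Q + P.W Q := by
    intro Q hQ hn
    have e : ξ Q = P.X Q / g - 1 - rr Q := if_neg hn
    have h1 := hκ Q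
    have h2 := hdiv Q
    have h3 := hrr Q hQ
    have h4 : P.ρ < P.X Q := by
      by_contra hc
      exact hn (.left hQ (not_lt.1 hc))
    have h5 : k + 2 ≤ P.X Q / g := by
      rw [Nat.le_div_iff_mul_le hg, mul_comm]
      omega
    have e' : ξ Q + 1 + rr Q = P.X Q / g := by omega
    have h6 : g * (rr Q + 1) ≤ g * k := Nat.mul_le_mul_left _ h3
    refine ⟨e', ?_, ?_⟩
    · rw [← e', mul_add, mul_add, mul_one] at h2
      rw [mul_add] at h6 hgk
      omega
    · rw [← e', mul_add, mul_add, mul_one] at h2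
      omega
  -- rectangles that overlap vertically keep their order
  have hsep : ∀ Q ∈ Z, ∀ R ∈ Z, P.X Q + P.W Q ≤ P.X R → P.Y Q < P.Y R + P.H R →
      P.Y R < P.Y Q + P.H Q → g * ξ Q + g * κ Q ≤ g * ξ R := by
    intro Q hQ R hR h1 h2 h3
    have hd : P.X Q / g + κ Q ≤ P.X R / g + 1 := div_add_ceilDiv_le hg h1
    by_cases hQr : P.Reach Z Q
    · by_cases hRr : P.Reach Z R
      · have e1 := (hl Q hQ hQr).1
        have e2 := (hl R hR hRr).1
        have := hrl' Q hQ R hR hQr h1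
        rw [← mul_add]
        exact Nat.mul_le_mul_left _ (by omega)
      · have e1 := hl Q hQ hQr
        have e2 := hr R hR hRr
        have : P.X Q + P.W Q + 2 * P.ρ < P.X R := by
          by_contra hc
          exact hRr (.step hQr hR h1 (not_lt.1 hc) h2 h3)
        omega
    · by_cases hRr : P.Reach Z R
      · have e1 := hr Q hQ hQr
        have e2 := hl R hR hRr
        omega
      · have e1 := (hr Q hQ hQr).1
        have e2 := (hr R hR hRr).1
        have := hrr' Q hQ R hR hRr h1
        rw [← mul_add]
        exact Nat.mul_le_mul_left _ (by omega)
  refine ⟨ξ, κ, fun Q hQ => ⟨⟨(hκ Q).1, ?_⟩, fun R hR hne => ?_⟩⟩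
  · by_cases hQr : P.Reach Z Q
    · have := hl Q hQ hQr
      omega
    · have := hr Q hQ hQr
      have := P.right Q (hZ hQ)
      omega
  · have h1 := P.sep Q (hZ hQ) R (hZ hR) hne
    have h2 := hsep Q hQ R hR
    have h3 := hsep R hR Q hQ
    omega

end Layout

/-! ### The decomposition of a packing -/

/-- An interval contains at least one number of a given residue class modulo `T` in every `T`
consecutive numbers. -/
theorem le_mul_card_residue {T τ : ℕ} (hτ : τ < T) (b d : ℕ) :
    d ≤ T * (1 + Finset.card {f ∈ Finset.Ioo b (b + d) | f % T = τ}) := by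
  induction d using Nat.strong_induction_on with
  | _ d ih =>
    rcases le_or_gt d T with hd | hd
    · exact hd.trans (Nat.le_mul_of_pos_right _ (by omega))
    · have h1 := ih (d - T) (by omega)
      -- the largest number of the residue class below the end of the interval
      let f := T * ((b + d - 1 - τ) / T) + τ
      have hf1 : f ≤ b + d - 1 := by
        have := Nat.mul_div_le (b + d - 1 - τ) T
        omega
      have hf2 : b + (d - T) ≤ f := by
        have := Nat.lt_mul_div_succ (b + d - 1 - τ) (show 0 < T by omega)
        rw [mul_add, mul_one] at this
        omega
      have hf3 : f % T = τ := by
        rw [Nat.mul_add_mod, Nat.mod_eq_of_lt hτ]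
      have h2 : insert f ({f ∈ Finset.Ioo b (b + (d - T)) | f % T = τ} : Finset ℕ) ⊆
          ({f ∈ Finset.Ioo b (b + d) | f % T = τ} : Finset ℕ) := by
        intro i hi
        simp only [Finset.mem_insert, Finset.mem_filter, Finset.mem_Ioo] at hi ⊢
        rcases hi with hi | ⟨hi, hi'⟩
        · rw [hi]
          exact ⟨by omega, hf3⟩
        · exact ⟨by omega, hi'⟩
      have h3 := Finset.card_le_card h2
      rw [Finset.card_insert_of_notMem (by simp; omega)] at h3
      calc d = d - T + T := by omega
        _ ≤ T * (1 + Finset.card {f ∈ Finset.Ioo b (b + (d - T)) | f % T = τ}) + T := by omega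
        _ = T * (1 + (Finset.card {f ∈ Finset.Ioo b (b + (d - T)) | f % T = τ} + 1)) := by ring
        _ ≤ _ := Nat.mul_le_mul_left _ (by omega)

namespace Layout

variable (P : Layout)

/-- The number of rectangles of level `t + 1`. -/
noncomputable def gain (t : ℕ) : ℕ := (P.level (t + 1) \ P.level t).card

variable {P}

theorem sum_gain (m : ℕ) : ∑ t ∈ Finset.range m, P.gain t = (P.level m).card := by
  induction m with
  | zero => rfl
  | succ m ih =>
    rw [Finset.sum_range_succ, ih, gain, add_comm]
    exact Finset.card_sdiff_add_card_eq_card (level_subset_succ m)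

theorem sum_gain_le (m : ℕ) : ∑ t ∈ Finset.range m, P.gain t ≤ P.S.card :=
  (sum_gain m).trans_le (Finset.card_le_card (level_subset m))

theorem Loose.mono {Z Z' : Finset ℕ} (h : P.Loose Z') (hZ : Z ⊆ Z') : P.Loose Z :=
  fun a r hc => h a r (hc.mono hZ)

/-- The levels end when they reach up to the top in some column. -/
theorem exists_last_level (hN : 0 < P.N₁) : ∃ m,
    (∃ x < P.N₁, ∀ i ∈ P.S, P.Touch i x → P.Y i + P.H i ≤ P.env (P.level m) x) ∧
    ∀ t < m, ∀ x < P.N₁, ∃ i ∈ P.S, P.Touch i x ∧ P.env (P.level t) x < P.Y i + P.H i := by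
  classical
  have h : ∃ m, ∃ x < P.N₁, ∀ i ∈ P.S, P.Touch i x →
      P.Y i + P.H i ≤ P.env (P.level m) x := by
    by_contra! hc
    have hg : ∀ t, 1 ≤ P.gain t := by
      intro t
      have h1 := env_sdiff hN (hc t 0 hN)
      obtain ⟨i, h2, h3, h4⟩ := hc t 0 hN
      refine Finset.card_pos.2 (Finset.nonempty_iff_ne_empty.2 fun he => ?_)
      rw [he] at h1
      obtain ⟨j, h5, h6, h7⟩ := hc (t + 1) 0 hN
      obtain ⟨k, hk1, hk2⟩ := Finset.exists_min_image
        {i ∈ P.S | P.Touch i 0 ∧ P.env (P.level t) 0 < P.Y i + P.H i} P.Y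
        ⟨i, Finset.mem_filter.2 ⟨h2, h3, h4⟩⟩
      obtain ⟨k1, k2, k3⟩ := Finset.mem_filter.1 hk1
      have hl : k ∈ P.level (t + 1) := mem_level_succ.2 ⟨k1, 0, hN, k2, .inr fun j hj ht hlt =>
        hk2 j (Finset.mem_filter.2 ⟨hj, ht, hlt⟩)⟩
      have := le_env hl k2
      rw [← h1] at this
      have h0 : P.env ∅ 0 = 0 := rfl
      omega
    have h1 := sum_gain_le (P := P) (P.S.card + 1)
    have h2 : P.S.card + 1 ≤ ∑ t ∈ Finset.range (P.S.card + 1), P.gain t := by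
      simpa using Finset.sum_le_sum (s := Finset.range (P.S.card + 1)) fun t _ => hg t
    omega
  refine ⟨Nat.find h, Nat.find_spec h, fun t ht x hx => ?_⟩
  have := Nat.find_min h ht
  push Not at this
  exact this x hx

variable (P) in
open Classical in
/-- The last of the levels in `E` above which the rectangle `Q` lies, or `0`. -/
noncomputable def base (E : Finset ℕ) (Q : ℕ) : ℕ := Finset.sup {e ∈ E | Q ∉ P.level e} id

theorem base_mem {E : Finset ℕ} {Q : ℕ} (h : P.base E Q ≠ 0) :
    P.base E Q ∈ E ∧ Q ∉ P.level (P.base E Q) := by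
  classical
  have hne : ({e ∈ E | Q ∉ P.level e} : Finset ℕ).Nonempty := by
    by_contra hc
    rw [Finset.not_nonempty_iff_eq_empty] at hc
    exact h (by rw [base, hc]; rfl)
  obtain ⟨e, he, heq⟩ := Finset.exists_mem_eq_sup _ hne id
  have : P.base E Q = e := heq
  rw [this]
  exact Finset.mem_filter.1 he

theorem mem_level_of_base_lt {E : Finset ℕ} {Q e : ℕ} (he : e ∈ E) (h : P.base E Q < e) :
    Q ∈ P.level e := by
  classical
  by_contra hc
  exact absurd (Finset.le_sup (f := id) (Finset.mem_filter.2 ⟨he, hc⟩)) (not_le.2 h)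

/-- A set of rectangles between two consecutive levels of `E` becomes loose by few deletions,
unless it is small. -/
theorem exists_cut {T τ m b : ℕ} (hτ : τ < T) (hN : 0 < P.N₁)
    (hm : ∃ x < P.N₁, ∀ i ∈ P.S, P.Touch i x → P.Y i + P.H i ≤ P.env (P.level m) x)
    {E F Z : Finset ℕ} (hE : ∀ e ∈ E, e < m)
    (hF : ∀ f, 0 < f → f < m → f % T = τ → f ∉ E → f ∈ F ∧ T ≤ P.gain (f - 1))
    (hZ : Z ⊆ P.S) (hb : ∀ Q ∈ Z, P.base E Q = b)
    (hs : ∀ e ∈ E, ∀ Q ∈ Z, Q ∉ P.level e → Q ∉ P.level (e + 1)) :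
    ∃ D : Finset ℕ, T * D.card ≤ Z.card +
        T * ∑ f ∈ F with Finset.sup {e ∈ E | e < f} id = b, P.gain (f - 1) ∧
      ((Z \ D).card ≤ T * T ∨ P.Loose (Z \ D)) := by
  rcases le_or_gt Z.card (T * T) with hsm | hbig
  · exact ⟨∅, by simp, .inl (by simpa using hsm)⟩
  obtain ⟨Q₀, hQ₀⟩ : Z.Nonempty := Finset.card_pos.1 (by omega)
  have hbE : b = 0 ∨ b ∈ E := by
    by_cases h0 : b = 0
    · exact .inl h0
    · right
      rw [← hb Q₀ hQ₀] at h0 ⊢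
      exact (base_mem h0).1
  have hbm : b ≤ m := by
    rcases hbE with h | h
    · omega
    · exact (hE b h).le
  have habove : ∀ Q ∈ Z, ∀ x < P.N₁, P.Touch Q x → P.env (P.level b) x ≤ P.Y Q := by
    intro Q hQ x hx ht
    by_cases h0 : b = 0
    · rw [h0]
      exact Nat.zero_le _
    · rw [← hb Q hQ] at h0 ⊢
      obtain ⟨h1, h2⟩ := base_mem h0
      exact env_le_of_notMem (hZ hQ) (hs _ h1 Q hQ h2) hx ht
  -- the next level in `E`, or the last level
  obtain ⟨d, hd, ⟨x, hx, ht⟩, hno⟩ : ∃ d, b + d ≤ m ∧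
      (∃ x < P.N₁, ∀ Q ∈ Z, P.Touch Q x → P.Y Q + P.H Q ≤ P.env (P.level (b + d)) x) ∧
      ∀ e ∈ E, b < e → b + d ≤ e := by
    by_cases hne : ({e ∈ E | b < e} : Finset ℕ).Nonempty
    · obtain ⟨e, he, hmin⟩ := Finset.exists_min_image _ id hne
      obtain ⟨h1, h2⟩ := Finset.mem_filter.1 he
      refine ⟨e - b, ?_, ⟨0, hN, fun Q hQ ht => ?_⟩, fun e' h3 h4 => ?_⟩
      · have := hE e h1
        omega
      · rw [Nat.add_sub_cancel' h2.le]
        exact le_env (mem_level_of_base_lt h1 ((hb Q hQ).trans_lt h2)) ht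
      · have := hmin e' (Finset.mem_filter.2 ⟨h3, h4⟩)
        dsimp only [id] at this
        omega
    · obtain ⟨x, hx, h1⟩ := hm
      refine ⟨m - b, by omega, ⟨x, hx, fun Q hQ ht => ?_⟩, fun e' h3 h4 => ?_⟩
      · rw [Nat.add_sub_cancel' hbm]
        exact h1 Q (hZ hQ) ht
      · exact absurd ⟨e', Finset.mem_filter.2 ⟨h3, h4⟩⟩ hne
  -- At most `d` rectangles are deleted. The levels of the residue class in between are not in `E`,
  -- so each of them has at least `T` rectangles. These pay for all but `T` of the deletions, and
  -- `Z`, which has more than `T * T` elements, pays for the rest.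
  obtain ⟨D, hD, hloose⟩ := exists_loose hZ habove hx ht
  refine ⟨D, ?_, .inr hloose⟩
  have hsub : ({f ∈ Finset.Ioo b (b + d) | f % T = τ} : Finset ℕ) ⊆
      {f ∈ F | Finset.sup {e ∈ E | e < f} id = b} := by
    intro f hf
    simp only [Finset.mem_filter, Finset.mem_Ioo] at hf ⊢
    have hfE : f ∉ E := fun h => by
      have := hno f h hf.1.1
      omega
    refine ⟨(hF f (by omega) (by omega) hf.2 hfE).1, le_antisymm ?_ ?_⟩
    · refine Finset.sup_le fun e he => ?_
      obtain ⟨h1, h2⟩ := Finset.mem_filter.1 he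
      by_contra hc
      have := hno e h1 (not_le.1 hc)
      omega
    · rcases hbE with h | h
      · omega
      · exact Finset.le_sup (f := id) (Finset.mem_filter.2 ⟨h, hf.1.1⟩)
  have h1 := le_mul_card_residue hτ b d
  have h2 : T * Finset.card {f ∈ Finset.Ioo b (b + d) | f % T = τ} ≤
      ∑ f ∈ F with Finset.sup {e ∈ E | e < f} id = b, P.gain (f - 1) := by
    calc _ = ∑ f ∈ Finset.Ioo b (b + d) with f % T = τ, T := by
          rw [Finset.sum_const, smul_eq_mul, mul_comm]
      _ ≤ ∑ f ∈ Finset.Ioo b (b + d) with f % T = τ, P.gain (f - 1) := by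
          refine Finset.sum_le_sum fun f hf => ?_
          simp only [Finset.mem_filter, Finset.mem_Ioo] at hf
          refine (hF f (by omega) (by omega) hf.2 fun h => ?_).2
          have := hno f h hf.1.1
          omega
      _ ≤ _ := Finset.sum_le_sum_of_subset hsub
  calc T * D.card ≤ T * (T * (1 + Finset.card {f ∈ Finset.Ioo b (b + d) | f % T = τ})) :=
        Nat.mul_le_mul_left _ (hD.trans h1)
    _ = T * T + T * (T * Finset.card {f ∈ Finset.Ioo b (b + d) | f % T = τ}) := by ring
    _ ≤ _ := add_le_add hbig.le (Nat.mul_le_mul_left _ h2)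

/-- By the deletion of few rectangles, a packing decomposes into sets that are separated by the
envelopes of certain levels, each of which is attained by at most `T` rectangles; each of the sets
has at most `T * T` elements or is loose. The levels are taken from a residue class modulo `T`. -/
theorem exists_decomposition {T : ℕ} (hT : 0 < T) (hN : 0 < P.N₁) :
    ∃ R E : Finset ℕ, R ⊆ P.S ∧ T * P.S.card ≤ T * R.card + 5 * P.S.card ∧
      (∀ e ∈ E, ∃ A ⊆ P.S, A.card ≤ T ∧ ∀ x < P.N₁, P.env A x = P.env (P.level e) x) ∧
      (∀ e ∈ E, ∀ Q ∈ R, Q ∉ P.level e → Q ∉ P.level (e + 1)) ∧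
      ∀ b, Finset.card {Q ∈ R | P.base E Q = b} ≤ T * T ∨ P.Loose {Q ∈ R | P.base E Q = b} := by
  classical
  obtain ⟨m, hm, hlt⟩ := exists_last_level hN
  -- a residue class whose members, and the levels directly after them, have few rectangles
  obtain ⟨τ, hτ, hsum⟩ := Finset.exists_sum_fiber_le_of_maps_to_of_sum_le_nsmul
    (s := Finset.Ico 1 m) (t := Finset.range T) (f := fun e => e % T)
    (w := fun e => T * (P.gain (e - 1) + P.gain e)) (b := 2 * P.S.card)
    (fun e _ => Finset.mem_range.2 (Nat.mod_lt _ hT)) ⟨0, Finset.mem_range.2 hT⟩ (by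
      rw [← Finset.mul_sum, Finset.card_range, smul_eq_mul, Finset.sum_add_distrib]
      refine Nat.mul_le_mul_left _ ?_
      have h1 : ∑ e ∈ Finset.Ico 1 m, P.gain e ≤ P.S.card := by
        refine (Finset.sum_le_sum_of_subset fun e he => ?_).trans (sum_gain_le m)
        exact Finset.mem_range.2 (Finset.mem_Ico.1 he).2
      have h2 : ∑ e ∈ Finset.Ico 1 m, P.gain (e - 1) ≤ P.S.card := by
        rw [Finset.sum_Ico_eq_sum_range]
        simp only [Nat.add_sub_cancel_left]
        exact sum_gain_le (m - 1)
      omega)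
  replace hτ := Finset.mem_range.1 hτ
  rw [← Finset.mul_sum] at hsum
  -- Cuts are made at the members `e` of the class for which level `e` is small. The rectangles of
  -- level `e + 1` are deleted, so that all remaining ones lie above or below the envelope.
  let E₀ : Finset ℕ := {e ∈ Finset.Ico 1 m | e % T = τ}
  let E : Finset ℕ := {e ∈ E₀ | P.gain (e - 1) ≤ T}
  let F : Finset ℕ := {e ∈ E₀ | ¬P.gain (e - 1) ≤ T}
  let U : Finset ℕ := E.biUnion fun e => P.level (e + 1) \ P.level e
  let Z : ℕ → Finset ℕ := fun b => {Q ∈ P.S \ U | P.base E Q = b}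
  have hE₀ : ∀ e ∈ E₀, 0 < e ∧ e < m ∧ e % T = τ := by
    intro e he
    obtain ⟨h1, h2⟩ := Finset.mem_filter.1 he
    have := Finset.mem_Ico.1 h1
    omega
  have hE : ∀ e ∈ E, 0 < e ∧ e < m ∧ e % T = τ ∧ P.gain (e - 1) ≤ T := by
    intro e he
    obtain ⟨h1, h2⟩ := Finset.mem_filter.1 he
    obtain ⟨h3, h4, h5⟩ := hE₀ e h1
    exact ⟨h3, h4, h5, h2⟩
  have hU : ∀ e ∈ E, ∀ Q ∈ P.S \ U, Q ∉ P.level e → Q ∉ P.level (e + 1) := by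
    intro e he Q hQ h1 h2
    exact (Finset.mem_sdiff.1 hQ).2 (Finset.mem_biUnion.2 ⟨e, he, Finset.mem_sdiff.2 ⟨h2, h1⟩⟩)
  have hcut : ∀ b, ∃ D : Finset ℕ, T * D.card ≤ (Z b).card +
      T * ∑ f ∈ F with Finset.sup {e ∈ E | e < f} id = b, P.gain (f - 1) ∧
      ((Z b \ D).card ≤ T * T ∨ P.Loose (Z b \ D)) := by
    intro b
    refine exists_cut hτ hN hm (fun e he => (hE e he).2.1) (fun f h0 h1 h2 h3 => ?_)
      ((Finset.filter_subset _ _).trans Finset.sdiff_subset)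
      (fun Q hQ => (Finset.mem_filter.1 hQ).2)
      fun e he Q hQ => hU e he Q (Finset.mem_filter.1 hQ).1
    have h4 : f ∈ E₀ := Finset.mem_filter.2 ⟨Finset.mem_Ico.2 ⟨h0, h1⟩, h2⟩
    have h5 : ¬P.gain (f - 1) ≤ T := fun h => h3 (Finset.mem_filter.2 ⟨h4, h⟩)
    exact ⟨Finset.mem_filter.2 ⟨h4, h5⟩, by omega⟩
  choose D hD1 hD2 using hcut
  let B := insert 0 E
  let V := B.biUnion D
  have hbase : ∀ Q, P.base E Q ∈ B := by
    intro Q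
    by_cases h0 : P.base E Q = 0
    · rw [h0]
      exact Finset.mem_insert_self _ _
    · exact Finset.mem_insert_of_mem (base_mem h0).1
  refine ⟨(P.S \ U) \ V, E, Finset.sdiff_subset.trans Finset.sdiff_subset, ?_, ?_, ?_, ?_⟩
  · have c1 := Finset.card_le_card_sdiff_add_card (s := P.S) (t := U)
    have c2 := Finset.card_le_card_sdiff_add_card (s := P.S \ U) (t := V)
    have c3 : U.card ≤ ∑ e ∈ E, P.gain e := Finset.card_biUnion_le
    have c4 : V.card ≤ ∑ b ∈ B, (D b).card := Finset.card_biUnion_le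
    have c5 : ∑ b ∈ B, (Z b).card ≤ P.S.card := by
      rw [← Finset.card_eq_sum_card_fiberwise fun Q _ => hbase Q]
      exact Finset.card_le_card Finset.sdiff_subset
    have c6 : ∑ b ∈ B, ∑ f ∈ F with Finset.sup {e ∈ E | e < f} id = b, P.gain (f - 1) =
        ∑ f ∈ F, P.gain (f - 1) := by
      refine Finset.sum_fiberwise_of_maps_to (fun f _ => ?_) _
      rcases Finset.eq_empty_or_nonempty {e ∈ E | e < f} with h | h
      · rw [h]
        exact Finset.mem_insert_self _ _
      · obtain ⟨e, he, heq⟩ := Finset.exists_mem_eq_sup _ h id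
        rw [heq]
        exact Finset.mem_insert_of_mem (Finset.mem_filter.1 he).1
    have c7 : T * ∑ b ∈ B, (D b).card ≤ P.S.card + T * ∑ f ∈ F, P.gain (f - 1) := by
      rw [Finset.mul_sum]
      refine (Finset.sum_le_sum fun b _ => hD1 b).trans ?_
      rw [Finset.sum_add_distrib, ← Finset.mul_sum, c6]
      exact Nat.add_le_add_right c5 _
    have c8 : T * (∑ f ∈ F, P.gain (f - 1) + ∑ e ∈ E, P.gain e) ≤ 2 * P.S.card := by
      refine le_trans (Nat.mul_le_mul_left _ ?_) hsum
      rw [Finset.sum_add_distrib]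
      exact add_le_add (Finset.sum_le_sum_of_subset (Finset.filter_subset _ _))
        (Finset.sum_le_sum_of_subset (Finset.filter_subset _ _))
    have c9 : P.S.card ≤ ((P.S \ U) \ V).card + (∑ e ∈ E, P.gain e + ∑ b ∈ B, (D b).card) := by
      omega
    have c10 := Nat.mul_le_mul_left T c9
    rw [mul_add, mul_add] at c10
    rw [mul_add] at c8
    omega
  · intro e he
    obtain ⟨h1, h2, -, h3⟩ := hE e he
    refine ⟨P.level (e - 1 + 1) \ P.level (e - 1), Finset.sdiff_subset.trans (level_subset _), h3,
      fun x hx => ?_⟩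
    rw [env_sdiff hx (hlt _ (by omega) x hx), Nat.sub_add_cancel h1]
  · intro e he Q hQ
    exact hU e he Q (Finset.sdiff_subset hQ)
  · intro b
    by_cases hb : b ∈ B
    · have hsub : ({Q ∈ (P.S \ U) \ V | P.base E Q = b} : Finset ℕ) ⊆ Z b \ D b := by
        intro Q hQ
        obtain ⟨h1, h2⟩ := Finset.mem_filter.1 hQ
        obtain ⟨h3, h4⟩ := Finset.mem_sdiff.1 h1
        exact Finset.mem_sdiff.2 ⟨Finset.mem_filter.2 ⟨h3, h2⟩, fun h =>
          h4 (Finset.mem_biUnion.2 ⟨b, hb, h⟩)⟩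
      exact (hD2 b).imp (Finset.card_le_card hsub).trans fun h => h.mono hsub
    · left
      rw [Finset.filter_false_of_mem fun Q _ h => hb (by rw [← h]; exact hbase Q)]
      simp

end Layout

/-! ### Colours, orders and codes -/

namespace Knapsack

open RAM

/-- A linear hash function modulo a prime number is injective on a given set of `k` items, for some
multiplier, if its values are taken modulo `k * k`: for two items, only few multipliers lead to
a collision. -/
theorem exists_hash {n k : ℕ} {S : Finset ℕ} (hS : ∀ i ∈ S, i < n) (hcard : S.card = k)
    (hn : 0 < n) : ∃ p a, p < 2 * n + 1 ∧ a < 2 * n + 1 ∧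
      ∀ i ∈ S, ∀ j ∈ S, a * i % p % (k * k) = a * j % p % (k * k) → i = j := by
  classical
  obtain ⟨p, hp, hnp, hp2⟩ := Nat.exists_prime_lt_and_le_two_mul n hn.ne'
  have : Fact p.Prime := ⟨hp⟩
  rcases Nat.eq_zero_or_pos k with rfl | hk
  · refine ⟨0, 0, by omega, by omega, fun i hi => ?_⟩
    rw [Finset.card_eq_zero.1 hcard] at hi
    simp at hi
  -- the multipliers for which the difference of two hash values is divisible by `k * k`
  let bad : ℕ × ℕ → Finset ℕ := fun ij => {a ∈ Finset.Ioc 0 (p - 1) |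
    k * k ∣ ((a : ZMod p) * ((ij.1 : ZMod p) - ij.2)).val}
  have hp1 := hp.one_lt
  have hbad : ∀ ij ∈ S.offDiag, (bad ij).card ≤ (p - 1) / (k * k) := by
    rintro ⟨i, j⟩ hij
    obtain ⟨h1, h2, h3⟩ := Finset.mem_offDiag.1 hij
    have hne : (i : ZMod p) - j ≠ 0 := by
      rw [sub_ne_zero]
      intro h
      have := (ZMod.natCast_eq_natCast_iff' i j p).1 h
      rw [Nat.mod_eq_of_lt ((hS i h1).trans hnp), Nat.mod_eq_of_lt ((hS j h2).trans hnp)] at this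
      exact h3 this
    rw [← Nat.Ioc_filter_dvd_card_eq_div]
    refine Finset.card_le_card_of_injOn
      (fun a : ℕ => ((a : ZMod p) * ((i : ZMod p) - (j : ZMod p))).val) ?_ ?_
    · intro a ha
      obtain ⟨h4, h5⟩ := Finset.mem_filter.1 ha
      have h6 := Finset.mem_Ioc.1 h4
      refine Finset.mem_coe.2 (Finset.mem_filter.2 ⟨Finset.mem_Ioc.2 ⟨?_, ?_⟩, h5⟩)
      · refine Nat.pos_of_ne_zero fun h0 => ?_
        rw [ZMod.val_eq_zero] at h0
        rcases mul_eq_zero.1 h0 with h0 | h0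
        · rw [ZMod.natCast_eq_zero_iff] at h0
          have := Nat.le_of_dvd h6.1 h0
          omega
        · exact hne h0
      · have := ZMod.val_lt ((a : ZMod p) * ((i : ZMod p) - (j : ZMod p)))
        exact Nat.le_sub_one_of_lt this
    · intro a ha b hb hab
      have ha' := Finset.mem_Ioc.1 (Finset.mem_filter.1 ha).1
      have hb' := Finset.mem_Ioc.1 (Finset.mem_filter.1 hb).1
      have h4 := mul_right_cancel₀ hne (ZMod.val_injective p hab)
      have := (ZMod.natCast_eq_natCast_iff' a b p).1 h4
      rwa [Nat.mod_eq_of_lt (by omega), Nat.mod_eq_of_lt (by omega)] at this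
  have hU : (S.offDiag.biUnion bad).card < (Finset.Ioc 0 (p - 1)).card := by
    refine Finset.card_biUnion_le.trans_lt ((Finset.sum_le_card_nsmul _ _ _ hbad).trans_lt ?_)
    rw [Finset.offDiag_card, hcard, smul_eq_mul, Nat.card_Ioc, Nat.sub_zero]
    rcases Nat.eq_zero_or_pos ((p - 1) / (k * k)) with h0 | h0
    · rw [h0]
      omega
    · calc (k * k - k) * ((p - 1) / (k * k)) < k * k * ((p - 1) / (k * k)) := by
            refine Nat.mul_lt_mul_of_pos_right ?_ h0
            have := Nat.le_mul_of_pos_right k hk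
            omega
        _ ≤ p - 1 := Nat.mul_div_le _ _
  obtain ⟨a, ha, haU⟩ := Finset.exists_mem_notMem_of_card_lt_card hU
  have hgood : ∀ i ∈ S, ∀ j ∈ S, i ≠ j →
      ¬k * k ∣ ((a : ZMod p) * ((i : ZMod p) - j)).val := fun i hi j hj hne hd =>
    haU (Finset.mem_biUnion.2 ⟨(i, j), Finset.mem_offDiag.2 ⟨hi, hj, hne⟩,
      Finset.mem_filter.2 ⟨ha, hd⟩⟩)
  have key : ∀ i ∈ S, ∀ j ∈ S, a * i % p % (k * k) = a * j % p % (k * k) →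
      a * j % p ≤ a * i % p → i = j := by
    intro i hi j hj he hle
    by_contra hne
    refine hgood i hi j hj hne ?_
    have h1 : ((a : ZMod p) * ((i : ZMod p) - j)) = ((a * i % p - a * j % p : ℕ) : ZMod p) := by
      rw [Nat.cast_sub hle, ZMod.natCast_mod, ZMod.natCast_mod]
      push_cast
      ring
    rw [h1, ZMod.val_cast_of_lt ((Nat.sub_le _ _).trans_lt (Nat.mod_lt _ hp.pos))]
    exact (Nat.modEq_iff_dvd' hle).1 he.symm
  have ha' := Finset.mem_Ioc.1 ha
  refine ⟨p, a, by omega, by omega, fun i hi j hj he => ?_⟩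
  rcases le_total (a * j % p) (a * i % p) with h | h
  · exact key i hi j hj he h
  · exact (key j hj i hi he.symm h).symm

/-- A finite set can be listed without repetitions, in the order of a given key. -/
theorem exists_enumeration (f : ℕ → ℕ) {J : ℕ} {A : Finset ℕ} (hA : A.card = J) :
    ∃ r : ℕ → ℕ, (∀ i < J, r i ∈ A) ∧ ∀ i < J, ∀ i' < i, r i' ≠ r i ∧ f (r i') ≤ f (r i) := by
  induction J generalizing A with
  | zero => exact ⟨fun _ => 0, fun i hi => by omega, fun i hi => by omega⟩
  | succ J ih =>
    obtain ⟨m, hm, hmax⟩ := Finset.exists_max_image A f (Finset.card_pos.1 (by omega))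
    obtain ⟨r, h1, h2⟩ := ih (A := A.erase m) (by rw [Finset.card_erase_of_mem hm]; omega)
    refine ⟨Function.update r J m, fun i hi => ?_, fun i hi i' hi' => ?_⟩
    · rcases Nat.lt_succ_iff_lt_or_eq.1 hi with h | rfl
      · rw [Function.update_of_ne h.ne]
        exact Finset.mem_of_mem_erase (h1 i h)
      · rwa [Function.update_self]
    · rw [Function.update_of_ne (show i' ≠ J by omega)]
      rcases Nat.lt_succ_iff_lt_or_eq.1 hi with h | rfl
      · rw [Function.update_of_ne h.ne]
        exact h2 i h i' hi'
      · rw [Function.update_self]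
        have := h1 i' hi'
        exact ⟨Finset.ne_of_mem_erase this, hmax _ (Finset.mem_of_mem_erase this)⟩

namespace Par

variable {Q : Par}

/-- Every sequence of `T` steps is encoded by a contour. -/
theorem exists_contour (hB : Q.Bc = Q.bi ^ (3 * Q.T)) {A B C : ℕ → ℕ}
    (h : ∀ t < Q.T, A t < Q.bi ∧ B t < Q.bi ∧ C t < Q.bi) : ∃ c < Q.Bc, ∀ x, Q.cont c x =
      (Finset.range Q.T).sup fun t => if A t ≤ x ∧ x < B t then C t else 0 := by
  obtain ⟨c, hc, hd⟩ := exists_digits (b := Q.bi) (3 * Q.T)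
    (fun i => if i % 3 = 0 then A (i / 3) else if i % 3 = 1 then B (i / 3) else C (i / 3))
    (fun i hi => by
      obtain ⟨h1, h2, h3⟩ := h (i / 3) (by omega)
      split_ifs <;> assumption)
  refine ⟨c, by rw [hB]; exact hc, fun x => ?_⟩
  refine Finset.sup_congr rfl fun t ht => ?_
  have ht' := Finset.mem_range.1 ht
  rw [hd _ (show 3 * t < 3 * Q.T by omega), hd _ (show 3 * t + 1 < 3 * Q.T by omega),
    hd _ (show 3 * t + 2 < 3 * Q.T by omega)]
  have e0 : 3 * t % 3 = 0 := by omega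
  have e1 : (3 * t + 1) % 3 = 1 := by omega
  have e2 : (3 * t + 2) % 3 = 2 := by omega
  have d0 : 3 * t / 3 = t := by omega
  have d1 : (3 * t + 1) / 3 = t := by omega
  have d2 : (3 * t + 2) / 3 = t := by omega
  simp [e0, e1, e2, d0, d1, d2]

theorem best_spec {γ κ i : ℕ} (hi : i < Q.n) (hc : Q.Cand γ κ i) :
    Q.best γ κ < Q.n ∧ Q.Cand γ κ (Q.best γ κ) ∧ Q.h (Q.best γ κ) ≤ Q.h i := by
  classical
  obtain ⟨m, hm, hmin⟩ := Finset.exists_min_image {i ∈ Finset.range Q.n | Q.Cand γ κ i} Q.h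
    ⟨i, Finset.mem_filter.2 ⟨Finset.mem_range.2 hi, hc⟩⟩
  obtain ⟨hm1, hm2⟩ := Finset.mem_filter.1 hm
  have hm3 : Q.Cand γ κ m ∧ ∀ i' < Q.n, Q.Cand γ κ i' → Q.h m ≤ Q.h i' :=
    ⟨hm2, fun i' h1 h2 => hmin i' (Finset.mem_filter.2 ⟨Finset.mem_range.2 h1, h2⟩)⟩
  have hle : m ≤ Q.best γ κ := by
    refine le_trans ?_ (Finset.le_sup (b := m) hm1)
    rw [if_pos hm3]
  obtain ⟨b, hb, hbe⟩ := Finset.exists_mem_eq_sup (Finset.range Q.n) ⟨m, hm1⟩ fun i =>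
    if Q.Cand γ κ i ∧ ∀ i' < Q.n, Q.Cand γ κ i' → Q.h i ≤ Q.h i' then i else 0
  have hbe' : Q.best γ κ =
    if Q.Cand γ κ b ∧ ∀ i' < Q.n, Q.Cand γ κ i' → Q.h b ≤ Q.h i' then b else 0 := hbe
  split_ifs at hbe' with h
  · rw [hbe']
    exact ⟨Finset.mem_range.1 hb, h.1, h.2 i hi hc⟩
  · -- the value `0` of the supremum is then the index of an item with the property
    obtain rfl : m = 0 := by omega
    rw [hbe']
    exact ⟨Finset.mem_range.1 hm1, hm3.1, hm3.2 i hi hc⟩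

end Par

end Knapsack

/-! ### From packings to paths -/

namespace Knapsack

open RAM

namespace Par

variable {Q : Par}

/-- A packing of the items `r i`, `i < J`, at heights `y i`, that the search finds if it guesses
the properties of the slots right. The item in slot `i` may occupy the columns `x` with
`lo i ≤ x < lo i + le i`. The contour with code `c j` separates the slots from `j` on from the
segments before, if a segment starts with `j`. -/
structure Plan (Q : Par) (r y lo le c : ℕ → ℕ) : Prop where
  lt : ∀ i < Q.J, r i < Q.n
  color : ∀ i < Q.J, Q.color (r i) = Q.slot 0 i
  ne : ∀ i < Q.J, ∀ i' < i, Q.slot 0 i' ≠ Q.slot 0 i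
  right : ∀ i < Q.J, lo i + le i ≤ Q.N₁
  top : ∀ i < Q.J, y i + Q.h (r i) ≤ Q.N₂
  free : ∀ i < Q.J, Q.slot 3 i ≠ 0 → r i < Q.bi ∧ lo i < Q.bi ∧ Q.w (r i) ≤ le i
  small : ∀ j, ∀ i < Q.J, Q.InSeg j i → Q.slot 3 i ≠ 0 → i - j < Q.T * Q.T
  rounded : ∀ i < Q.J, Q.slot 3 i = 0 →
    lo i = Q.g * Q.slot 2 i ∧ Q.w (r i) ≤ Q.g * Q.slot 1 i ∧ Q.g * Q.slot 1 i ≤ le i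
  sep : ∀ j, ∀ i < Q.J, Q.InSeg j i → ∀ i' < i, j ≤ i' → lo i < lo i' + le i' →
    lo i' < lo i + le i → y i' + Q.h (r i') ≤ y i
  code : ∀ j, c j < Q.Bc
  code_zero : c 0 = 0
  below : ∀ j, ∀ i < Q.J, Q.InSeg j i → ∀ x, lo i ≤ x → x < lo i + le i → Q.cont (c j) x ≤ y i
  above : ∀ j, ∀ i < Q.J, Q.InSeg j i → ∀ x, lo i ≤ x → x < lo i + le i →
    y i + Q.h (r i) ≤ Q.cont (c (Q.next j)) x
  mono : ∀ j < Q.J, ∀ x < Q.N₁, Q.cont (c j) x ≤ Q.cont (c (Q.next j)) x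

theorem inSeg_of_lt_next {j i : ℕ} (hji : j ≤ i) (hi : i < Q.next j) : Q.InSeg j i := by
  classical
  obtain ⟨i', hi', hlt⟩ := (Finset.lt_sup_iff).1 hi
  split_ifs at hlt with h
  · exact ⟨hji, fun l hl hjl => h.2 l (by omega) hjl⟩
  · omega

/-- The heights at which the items of a segment are dropped. -/
theorem exists_yy (Q : Par) (c j v : ℕ) : ∃ Y : ℕ → ℕ, ∀ i, Y i = Q.yy c j v Y i := by
  let F : (i : ℕ) → ((i' : ℕ) → i' < i → ℕ) → ℕ := fun i f =>
    Q.yy c j v (fun i' => if h : i' < i then f i' h else 0) i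
  refine ⟨fun i => WellFounded.fix Nat.lt_wfRel.wf F i, fun i => ?_⟩
  change WellFounded.fix Nat.lt_wfRel.wf F i = _
  rw [WellFounded.fix_eq]
  exact Q.yy_congr fun i' _ h => by simp [h]

/-- The search follows a plan: a segment that is packed greedily ends up nowhere above the segment
in the plan, so the contours of the plan remain valid. -/
theorem Plan.path {r y lo le c : ℕ → ℕ} (hP : Q.Plan r y lo le c)
    (hBc : Q.Bc = Q.bi ^ (3 * Q.T)) (hbi : 0 < Q.bi) : Q.Path Q.Bv 0 := by
  have hpos : 0 < Q.Bc := by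
    rw [hBc]
    exact Nat.pow_pos hbi
  suffices H : ∀ d j, Q.J ≤ j + d → Q.Path Q.Bv (j * Q.Bc + c j) by
    have := H Q.J 0 (by omega)
    rwa [hP.code_zero, zero_mul] at this
  intro d
  induction d with
  | zero =>
    intro j hj
    exact .done ((Nat.mul_le_mul_right _ (by omega)).trans (Nat.le_add_right _ _))
  | succ d ih =>
    intro j hj
    rcases le_or_gt Q.J j with hJ | hJ
    · exact ih j (by omega)
    have hnext := Q.lt_next hJ
    obtain ⟨f, hf, hfd⟩ := exists_digits (b := Q.bi) (2 * (Q.T * Q.T))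
      (fun l => if j + l / 2 < Q.next j ∧ Q.slot 3 (j + l / 2) ≠ 0 then
        if l % 2 = 0 then r (j + l / 2) else lo (j + l / 2) else 0) (fun l _ => by
          split_ifs with h1 h2
          · exact (hP.free _ (h1.1.trans_le Q.next_le) h1.2).1
          · exact (hP.free _ (h1.1.trans_le Q.next_le) h1.2).2.1
          · exact hbi)
    -- the end of the segment, and the choices for its free slots
    let v := c (Q.next j) + Q.Bc * f
    have hc := hP.code (Q.next j)
    have hvm : v % Q.Bc = c (Q.next j) := by
      rw [Nat.add_mul_mod_self_left, Nat.mod_eq_of_lt hc]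
    have hv : v < Q.Bv := by
      calc v < Q.Bc + Q.Bc * f := Nat.add_lt_add_right hc _
        _ = Q.Bc * (f + 1) := by ring
        _ ≤ Q.Bc * Q.bi ^ (2 * (Q.T * Q.T)) := Nat.mul_le_mul_left _ hf
        _ = Q.Bv := by rw [hBc, Bv, pow_add]
    have ha : (j * Q.Bc + c j) / Q.Bc = j := by
      rw [add_comm, Nat.add_mul_div_right _ _ hpos, Nat.div_eq_of_lt (hP.code j), zero_add]
    have ham : (j * Q.Bc + c j) % Q.Bc = c j := by
      rw [add_comm, Nat.add_mul_mod_self_right, Nat.mod_eq_of_lt (hP.code j)]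
    -- every slot holds an item that is at most as high as the one in the plan
    have hslot : ∀ i, j ≤ i → i < Q.next j → Q.xx j v i = lo i ∧ Q.it j v i < Q.n ∧
        Q.color (Q.it j v i) = Q.slot 0 i ∧ Q.w (Q.it j v i) ≤ le i ∧
        Q.h (Q.it j v i) ≤ Q.h (r i) := by
      intro i hji hi
      have hiJ : i < Q.J := hi.trans_le Q.next_le
      by_cases h3 : Q.slot 3 i ≠ 0
      · have hs := hP.small j i hiJ (inSeg_of_lt_next hji hi) h3
        have hadd : j + (i - j) = i := by omega
        have hd0 : digit Q.bi v (3 * Q.T + 2 * (i - j)) = r i := by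
          simp only [v]
          rw [hBc] at hc ⊢
          rw [digit_add_mul hc, hfd _ (by omega), Nat.mul_div_cancel_left _ (by omega), hadd,
            if_pos ⟨hi, h3⟩, if_pos (by omega)]
        have hd1 : digit Q.bi v (3 * Q.T + 2 * (i - j) + 1) = lo i := by
          have e : (2 * (i - j) + 1) / 2 = i - j := by omega
          simp only [v]
          rw [hBc] at hc ⊢
          rw [add_assoc, digit_add_mul hc, hfd _ (by omega), e, hadd, if_pos ⟨hi, h3⟩,
            if_neg (by omega)]
        have e1 : Q.it j v i = r i := by rw [it, if_pos h3, hd0]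
        have e2 : Q.xx j v i = lo i := by rw [xx, if_pos h3, hd1]
        rw [e1, e2]
        exact ⟨rfl, hP.lt i hiJ, hP.color i hiJ, (hP.free i hiJ h3).2.2, le_rfl⟩
      · have e1 : Q.it j v i = Q.best (Q.slot 0 i) (Q.slot 1 i) := by rw [it, if_neg h3]
        have e2 : Q.xx j v i = Q.g * Q.slot 2 i := by rw [xx, if_neg h3]
        obtain ⟨h4, h5, h6⟩ := hP.rounded i hiJ (not_not.1 h3)
        obtain ⟨b1, b2, b3⟩ := best_spec (hP.lt i hiJ) ⟨hP.color i hiJ, h5⟩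
        rw [e1, e2]
        exact ⟨h4.symm, b1, b2.1, b2.2.trans h6, b3⟩
    obtain ⟨Y, hY⟩ := Q.exists_yy (c j) j v
    have hle : ∀ i, j ≤ i → i < Q.next j → Y i ≤ y i := by
      intro i
      induction i using Nat.strong_induction_on with
      | _ i ihi =>
        intro hji hi
        have hiJ : i < Q.J := hi.trans_le Q.next_le
        have hseg := inSeg_of_lt_next hji hi
        obtain ⟨s1, s2, s3, s4, s5⟩ := hslot i hji hi
        rw [hY i, yy]
        refine max_le (Finset.sup_le fun x hx => ?_) (Finset.sup_le fun i' hi' => ?_)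
        · split_ifs with hcond
          · rw [s1] at hcond
            exact hP.below j i hiJ hseg x hcond.1 (by omega)
          · exact Nat.zero_le _
        · have hi' := Finset.mem_range.1 hi'
          split_ifs with hcond
          · obtain ⟨t1, t2, t3, t4, t5⟩ := hslot i' hcond.1 (by omega)
            rw [s1, t1] at hcond
            have h1 := hP.sep j i hiJ hseg i' hi' hcond.1 (by omega) (by omega)
            have h2 := ihi i' hi' hcond.1 (by omega)
            have h3 := min_le_left (Y i') Q.N₂
            omega
          · exact Nat.zero_le _
    have htar : Q.target (j * Q.Bc + c j) v = Q.next j * Q.Bc + c (Q.next j) := by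
      rw [target, ha, hvm]
    refine .step (v := v) (Y := Y) hv ?_ ?_ (by rw [htar]; exact ih _ (by omega))
    · calc j * Q.Bc + c j < j * Q.Bc + Q.Bc := Nat.add_lt_add_left (hP.code j) _
        _ = (j + 1) * Q.Bc := by ring
        _ ≤ Q.J * Q.Bc := Nat.mul_le_mul_right _ hJ
    · unfold Run
      rw [ha, ham]
      intro i hji hi
      refine ⟨hY i, ?_⟩
      have hiJ : i < Q.J := hi.trans_le Q.next_le
      have hseg := inSeg_of_lt_next hji hi
      obtain ⟨s1, s2, s3, s4, s5⟩ := hslot i hji hi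
      have h1 := hle i hji hi
      have h2 := hP.right i hiJ
      have h3 := hP.top i hiJ
      refine ⟨s2, s3, hP.ne i hiJ, by omega, by omega, fun x _ hx1 hx2 => ?_, fun x hx => ?_⟩
      · rw [hvm]
        have := hP.above j i hiJ hseg x (by omega) (by omega)
        omega
      · rw [hvm]
        exact hP.mono j hJ x hx

end Par

end Knapsack

namespace Knapsack

open RAM

namespace Par

variable {Q : Par}

theorem cont_zero (x : ℕ) : Q.cont 0 x = 0 := by
  refine Nat.le_zero.1 (Finset.sup_le fun t _ => ?_)
  simp [digit]

/-- The upper envelope of at most `T` rectangles is a contour. -/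
theorem exists_contour_env {P : Layout} (hB : Q.Bc = Q.bi ^ (3 * Q.T))
    (hbi : Q.bi = Q.n + Q.N₁ + Q.N₂ + 1) (h1 : P.N₁ = Q.N₁) (h2 : P.N₂ = Q.N₂) {A : Finset ℕ}
    (hA : A ⊆ P.S) (hT : A.card ≤ Q.T) :
    ∃ c < Q.Bc, ∀ x < P.N₁, Q.cont c x = P.env A x := by
  classical
  obtain ⟨r, hr, hr'⟩ := exists_enumeration (fun _ => 0) (A := A) rfl
  have himg : (Finset.range A.card).image r = A := by
    refine Finset.eq_of_subset_of_card_le ?_ ?_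
    · intro i hi
      obtain ⟨t, ht, rfl⟩ := Finset.mem_image.1 hi
      exact hr t (Finset.mem_range.1 ht)
    · rw [Finset.card_image_of_injOn, Finset.card_range]
      intro i hi j hj hij
      have hi := Finset.mem_range.1 (Finset.mem_coe.1 hi)
      have hj := Finset.mem_range.1 (Finset.mem_coe.1 hj)
      rcases lt_trichotomy i j with h | h | h
      · exact absurd hij (hr' j hj i h).1
      · exact h
      · exact absurd hij.symm (hr' i hi j h).1
  obtain ⟨c, hc, hcont⟩ := exists_contour (Q := Q) hB
    (A := fun t => if t < A.card then P.X (r t) - P.ρ else 0)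
    (B := fun t => if t < A.card then min (P.X (r t) + P.W (r t) + P.ρ) P.N₁ else 0)
    (C := fun t => if t < A.card then P.Y (r t) + P.H (r t) else 0) (fun t _ => by
      split_ifs with h
      · have := P.right _ (hA (hr t h))
        have := P.top _ (hA (hr t h))
        omega
      · omega)
  refine ⟨c, hc, fun x hx => ?_⟩
  rw [hcont x]
  conv_rhs => rw [← himg]
  rw [Layout.env, Finset.sup_image]
  refine le_antisymm (Finset.sup_le fun t _ => ?_) (Finset.sup_le fun t ht => ?_)
  · split_ifs with h3 h4 h5
    · refine le_trans ?_ (Finset.le_sup (b := t) (Finset.mem_range.2 h3))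
      rw [Function.comp, if_pos (by unfold Layout.Touch; omega)]
    · exact Nat.zero_le _
    · exact Nat.zero_le _
    · exact Nat.zero_le _
  · have ht := Finset.mem_range.1 ht
    rw [Function.comp]
    split_ifs with h3
    · refine le_trans ?_ (Finset.le_sup (b := t) (Finset.mem_range.2 (by omega)))
      unfold Layout.Touch at h3
      rw [if_pos ht, if_pos ht, if_pos ht, if_pos (by omega)]
    · exact Nat.zero_le _

/-- If the items admit a packing of size `k`, then some guess leads to a packing of size `J`,
where `J` is so small that it is not affected by the deletions in the decomposition of the given
packing. -/
theorem exists_guess {P : Layout} (h1 : P.N₁ = Q.N₁) (h2 : P.N₂ = Q.N₂) (hpos : 0 < P.N₁)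
    (hS : ∀ i ∈ P.S, i < Q.n ∧ P.W i = Q.w i ∧ P.H i = Q.h i) (hk : P.S.card = Q.k)
    (hk0 : 0 < Q.k) (hT : 0 < Q.T) (hg : Q.g = 1 ∨ 0 < Q.g ∧ Q.g * (Q.k + 2) ≤ P.ρ)
    (hbi : Q.bi = Q.n + Q.N₁ + Q.N₂ + 1) (hbo : Q.bo = Q.k * Q.k + Q.N₁ / Q.g + 3)
    (hB : Q.Bc = Q.bi ^ (3 * Q.T)) (hJ : ∀ r, Q.T * Q.k ≤ Q.T * r + 5 * Q.k → Q.J ≤ r) :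
    ∃ Γ < Q.Bo, (Q.guess Γ).Path Q.Bv 0 := by
  classical
  have hg0 : 0 < Q.g := by omega
  obtain ⟨R, E, hRS, hcard, hE, hER, hcl⟩ := P.exists_decomposition hT hpos
  rw [hk] at hcard
  obtain ⟨R', hR'R, hR'J⟩ := Finset.exists_subset_card_eq (hJ _ hcard)
  obtain ⟨r, hr, hr'⟩ := exists_enumeration (fun i => P.base E i * (P.N₂ + 1) + P.Y i) hR'J
  have hrR : ∀ i < Q.J, r i ∈ R := fun i hi => hR'R (hr i hi)
  have hrS : ∀ i < Q.J, r i ∈ P.S := fun i hi => hRS (hrR i hi)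
  obtain ⟨i₀, hi₀⟩ : P.S.Nonempty := Finset.card_pos.1 (by omega)
  have hn : 0 < Q.n := (Nat.zero_le _).trans_lt (hS i₀ hi₀).1
  obtain ⟨p, a, hp, ha, hinj⟩ := exists_hash (fun i hi => (hS i hi).1) hk hn
  -- the slots are sorted by their sets in the decomposition, and in each set by their heights
  have hkey : ∀ i < Q.J, ∀ i' < i, P.base E (r i') ≤ P.base E (r i) ∧
      (P.base E (r i') = P.base E (r i) → P.Y (r i') ≤ P.Y (r i)) := by
    intro i hi i' hi'
    have h3 := (hr' i hi i' hi').2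
    have h4 := P.top _ (hrS i hi)
    refine ⟨?_, fun he => ?_⟩
    · have : P.base E (r i') * (P.N₂ + 1) < (P.base E (r i) + 1) * (P.N₂ + 1) := by
        rw [add_mul, one_mul]
        omega
      exact Nat.le_of_lt_succ (lt_of_mul_lt_mul_right this (Nat.zero_le _))
    · rw [he] at h3
      omega
  let Z : ℕ → Finset ℕ := fun b => {i ∈ R | P.base E i = b}
  have hround : ∀ b, ∃ ξ κ : ℕ → ℕ, (Z b).card ≤ Q.T * Q.T ∨ ∀ i ∈ Z b,
      (P.W i ≤ Q.g * κ i ∧ P.X i ≤ Q.g * ξ i + P.ρ ∧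
        Q.g * ξ i + Q.g * κ i ≤ P.X i + P.W i + P.ρ ∧ Q.g * ξ i + Q.g * κ i ≤ P.N₁) ∧
      ∀ j ∈ Z b, i ≠ j → Q.g * ξ i + Q.g * κ i ≤ Q.g * ξ j ∨ Q.g * ξ j + Q.g * κ j ≤ Q.g * ξ i ∨
        P.Y i + P.H i ≤ P.Y j ∨ P.Y j + P.H j ≤ P.Y i := by
    intro b
    rcases hcl b with h | h
    · exact ⟨fun _ => 0, fun _ => 0, .inl h⟩
    · have hZS : Z b ⊆ P.S := (Finset.filter_subset _ _).trans hRS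
      obtain ⟨ξ, κ, h3⟩ := h.exists_rounding hZS hg ((Finset.card_le_card hZS).trans hk.le)
      exact ⟨ξ, κ, .inr h3⟩
  choose ξ κ hround using hround
  have hcode : ∀ b, ∃ c < Q.Bc, (b = 0 → c = 0) ∧
      (b = 0 ∨ b ∈ E → ∀ x < P.N₁, Q.cont c x = P.env (P.level b) x) := by
    intro b
    have hBpos : 0 < Q.Bc := by
      rw [hB]
      exact Nat.pow_pos (by omega)
    by_cases h0 : b = 0
    · refine ⟨0, hBpos, fun _ => rfl, fun _ x _ => ?_⟩
      rw [cont_zero, h0]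
      rfl
    · by_cases hbE : b ∈ E
      · obtain ⟨A, hA, hAT, hAe⟩ := hE b hbE
        obtain ⟨c, hc, hcx⟩ := exists_contour_env hB hbi h1 h2 hA hAT
        exact ⟨c, hc, fun h => absurd h h0, fun _ x hx => (hcx x hx).trans (hAe x hx)⟩
      · exact ⟨0, hBpos, fun _ => rfl, fun h => absurd h (by tauto)⟩
  choose code hcode0 hcode1 hcode2 using hcode
  obtain ⟨ct, hct, hctx⟩ := exists_contour (Q := Q) hB (A := fun _ => 0) (B := fun _ => Q.N₁)
    (C := fun _ => Q.N₂) fun t _ => by omega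
  have hctx' : ∀ x < P.N₁, Q.cont ct x = P.N₂ := by
    intro x hx
    rw [hctx, h2]
    refine le_antisymm (Finset.sup_le fun t _ => ?_) ?_
    · split_ifs <;> omega
    · refine le_trans ?_ (Finset.le_sup (b := 0) (Finset.mem_range.2 hT))
      rw [if_pos (by omega)]
  -- the set of the item in slot `i`, the columns that are reserved for it, and the contours
  let b : ℕ → ℕ := fun i => P.base E (r i)
  let lo : ℕ → ℕ := fun i => if (Z (b i)).card ≤ Q.T * Q.T then P.X (r i) else Q.g * ξ (b i) (r i)
  let le : ℕ → ℕ := fun i => if (Z (b i)).card ≤ Q.T * Q.T then P.W (r i) else Q.g * κ (b i) (r i)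
  let c : ℕ → ℕ := fun j => if j = 0 then 0 else if j < Q.J then code (b j) else ct
  -- the properties of the slots, and the guess that encodes them
  let D : ℕ → ℕ → ℕ := fun f i =>
    if f = 0 then a * r i % p % (Q.k * Q.k)
    else if f = 1 then (if (Z (b i)).card ≤ Q.T * Q.T then 0 else κ (b i) (r i))
    else if f = 2 then (if (Z (b i)).card ≤ Q.T * Q.T then 0 else ξ (b i) (r i))
    else if f = 3 then (if (Z (b i)).card ≤ Q.T * Q.T then 1 else 0)
    else if 0 < i ∧ b (i - 1) ≠ b i then 1 else 0
  have hrZ : ∀ i < Q.J, r i ∈ Z (b i) := fun i hi => Finset.mem_filter.2 ⟨hrR i hi, rfl⟩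
  have hD : ∀ f, ∀ i < Q.J, D f i < Q.bo := by
    intro f i hi
    have hkk : 0 < Q.k * Q.k := Nat.mul_pos hk0 hk0
    have h3 := Nat.mod_lt (a * r i % p) hkk
    have h4 : ¬(Z (b i)).card ≤ Q.T * Q.T →
        κ (b i) (r i) ≤ Q.N₁ / Q.g ∧ ξ (b i) (r i) ≤ Q.N₁ / Q.g := by
      intro hc
      obtain ⟨-, -, -, h5⟩ := ((hround (b i)).resolve_left hc _ (hrZ i hi)).1
      rw [Nat.le_div_iff_mul_le hg0, Nat.le_div_iff_mul_le hg0, mul_comm, mul_comm (ξ _ _)]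
      omega
    rw [hbo]
    simp only [D]
    revert h3 h4
    generalize a * r i % p % (Q.k * Q.k) = u
    generalize Q.k * Q.k = K
    generalize Q.N₁ / Q.g = M
    intro h3 h4
    split_ifs with d0 d1 hc d2 hc d3 hc d4
    all_goals omega
  obtain ⟨G, hG, hGd⟩ := exists_digits (b := Q.bo) (5 * Q.J) (fun l => D (l % 5) (l / 5))
    fun l hl => hD _ _ (by omega)
  let M := 2 * Q.n + 1
  let Γ := p + M * (a + M * G)
  have hM : 0 < M := Nat.succ_pos _
  have g1 : Γ % M = p := by
    rw [Nat.add_mul_mod_self_left, Nat.mod_eq_of_lt hp]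
  have g2 : Γ / M = a + M * G := by
    rw [Nat.add_mul_div_left _ _ hM, Nat.div_eq_of_lt hp, zero_add]
  have g3 : (a + M * G) % M = a := by
    rw [Nat.add_mul_mod_self_left, Nat.mod_eq_of_lt ha]
  have g4 : (a + M * G) / M = G := by
    rw [Nat.add_mul_div_left _ _ hM, Nat.div_eq_of_lt ha, zero_add]
  have hΓ : Γ < Q.Bo := by
    calc Γ < M + M * (a + M * G) := Nat.add_lt_add_right hp _
      _ = M * (a + 1 + M * G) := by ring
      _ ≤ M * (M + M * G) := Nat.mul_le_mul_left _ (Nat.add_le_add_right ha _)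
      _ = M * M * (G + 1) := by ring
      _ ≤ M * M * Q.bo ^ (5 * Q.J) := Nat.mul_le_mul_left _ hG
  have hcolor : ∀ i, (Q.guess Γ).color i = a * i % p % (Q.k * Q.k) := by
    intro i
    change Γ / M % M * i % (Γ % M) % (Q.k * Q.k) = _
    rw [g1, g2, g3]
  have hslot : ∀ f < 5, ∀ i < Q.J, (Q.guess Γ).slot f i = D f i := by
    intro f hf i hi
    change digit Q.bo (Γ / M / M) (5 * i + f) = _
    rw [g2, g4, hGd _ (by omega)]
    congr 1 <;> omega
  have hfree : ∀ i < Q.J, (Q.guess Γ).slot 3 i ≠ 0 ↔ (Z (b i)).card ≤ Q.T * Q.T := by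
    intro i hi
    rw [hslot 3 (by omega) i hi]
    simp [D]
  have hstart : ∀ i < Q.J, (Q.guess Γ).slot 4 i ≠ 0 ↔ 0 < i ∧ b (i - 1) ≠ b i := by
    intro i hi
    rw [hslot 4 (by omega) i hi]
    simp [D]
  have hsame : ∀ j, ∀ i < Q.J, (Q.guess Γ).InSeg j i → ∀ l, j ≤ l → l ≤ i → b l = b j := by
    intro j i hi hseg l
    induction l with
    | zero => intro h3 _; obtain rfl : j = 0 := by omega
              rfl
    | succ l ih =>
      intro h3 h4
      rcases h3.eq_or_lt with h5 | h5
      · rw [h5]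
      · have h6 := hseg.2 (l + 1) (by omega) h5
        rw [hstart _ (by omega)] at h6
        rw [← ih (by omega) (by omega)]
        by_contra hne
        exact h6 ⟨Nat.succ_pos _, by rw [Nat.add_sub_cancel]; exact fun h => hne h.symm⟩
  have hnext : ∀ j < Q.J, (Q.guess Γ).next j < Q.J →
      b j < b ((Q.guess Γ).next j) ∧ j < (Q.guess Γ).next j := by
    intro j hj hlt
    have hjn := (Q.guess Γ).lt_next (j := j) hj
    set e := (Q.guess Γ).next j with he
    have hin : (Q.guess Γ).InSeg j (e - 1) := inSeg_of_lt_next (by omega) (by omega)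
    have hs : (Q.guess Γ).slot 4 e ≠ 0 := by
      intro h0
      have hin' : (Q.guess Γ).InSeg j e := by
        refine ⟨hjn.le, fun l hl hjl => ?_⟩
        rcases Nat.lt_succ_iff_lt_or_eq.1 hl with h | rfl
        · exact hin.2 l (by omega) hjl
        · exact not_not.2 h0
      have : e + 1 ≤ (Q.guess Γ).next j := by
        refine le_trans ?_ (Finset.le_sup (b := e) (Finset.mem_range.2 hlt))
        rw [if_pos hin']
      omega
    have h3 := ((hstart e hlt).1 hs).2
    have h4 := hsame j (e - 1) (by omega) hin (e - 1) (by omega) le_rfl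
    have h5 := (hkey e hlt (e - 1) (by omega)).1
    refine ⟨?_, hjn⟩
    rw [← h4]
    exact lt_of_le_of_ne h5 h3
  have hlo : ∀ i < Q.J, lo i + le i ≤ P.N₁ ∧ P.W (r i) ≤ le i ∧
      ∀ x, lo i ≤ x → x < lo i + le i → P.Touch (r i) x := by
    intro i hi
    have := P.right _ (hrS i hi)
    simp only [lo, le, Layout.Touch]
    split_ifs with hc
    · exact ⟨this, le_rfl, fun x _ _ => by omega⟩
    · obtain ⟨h3, h4, h5, h6⟩ := ((hround (b i)).resolve_left hc _ (hrZ i hi)).1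
      exact ⟨h6, h3, fun x _ _ => by omega⟩
  have hbE : ∀ i, b i = 0 ∨ b i ∈ E := fun i => by
    by_cases h0 : b i = 0
    · exact .inl h0
    · exact .inr (Layout.base_mem h0).1
  have hc1 : ∀ j < Q.J, ∀ x < P.N₁, Q.cont (c j) x ≤ P.env (P.level (b j)) x := by
    intro j hj x hx
    simp only [c]
    split_ifs with h0
    · rw [cont_zero]
      exact Nat.zero_le _
    · rw [hcode2 _ (hbE j) x hx]
  have hc2 : ∀ j < Q.J, ∀ x < P.N₁,
      (b j < b ((Q.guess Γ).next j) ∧ b ((Q.guess Γ).next j) ∈ E ∧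
        Q.cont (c ((Q.guess Γ).next j)) x = P.env (P.level (b ((Q.guess Γ).next j))) x) ∨
      Q.cont (c ((Q.guess Γ).next j)) x = P.N₂ := by
    intro j hj x hx
    rcases lt_or_ge ((Q.guess Γ).next j) Q.J with hlt | hge
    · obtain ⟨h3, h4⟩ := hnext j hj hlt
      left
      refine ⟨h3, (hbE _).resolve_left (by omega), ?_⟩
      simp only [c]
      rw [if_neg (by omega), if_pos hlt, hcode2 _ (hbE _) x hx]
    · right
      simp only [c]
      rw [if_neg (by omega), if_neg (by omega), hctx' x hx]
  have hplan : (Q.guess Γ).Plan r (fun i => P.Y (r i)) lo le c := by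
    constructor
    · exact fun i hi => (hS _ (hrS i hi)).1
    · intro i hi
      rw [hcolor, hslot 0 (by omega) i hi]
      rfl
    · intro i hi i' hi' he
      rw [hslot 0 (by omega) i hi, hslot 0 (by omega) i' (by exact hi'.trans hi)] at he
      exact (hr' i hi i' hi').1 (hinj _ (hrS i' (hi'.trans hi)) _ (hrS i hi) he)
    · intro i hi
      exact (hlo i hi).1.trans h1.le
    · intro i hi
      have h3 := P.top _ (hrS i hi)
      rw [(hS _ (hrS i hi)).2.2] at h3
      exact h3.trans h2.le
    · intro i hi h3
      rw [hfree i hi] at h3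
      have h4 := (hS _ (hrS i hi))
      have h5 := P.right _ (hrS i hi)
      simp only [lo, le, if_pos h3]
      change r i < Q.bi ∧ P.X (r i) < Q.bi ∧ Q.w (r i) ≤ P.W (r i)
      omega
    · intro j i hi hseg h3
      rw [hfree i hi] at h3
      have h4 : (Finset.Icc j i).card ≤ (Z (b i)).card := by
        refine Finset.card_le_card_of_injOn r (fun l hl => ?_) fun l hl l' hl' he => ?_
        · obtain ⟨h5, h6⟩ := Finset.mem_Icc.1 hl
          refine Finset.mem_coe.2 (Finset.mem_filter.2 ⟨hrR l (lt_of_le_of_lt h6 hi), ?_⟩)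
          exact (hsame j i hi hseg l h5 h6).trans (hsame j i hi hseg i hseg.1 le_rfl).symm
        · have h5 := (Finset.mem_Icc.1 hl).2
          have h6 := (Finset.mem_Icc.1 hl').2
          rcases lt_trichotomy l l' with h | h | h
          · exact absurd he (hr' l' (lt_of_le_of_lt h6 hi) l h).1
          · exact h
          · exact absurd he.symm (hr' l (lt_of_le_of_lt h5 hi) l' h).1
      rw [Nat.card_Icc] at h4
      have h5 := hseg.1
      change i - j < Q.T * Q.T
      omega
    · intro i hi h3
      have h4 := (hfree i hi).not.1 (not_not.2 h3)
      obtain ⟨h5, -⟩ := ((hround (b i)).resolve_left h4 _ (hrZ i hi)).1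
      rw [hslot 1 (by omega) i hi, hslot 2 (by omega) i hi]
      simp only [lo, le, D, if_neg h4]
      refine ⟨rfl, ?_, le_rfl⟩
      rw [(hS _ (hrS i hi)).2.1] at h5
      exact h5
    · intro j i hi hseg i' hi' hji' h3 h4
      have hi'J : i' < Q.J := hi'.trans hi
      have e : b i' = b i := (hsame j i hi hseg i' hji' hi'.le).trans
        (hsame j i hi hseg i hseg.1 le_rfl).symm
      have hne := (hr' i hi i' hi').1
      have hy := (hkey i hi i' hi').2 e
      have hh := P.pos _ (hrS i hi)
      have hsep : P.Y (r i') + P.H (r i') ≤ P.Y (r i) ∨ P.Y (r i) + P.H (r i) ≤ P.Y (r i') := by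
        simp only [lo, le, e] at h3 h4
        split_ifs at h3 h4 with hc
        · have := P.sep _ (hrS i' hi'J) _ (hrS i hi) hne
          omega
        · have := ((hround (b i)).resolve_left hc _ (by rw [← e]; exact hrZ i' hi'J)).2 _
            (hrZ i hi) hne
          omega
      have h5 : P.H (r i') = Q.h (r i') := (hS _ (hrS i' hi'J)).2.2
      change P.Y (r i') + Q.h (r i') ≤ P.Y (r i)
      omega
    · intro j
      change c j < Q.Bc
      simp only [c]
      split_ifs
      · exact (Nat.zero_le _).trans_lt hct
      · exact hcode0 _
      · exact hct
    · exact if_pos rfl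
    · intro j i hi hseg x hx1 hx2
      have hj : j < Q.J := lt_of_le_of_lt hseg.1 hi
      obtain ⟨h3, -, h4⟩ := hlo i hi
      have e := hsame j i hi hseg i hseg.1 le_rfl
      refine (hc1 j hj x (by omega)).trans ?_
      rw [← e]
      by_cases h0 : b i = 0
      · rw [h0]
        exact Nat.zero_le _
      · obtain ⟨h5, h6⟩ := Layout.base_mem h0
        exact Layout.env_le_of_notMem (hrS i hi) (hER _ h5 _ (hrR i hi) h6) (by omega)
          (h4 x hx1 hx2)
    · intro j i hi hseg x hx1 hx2
      have hj : j < Q.J := lt_of_le_of_lt hseg.1 hi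
      obtain ⟨h3, -, h4⟩ := hlo i hi
      have e := hsame j i hi hseg i hseg.1 le_rfl
      change P.Y (r i) + Q.h (r i) ≤ Q.cont (c ((Q.guess Γ).next j)) x
      rw [← (hS _ (hrS i hi)).2.2]
      rcases hc2 j hj x (by omega) with ⟨h5, h6, h7⟩ | h5
      · rw [h7]
        rw [← e] at h5
        exact Layout.le_env (Layout.mem_level_of_base_lt h6 h5) (h4 x hx1 hx2)
      · rw [h5]
        exact P.top _ (hrS i hi)
    · intro j hj x hx
      have hx' : x < P.N₁ := by rw [h1]; exact hx
      refine (hc1 j hj x hx').trans ?_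
      change _ ≤ Q.cont (c ((Q.guess Γ).next j)) x
      rcases hc2 j hj x hx' with ⟨h5, h6, h7⟩ | h5
      · rw [h7]
        exact Layout.env_mono (Layout.level_mono h5.le) x
      · rw [h5]
        exact Layout.env_le fun i hi _ => P.top _ (Layout.level_subset _ hi)
  exact ⟨Γ, hΓ, hplan.path hB (show 0 < Q.bi by omega)⟩

end Par

end Knapsack

/-! ### Packings of an instance -/

namespace Knapsack

open RAM

namespace Instance

variable {I : Instance}

theorem placed_subset_box_iff {R : Rectangle} {p : ℤ × ℤ} :
    R.placed p ⊆ I.box ↔ (0 ≤ p.1 ∧ p.1 + R.w ≤ I.N₁) ∧ 0 ≤ p.2 ∧ p.2 + R.h ≤ I.N₂ := by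
  have h1 : (p.1 : ℝ) ≤ p.1 + R.w := by simp
  have h2 : (p.2 : ℝ) ≤ p.2 + R.h := by simp
  rw [Rectangle.placed, Instance.box, Set.prod_subset_prod_iff, Set.Icc_subset_Icc_iff h1,
    Set.Icc_subset_Icc_iff h2, Set.Icc_eq_empty_iff, Set.Icc_eq_empty_iff]
  simp only [h1, h2, not_true, or_false]
  norm_cast

theorem disjoint_placedInterior_iff {R R' : Rectangle} {p p' : ℤ × ℤ} :
    Disjoint (R.placedInterior p) (R'.placedInterior p') ↔ p.1 + R.w ≤ p'.1 ∨ p'.1 + R'.w ≤ p.1 ∨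
      p.2 + R.h ≤ p'.2 ∨ p'.2 + R'.h ≤ p.2 := by
  have h1 := R.w_pos
  have h2 := R.h_pos
  have h3 := R'.w_pos
  have h4 := R'.h_pos
  rw [Rectangle.placedInterior, Rectangle.placedInterior, Set.disjoint_prod, Set.Ioo_disjoint_Ioo,
    Set.Ioo_disjoint_Ioo]
  norm_cast
  omega

theorem minWidth_le (N n : ℕ) (w : ℕ → ℕ) {i : ℕ} (hi : i < n) :
    minWidth N n w ≤ min (w i) (N + 1) := by
  have := Finset.le_sup (f := fun i => N + 1 - min (w i) (N + 1)) (Finset.mem_range.2 hi)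
  rw [minWidth]
  omega

theorem goal_le {p q k T r : ℕ} (hq : 0 < q) (hT : 5 * q ≤ T * p) (hr : T * k ≤ T * r + 5 * k) :
    goal p q k ≤ r := by
  by_contra hc
  have h1 := (lt_ceilDiv_iff hq).1 (not_le.1 hc)
  rcases Nat.eq_zero_or_pos T with rfl | hT0
  · omega
  have hpq : p ≤ q := by
    by_contra hpq
    rw [Nat.sub_eq_zero_of_le (by omega), mul_zero] at h1
    omega
  obtain ⟨d, rfl⟩ := Nat.exists_eq_add_of_le hpq
  rw [Nat.add_sub_cancel_left] at h1
  have h2 := Nat.mul_lt_mul_of_pos_left h1 hT0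
  have h3 := Nat.mul_le_mul_right k hT
  have h4 := Nat.mul_le_mul_right (p + d) hr
  nlinarith

theorem le_steps_mul {p q : ℕ} (hp : 0 < p) : 5 * q ≤ steps p q * p :=
  not_lt.1 fun h => lt_irrefl _ ((lt_ceilDiv_iff hp).2 h)

/-- If there is a packing of size `k`, then the search has a successful guess. -/
theorem HasPackingOfSize.exists_guess {p q : ℕ} (hI : I.HasPackingOfSize I.k) (hp : 0 < p)
    (hq : 0 < q) (hk : 0 < I.k) :
    ∃ Γ < (I.par (steps p q) (goal p q I.k)).Bo, ((I.par (steps p q) (goal p q I.k)).guess Γ).Path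
      (I.par (steps p q) (goal p q I.k)).Bv 0 := by
  obtain ⟨S, pos, hP, hS⟩ := hI
  set Q := I.par (steps p q) (goal p q I.k) with hQ
  let x : ℕ → ℕ := fun i => if hi : i < I.numItems then (pos ⟨i, hi⟩).1.toNat else 0
  let y : ℕ → ℕ := fun i => if hi : i < I.numItems then (pos ⟨i, hi⟩).2.toNat else 0
  have hbox := fun i hi => placed_subset_box_iff.1 (hP.subset_box i hi)
  have hw : ∀ i : Fin I.numItems, Q.w i = min (I.item i).w (I.N₁ + 1) := fun i => by
    change min (I.width i) (I.N₁ + 1) = _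
    simp [width]
  have hh : ∀ i : Fin I.numItems, Q.h i = min (I.item i).h (I.N₂ + 1) := fun i => by
    change min (I.height i) (I.N₂ + 1) = _
    simp [height]
  have hx : ∀ i ∈ S, (x i : ℤ) = (pos i).1 := fun i hi => by
    simp [x, (hbox i hi).1.1]
  have hy : ∀ i ∈ S, (y i : ℤ) = (pos i).2 := fun i hi => by
    simp [y, (hbox i hi).2.1]
  let P : Layout :=
    { N₁ := I.N₁
      N₂ := I.N₂
      ρ := (minWidth I.N₁ I.numItems I.width - 1) / 2
      S := S.map Fin.valEmbedding
      X := x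
      Y := y
      W := Q.w
      H := Q.h
      wide := by
        intro i hi
        obtain ⟨i, mi, rfl⟩ := Finset.mem_map.1 hi
        have h1 : minWidth I.N₁ I.numItems I.width ≤ Q.w i := minWidth_le _ _ _ i.2
        have h2 := (I.item i).w_pos
        have h3 := hw i
        simp only [Fin.valEmbedding_apply]
        omega
      pos := by
        intro i hi
        obtain ⟨i, mi, rfl⟩ := Finset.mem_map.1 hi
        have h2 := (I.item i).h_pos
        have h3 := hh i
        simp only [Fin.valEmbedding_apply]
        omega
      right := by
        intro i hi
        obtain ⟨i, mi, rfl⟩ := Finset.mem_map.1 hi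
        have h1 := hbox i mi
        have h2 := hx i mi
        have h3 := hw i
        simp only [Fin.valEmbedding_apply]
        omega
      top := by
        intro i hi
        obtain ⟨i, mi, rfl⟩ := Finset.mem_map.1 hi
        have h1 := hbox i mi
        have h2 := hy i mi
        have h3 := hh i
        simp only [Fin.valEmbedding_apply]
        omega
      sep := by
        intro i hi j hj hij
        obtain ⟨i, mi, rfl⟩ := Finset.mem_map.1 hi
        obtain ⟨j, mj, rfl⟩ := Finset.mem_map.1 hj
        have h1 := disjoint_placedInterior_iff.1 (hP.no_overlap i mi j mj fun h => hij (h ▸ rfl))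
        have h2 := hx i mi
        have h3 := hx j mj
        have h4 := hy i mi
        have h5 := hy j mj
        have h6 := hw i
        have h7 := hw j
        have h8 := hh i
        have h9 := hh j
        simp only [Fin.valEmbedding_apply]
        omega }
  refine Par.exists_guess (P := P) (Q := Q) rfl rfl I.N₁_pos ?_ ?_ hk ?_ ?_ rfl rfl rfl ?_
  · intro i hi
    obtain ⟨i, hi, rfl⟩ := Finset.mem_map.1 hi
    exact ⟨i.2, rfl, rfl⟩
  · rw [Finset.card_map, hS]
    rfl
  · exact (lt_ceilDiv_iff hp).2 (by omega)
  · change unit I.N₁ I.numItems I.k I.width = 1 ∨ 0 < unit I.N₁ I.numItems I.k I.width ∧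
      unit I.N₁ I.numItems I.k I.width * (I.k + 2) ≤ P.ρ
    rw [unit]
    rcases le_or_gt (P.ρ / (I.k + 2)) 1 with h | h
    · exact .inl (max_eq_left h)
    · rw [max_eq_right h.le]
      exact .inr ⟨by omega, Nat.div_mul_le_self _ _⟩
  · exact fun r hr => goal_le hq (le_steps_mul hp) hr

/-- A solution that is found by the search is a packing. -/
theorem exists_isPacking {T J : ℕ} {s : State} (h0 : s.reg 0 = 1) (h1 : s.reg 1 = J)
    (h : (I.par T J).Solution (s.arr 2) (s.arr 3) (s.arr 4)) :
    ∃ (S : Finset (Fin I.numItems)) (pos : Fin I.numItems → ℤ × ℤ),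
      Returns I s S pos ∧ I.IsPacking S pos ∧ S.card = J := by
  subst h1
  let f : Fin (s.reg 1) → Fin I.numItems := fun j => ⟨s.arr 2 j, h.lt j j.2⟩
  have hf : Function.Injective f := by
    intro j j' hj
    have hv : s.arr 2 j = s.arr 2 j' := congrArg Fin.val hj
    by_contra hne
    rcases lt_or_gt_of_ne (fun h => hne (Fin.ext h) : (j : ℕ) ≠ j') with h2 | h2
    · exact h.ne j' j'.2 j h2 hv
    · exact h.ne j j.2 j' h2 hv.symm
  let e₀ := Equiv.ofInjective f hf
  let e : Fin (s.reg 1) ≃ {i // i ∈ Finset.univ.map ⟨f, hf⟩} :=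
    e₀.trans (Equiv.subtypeEquivRight fun i => by simp)
  have he : ∀ j, (e j : Fin I.numItems) = f j := fun j => rfl
  let pos : Fin I.numItems → ℤ × ℤ := Function.extend f
    (fun j => ((s.arr 3 j : ℤ), (s.arr 4 j : ℤ))) fun _ => (0, 0)
  have hpos : ∀ j, pos (f j) = ((s.arr 3 j : ℤ), (s.arr 4 j : ℤ)) := fun j => hf.extend_apply _ _ j
  have hw : ∀ j : Fin (s.reg 1), (I.par T (s.reg 1)).w (s.arr 2 j) =
      min (I.item (f j)).w (I.N₁ + 1) := fun j => by
    change min (I.width (f j)) (I.N₁ + 1) = _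
    simp [width]
  have hh : ∀ j : Fin (s.reg 1), (I.par T (s.reg 1)).h (s.arr 2 j) =
      min (I.item (f j)).h (I.N₂ + 1) := fun j => by
    change min (I.height (f j)) (I.N₂ + 1) = _
    simp [height]
  have right : ∀ j : Fin (s.reg 1), s.arr 3 j + (I.par T (s.reg 1)).w (s.arr 2 j) ≤ I.N₁ :=
    fun j => h.right j j.2
  have top : ∀ j : Fin (s.reg 1), s.arr 4 j + (I.par T (s.reg 1)).h (s.arr 2 j) ≤ I.N₂ :=
    fun j => h.top j j.2
  refine ⟨Finset.univ.map ⟨f, hf⟩, pos, ⟨h0, e, fun j => ?_⟩, ⟨?_, ?_⟩, by simp⟩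
  · rw [he, hpos]
    exact ⟨rfl, rfl, rfl⟩
  · intro i hi
    obtain ⟨j, -, rfl⟩ := Finset.mem_map.1 hi
    rw [placed_subset_box_iff, Function.Embedding.coeFn_mk, hpos]
    have h1 := right j
    have h2 := top j
    have h3 := hw j
    have h4 := hh j
    dsimp only
    omega
  · intro i hi i' hi' hne
    obtain ⟨j, -, rfl⟩ := Finset.mem_map.1 hi
    obtain ⟨j', -, rfl⟩ := Finset.mem_map.1 hi'
    rw [disjoint_placedInterior_iff]
    simp only [Function.Embedding.coeFn_mk, hpos]
    have h1 := right j
    have h2 := top j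
    have h3 := hw j
    have h4 := hh j
    have h5 := right j'
    have h6 := top j'
    have h7 := hw j'
    have h8 := hh j'
    have hjj : (j : ℕ) ≠ j' := fun h => hne (by rw [Fin.ext h])
    rcases lt_or_gt_of_ne hjj with h9 | h9
    · have := h.sep j' j'.2 j h9
      omega
    · have := h.sep j j.2 j' h9
      omega

theorem exists_isPacking_empty {s : State} (h0 : s.reg 0 = 1) (h1 : s.reg 1 = 0) :
    ∃ (S : Finset (Fin I.numItems)) (pos : Fin I.numItems → ℤ × ℤ),
      Returns I s S pos ∧ I.IsPacking S pos ∧ S.card = 0 :=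
  exists_isPacking (T := 0) h0 h1
    ⟨fun _ h => absurd h (Nat.not_lt_zero _), fun _ h => absurd h (Nat.not_lt_zero _),
      fun _ h => absurd h (Nat.not_lt_zero _), fun _ h => absurd h (Nat.not_lt_zero _),
      fun _ h => absurd h (Nat.not_lt_zero _)⟩

theorem HasPackingOfSize.le_numItems {m : ℕ} (h : I.HasPackingOfSize m) : m ≤ I.numItems := by
  obtain ⟨S, _, _, rfl⟩ := h
  simpa using S.card_le_univ

theorem le_goal {p q k : ℕ} (hq : 0 < q) :
    (1 - (p : ℝ) / q) * k ≤ goal p q k := by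
  have h1 : k * (q - p) ≤ goal p q k * q :=
    not_lt.1 fun h => lt_irrefl _ ((lt_ceilDiv_iff hq).2 h)
  have h2 : k * q ≤ goal p q k * q + k * p := by
    have := Nat.mul_le_mul_left k (show q ≤ (q - p) + p by omega)
    rw [mul_add] at this
    omega
  have hq' : (0 : ℝ) < q := by exact_mod_cast hq
  have h3 : (k : ℝ) * q ≤ goal p q k * q + k * p := by exact_mod_cast h2
  rw [sub_mul, one_mul, div_mul_eq_mul_div, sub_le_iff_le_add, ← sub_le_iff_le_add',
    le_div_iff₀ hq']
  nlinarith

end Instance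

end Knapsack

/-! ### The running time -/

namespace Knapsack

open RAM

namespace Instance

variable {I : Instance}

theorem exists_minWidth_eq (N : ℕ) {n : ℕ} (w : ℕ → ℕ) (hn : 0 < n) :
    ∃ i < n, minWidth N n w = min (w i) (N + 1) := by
  obtain ⟨i, hi, h⟩ := Finset.exists_mem_eq_sup (Finset.range n)
    (Finset.nonempty_range_iff.2 hn.ne') fun i => N + 1 - min (w i) (N + 1)
  refine ⟨i, Finset.mem_range.1 hi, ?_⟩
  rw [minWidth, h]
  omega

/-- The number of rounded lengths is bounded by a multiple of `α`. -/
theorem div_unit_le {α : ℝ} (hα : 1 ≤ α) (hn : 0 < I.numItems)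
    (hw : ∀ i, (I.N₁ : ℝ) / α ≤ (I.item i).w) :
    ((I.N₁ / unit I.N₁ I.numItems I.k I.width : ℕ) : ℝ) ≤ 4 * (I.k + 2) * α := by
  have hα0 : 0 < α := by linarith
  set g := unit I.N₁ I.numItems I.k I.width with hg
  obtain ⟨i, hi, hm⟩ := exists_minWidth_eq I.N₁ I.width hn
  have hgpos : 1 ≤ g := le_max_left _ _
  have h1 : (I.N₁ : ℝ) ≤ minWidth I.N₁ I.numItems I.width * α := by
    rw [hm, ← div_le_iff₀ hα0, Nat.cast_min]
    refine le_min ?_ ?_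
    · have := hw ⟨i, hi⟩
      rwa [width, dif_pos hi]
    · rw [div_le_iff₀ hα0]
      push_cast
      nlinarith [(Nat.cast_nonneg I.N₁ : (0 : ℝ) ≤ I.N₁)]
  have h2 : minWidth I.N₁ I.numItems I.width ≤ 4 * (I.k + 2) * g := by
    have h3 : (minWidth I.N₁ I.numItems I.width - 1) / 2 / (I.k + 2) ≤ g := le_max_right _ _
    rw [← Nat.lt_add_one_iff, Nat.div_lt_iff_lt_mul (by omega)] at h3
    have h4 : (g + 1) * (I.k + 2) ≤ 2 * g * (I.k + 2) := Nat.mul_le_mul_right _ (by omega)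
    have h5 : 4 * (I.k + 2) * g = 2 * (2 * g * (I.k + 2)) := by ring
    omega
  have h6 : (minWidth I.N₁ I.numItems I.width : ℝ) ≤ 4 * (I.k + 2) * g := by exact_mod_cast h2
  refine Nat.cast_div_le.trans ?_
  rw [div_le_iff₀ (by exact_mod_cast hgpos)]
  calc (I.N₁ : ℝ) ≤ minWidth I.N₁ I.numItems I.width * α := h1
    _ ≤ 4 * (I.k + 2) * g * α := mul_le_mul_of_nonneg_right h6 hα0.le
    _ = 4 * (I.k + 2) * α * g := by ring

theorem goal_le_self {p q k : ℕ} (hq : 0 < q) : goal p q k ≤ k := by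
  by_contra hc
  have := (lt_ceilDiv_iff hq).1 (not_le.1 hc)
  exact absurd (Nat.mul_le_mul_left k (Nat.sub_le q p)) (not_le.2 this)

theorem steps_le {p q : ℕ} (hp : 0 < p) (hpq : p < q) : (steps p q : ℝ) ≤ 6 * ((q : ℝ) / p) := by
  have h1 : steps p q * p ≤ 6 * q := (Nat.div_mul_le_self _ _).trans (by omega)
  rw [← mul_div_assoc, le_div_iff₀ (by exact_mod_cast hp)]
  exact_mod_cast h1

/-- The number of steps of a contour is covered by the size of the search space. -/
theorem steps_le_search {T J : ℕ} :
    T ≤ (I.par T J).bi * (I.par T J).Bv * (I.par T J).Bo := by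
  have hbi : (I.par T J).bi = I.numItems + I.N₁ + I.N₂ + 1 := rfl
  have h1 : 0 < (I.par T J).Bo :=
    Nat.mul_pos (Nat.mul_pos (by omega) (by omega)) (Nat.pow_pos (Nat.succ_pos _))
  have h2 : T ≤ (I.par T J).Bv := by
    have hN := I.N₁_pos
    change T ≤ (I.par T J).bi ^ (3 * T + 2 * (T * T))
    calc T ≤ 3 * T + 2 * (T * T) := by omega
      _ ≤ (I.par T J).bi ^ (3 * T + 2 * (T * T)) := (Nat.lt_pow_self (by omega)).le
  exact (h2.trans (Nat.le_mul_of_pos_left _ (by omega))).trans (Nat.le_mul_of_pos_right _ h1)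

/-- The size of the search space: `bi` is polynomial in the number of items and the size of the box,
`Bv` is a power of it with an exponent in `O(T ^ 2)`, and a guess consists of two numbers and of
`5 * J` digits below `bo`, which is at most `(k + L) ^ 4 * α`. -/
theorem search_le {T J : ℕ} {α L : ℝ} (hα : 1 ≤ α) (hk : 0 < I.k) (hkn : I.k ≤ I.numItems)
    (hw : ∀ i, (I.N₁ : ℝ) / α ≤ (I.item i).w) (hT0 : 0 < T) (hT : (T : ℝ) ≤ 6 * L) (hL : 1 ≤ L)
    (hJ : J ≤ I.k) :
    (((I.par T J).bi * (I.par T J).Bv * (I.par T J).Bo : ℕ) : ℝ) ≤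
      (I.k + L) ^ (20 * (I.k + L)) * α ^ (5 * (I.k : ℝ)) *
        (I.numItems * (I.boxSize : ℝ)) ^ (654 * L ^ 2) := by
  have hN1 := I.N₁_pos
  have hN2 := I.N₂_pos
  have hn : 1 ≤ I.numItems := by omega
  set M := I.numItems * I.boxSize with hM
  have hB : I.boxSize = I.N₁ + I.N₂ := rfl
  have m1 : I.numItems * 2 ≤ M := Nat.mul_le_mul_left _ (by omega)
  have m2 : I.boxSize ≤ M := Nat.le_mul_of_pos_left _ hn
  have m3 : 2 * M + 1 ≤ M ^ 3 := by
    have : M * 2 ^ 2 ≤ M * M ^ 2 := Nat.mul_le_mul_left _ (Nat.pow_le_pow_left (by omega) 2)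
    have e : M ^ 3 = M * M ^ 2 := pow_succ' M 2
    omega
  have hM1 : (1 : ℝ) ≤ M := by exact_mod_cast (by omega : 1 ≤ M)
  -- the codes for the segments
  have s1 : (I.par T J).bi * (I.par T J).Bv ≤ M ^ (18 * T ^ 2) := by
    have hbi : (I.par T J).bi = I.numItems + I.N₁ + I.N₂ + 1 := rfl
    have e1 : (I.par T J).bi ≤ M ^ 3 := by omega
    have e2 : 1 + (3 * T + 2 * (T * T)) ≤ 6 * T ^ 2 := by nlinarith
    calc (I.par T J).bi * (I.par T J).Bv
        = (I.par T J).bi ^ (1 + (3 * T + 2 * (T * T))) := by rw [pow_add, pow_one]; rfl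
      _ ≤ (I.par T J).bi ^ (6 * T ^ 2) := Nat.pow_le_pow_right (by omega) e2
      _ ≤ (M ^ 3) ^ (6 * T ^ 2) := Nat.pow_le_pow_left e1 _
      _ = M ^ (18 * T ^ 2) := by rw [← pow_mul]; congr 1; ring
  have s2 : (2 * I.numItems + 1) * (2 * I.numItems + 1) ≤ M ^ 6 := by
    have e1 : 2 * I.numItems + 1 ≤ M ^ 3 := by omega
    calc _ ≤ M ^ 3 * M ^ 3 := Nat.mul_le_mul e1 e1
      _ = M ^ 6 := by ring
  have t1 : (((I.par T J).bi * (I.par T J).Bv *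
      ((2 * I.numItems + 1) * (2 * I.numItems + 1)) : ℕ) : ℝ) ≤ (M : ℝ) ^ (654 * L ^ 2) := by
    have e1 : (((I.par T J).bi * (I.par T J).Bv *
        ((2 * I.numItems + 1) * (2 * I.numItems + 1)) : ℕ) : ℝ) ≤ (M : ℝ) ^ (18 * T ^ 2 + 6) := by
      rw [pow_add]
      exact_mod_cast Nat.mul_le_mul s1 s2
    refine e1.trans ?_
    rw [← Real.rpow_natCast]
    refine Real.rpow_le_rpow_of_exponent_le hM1 ?_
    push_cast
    have : (T : ℝ) ^ 2 ≤ (6 * L) ^ 2 := pow_le_pow_left₀ (Nat.cast_nonneg _) hT 2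
    nlinarith
  -- the guesses for the slots
  have hk1 : (1 : ℝ) ≤ I.k := by exact_mod_cast hk
  set u : ℝ := I.k + L with hu
  have hu2 : 2 ≤ u := by linarith
  have t2 : ((I.par T J).bo : ℝ) ≤ α * u ^ 4 := by
    change ((I.k * I.k + I.N₁ / unit I.N₁ I.numItems I.k I.width + 3 : ℕ) : ℝ) ≤ _
    push_cast
    have e1 := div_unit_le hα hn hw
    have e2 : (I.k : ℝ) * I.k + 4 * (I.k + 2) + 3 ≤ u ^ 4 := by
      have e3 : (I.k : ℝ) ≤ u - 1 := by linarith
      have e4 : (I.k : ℝ) * I.k ≤ (u - 1) * (u - 1) :=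
        mul_le_mul e3 e3 (by linarith) (by linarith)
      have e5 : 4 ≤ u ^ 2 := by nlinarith
      have e6 : 4 * u ^ 2 ≤ u ^ 4 := by nlinarith
      nlinarith
    have e3 : (0 : ℝ) ≤ I.k * I.k + 3 := by positivity
    calc _ ≤ (I.k : ℝ) * I.k + 4 * (I.k + 2) * α + 3 := by linarith
      _ ≤ α * (I.k * I.k + 4 * (I.k + 2) + 3) := by nlinarith
      _ ≤ α * u ^ 4 := mul_le_mul_of_nonneg_left e2 (by linarith)
  have t3 : ((I.par T J).bo : ℝ) ^ (5 * J) ≤ u ^ (20 * u) * α ^ (5 * (I.k : ℝ)) := by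
    have e1 : 1 ≤ α * u ^ 4 := by
      have : 1 ≤ u ^ 4 := one_le_pow₀ (by linarith)
      nlinarith
    calc ((I.par T J).bo : ℝ) ^ (5 * J) ≤ (α * u ^ 4) ^ (5 * J) :=
          pow_le_pow_left₀ (Nat.cast_nonneg _) t2 _
      _ ≤ (α * u ^ 4) ^ (5 * I.k) := pow_le_pow_right₀ e1 (by omega)
      _ = u ^ (20 * I.k) * α ^ (5 * I.k) := by
          rw [mul_pow, ← pow_mul, mul_comm]
          congr 2
          ring
      _ ≤ u ^ (20 * u) * α ^ (5 * (I.k : ℝ)) := by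
          rw [← Real.rpow_natCast, ← Real.rpow_natCast]
          push_cast
          refine mul_le_mul_of_nonneg_right (Real.rpow_le_rpow_of_exponent_le (by linarith) ?_)
            (by positivity)
          linarith
  calc (((I.par T J).bi * (I.par T J).Bv * (I.par T J).Bo : ℕ) : ℝ)
      = (((I.par T J).bi * (I.par T J).Bv *
          ((2 * I.numItems + 1) * (2 * I.numItems + 1)) : ℕ) : ℝ) *
          ((I.par T J).bo : ℝ) ^ (5 * J) := by
        have : (I.par T J).Bo =
          (2 * I.numItems + 1) * (2 * I.numItems + 1) * (I.par T J).bo ^ (5 * J) := rfl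
        rw [this]
        push_cast
        ring
    _ ≤ (M : ℝ) ^ (654 * L ^ 2) * (u ^ (20 * u) * α ^ (5 * (I.k : ℝ))) :=
        mul_le_mul t1 t3 (by positivity) (by positivity)
    _ = _ := by
        rw [mul_comm, hM]
        push_cast
        rfl

/-- The function `u ^ u` is bounded away from `0`; this matters only if `k = 0` and `1 < ε`. -/
theorem exp_neg_le_rpow_mul {u c : ℝ} (hu : 0 < u) (hc : 0 ≤ c) :
    Real.exp (-c) ≤ u ^ (c * u) := by
  rw [Real.rpow_def_of_pos hu, Real.exp_le_exp]
  have h1 := mul_le_mul_of_nonneg_left (Real.one_sub_inv_le_log_of_pos hu) hu.le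
  rw [mul_sub, mul_one, mul_inv_cancel₀ hu.ne'] at h1
  nlinarith

end Instance

end Knapsack

theorem mainTheorem3 :
    ∃ (P : RAM.Prog) (C c : ℝ), 0 < C ∧ 0 < c ∧
      ∀ (p q : ℕ), 0 < p → 0 < q → ∀ ε : ℝ, ε = (p : ℝ) / (q : ℝ) →
      ∀ (I : Knapsack.Instance) (α : ℝ), 1 ≤ α →
        (∀ i, (I.item i).IsWide) →
        (∀ i, (I.N₁ : ℝ) / α ≤ ((I.item i).w : ℝ)) →
        ∃ (s : RAM.State) (t : ℕ), RAM.Exec P (I.input p q) s t ∧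
          ((∃ (S : Finset (Fin I.numItems)) (pos : Fin I.numItems → ℤ × ℤ),
              Knapsack.Returns I s S pos ∧ I.IsPacking S pos ∧
              (1 - ε) * (I.k : ℝ) ≤ (S.card : ℝ)) ∨
            (Knapsack.ReportsNone s ∧ ¬ I.HasPackingOfSize I.k)) ∧
          (t : ℝ) ≤ C * ((I.k : ℝ) + 1 / ε) ^ (c * ((I.k : ℝ) + 1 / ε)) *
            α ^ (c * (I.k : ℝ)) *
            ((max I.numItems 1 : ℝ) * (I.boxSize : ℝ)) ^ (c / ε ^ 2) := by
  obtain ⟨P, d, hP⟩ := Knapsack.exists_program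
  have hc : (0 : ℝ) < 654 * (d + 1) := by positivity
  refine ⟨P, 100 * Real.exp (654 * (d + 1)), 654 * (d + 1), by positivity, hc, ?_⟩
  intro p q hp hq ε hε I α hα _ hw
  obtain ⟨hP1, hP2, hP3⟩ := hP p q hp hq I
  have hp' : (0 : ℝ) < p := by exact_mod_cast hp
  have hq' : (0 : ℝ) < q := by exact_mod_cast hq
  have hε0 : 0 < ε := hε ▸ div_pos hp' hq'
  have hk0 : (0 : ℝ) ≤ I.k := Nat.cast_nonneg _
  have hu : 0 < (I.k : ℝ) + 1 / ε := by positivity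
  have hα1 : 1 ≤ α ^ (654 * ((d : ℝ) + 1) * I.k) := Real.one_le_rpow hα (by positivity)
  have hM : (1 : ℝ) ≤ max (I.numItems : ℝ) 1 * I.boxSize := by
    have h1 : (1 : ℝ) ≤ I.boxSize := by
      exact_mod_cast (Nat.le_add_right_of_le I.N₁_pos : 1 ≤ I.N₁ + I.N₂)
    have h2 : (1 : ℝ) ≤ max (I.numItems : ℝ) 1 := le_max_right _ _
    nlinarith
  have hM1 : 1 ≤ (max (I.numItems : ℝ) 1 * I.boxSize) ^ (654 * ((d : ℝ) + 1) / ε ^ 2) :=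
    Real.one_le_rpow hM (by positivity)
  have hshort : ∀ {t : ℕ}, t ≤ 100 → (t : ℝ) ≤ 100 * Real.exp (654 * (d + 1)) *
      (I.k + 1 / ε) ^ (654 * ((d : ℝ) + 1) * (I.k + 1 / ε)) * α ^ (654 * ((d : ℝ) + 1) * I.k) *
      (max (I.numItems : ℝ) 1 * I.boxSize) ^ (654 * ((d : ℝ) + 1) / ε ^ 2) := by
    intro t ht
    have h1 : (1 : ℝ) ≤ Real.exp (654 * (d + 1)) *
        (I.k + 1 / ε) ^ (654 * ((d : ℝ) + 1) * (I.k + 1 / ε)) := by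
      calc (1 : ℝ) = Real.exp (654 * (d + 1)) * Real.exp (-(654 * (d + 1))) := by
            rw [← Real.exp_add, add_neg_cancel, Real.exp_zero]
        _ ≤ _ := mul_le_mul_of_nonneg_left
            (Knapsack.Instance.exp_neg_le_rpow_mul hu hc.le) (Real.exp_pos _).le
    have h2 := one_le_mul_of_one_le_of_one_le (one_le_mul_of_one_le_of_one_le h1 hα1) hM1
    have h3 : (t : ℝ) ≤ 100 := by exact_mod_cast ht
    linarith
  by_cases htriv : I.k = 0 ∨ q ≤ p
  · obtain ⟨s, t, hs, ht, h0, h1⟩ := hP1 htriv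
    refine ⟨s, t, hs, .inl ?_, hshort ht⟩
    obtain ⟨S, pos, hR, hI, hS⟩ := Knapsack.Instance.exists_isPacking_empty (I := I) h0 h1
    refine ⟨S, pos, hR, hI, ?_⟩
    rw [hS, Nat.cast_zero]
    rcases htriv with h | h
    · rw [h, Nat.cast_zero, mul_zero]
    · refine mul_nonpos_of_nonpos_of_nonneg ?_ hk0
      rw [sub_nonpos, hε, one_le_div hq']
      exact_mod_cast h
  push Not at htriv
  obtain ⟨hk, hpq⟩ := htriv
  have hk : 0 < I.k := Nat.pos_of_ne_zero hk
  rcases lt_or_ge I.numItems I.k with hkn | hkn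
  · obtain ⟨s, t, hs, ht, h0⟩ := hP2 hk hpq hkn
    exact ⟨s, t, hs, .inr ⟨h0, fun h => absurd h.le_numItems (not_le.2 hkn)⟩, hshort ht⟩
  obtain ⟨s, t, hs, ht, hcase⟩ := hP3 hk hpq hkn _ le_rfl Knapsack.Instance.steps_le_search
  refine ⟨s, t, hs, ?_, ?_⟩
  · rcases hcase with ⟨h0, hnone⟩ | ⟨h0, h1, hsol⟩
    · refine .inr ⟨h0, fun h => ?_⟩
      obtain ⟨Γ, hΓ, hpath⟩ := h.exists_guess hp hq hk
      exact hnone Γ hΓ hpath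
    · obtain ⟨S, pos, hR, hI, hS⟩ := Knapsack.Instance.exists_isPacking h0 h1 hsol
      refine .inl ⟨S, pos, hR, hI, ?_⟩
      rw [hS, hε]
      exact Knapsack.Instance.le_goal hq
  · have hL : 1 / ε = (q : ℝ) / p := by rw [hε, one_div_div]
    have hL1 : 1 ≤ 1 / ε := by
      rw [hL, one_le_div hp']
      exact_mod_cast hpq.le
    have hX := Knapsack.Instance.search_le hα hk hkn hw
      ((RAM.lt_ceilDiv_iff hp).2 (by omega))
      (hL ▸ Knapsack.Instance.steps_le hp hpq) hL1 (Knapsack.Instance.goal_le_self (p := p) hq)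
    have hn : max (I.numItems : ℝ) 1 = I.numItems :=
      max_eq_left (by exact_mod_cast hk.trans_le hkn)
    rw [hn] at hM hM1 ⊢
    have hu1 : 1 ≤ (I.k : ℝ) + 1 / ε := by linarith
    have hd : (0 : ℝ) ≤ d := Nat.cast_nonneg _
    have hε2 : (1 / ε) ^ 2 = 1 / ε ^ 2 := by rw [div_pow, one_pow]
    have hε3 : 0 < 1 / ε ^ 2 := by positivity
    have hC : 1 ≤ 100 * Real.exp (654 * (d + 1)) := by
      have := Real.one_le_exp hc.le
      linarith
    refine (Nat.cast_le.2 ht).trans ?_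
    rw [Nat.cast_pow]
    refine (pow_le_pow_left₀ (Nat.cast_nonneg _) hX d).trans ?_
    calc ((I.k + 1 / ε) ^ (20 * (I.k + 1 / ε)) * α ^ (5 * (I.k : ℝ)) *
          (I.numItems * (I.boxSize : ℝ)) ^ (654 * (1 / ε) ^ 2)) ^ d
        = (I.k + 1 / ε) ^ (20 * (I.k + 1 / ε) * d) * α ^ (5 * (I.k : ℝ) * d) *
          (I.numItems * (I.boxSize : ℝ)) ^ (654 * (1 / ε) ^ 2 * d) := by
            rw [mul_pow, mul_pow, Real.rpow_mul_natCast hu.le,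
              Real.rpow_mul_natCast (zero_le_one.trans hα) _ d,
              Real.rpow_mul_natCast (zero_le_one.trans hM)]
      _ ≤ (I.k + 1 / ε) ^ (654 * ((d : ℝ) + 1) * (I.k + 1 / ε)) *
          α ^ (654 * ((d : ℝ) + 1) * I.k) *
          (I.numItems * (I.boxSize : ℝ)) ^ (654 * ((d : ℝ) + 1) / ε ^ 2) := by
        refine mul_le_mul (mul_le_mul (Real.rpow_le_rpow_of_exponent_le hu1 ?_)
          (Real.rpow_le_rpow_of_exponent_le hα ?_) (by positivity) (by positivity))
          (Real.rpow_le_rpow_of_exponent_le hM ?_) (by positivity) (by positivity)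
        · nlinarith
        · nlinarith
        · rw [hε2, div_eq_mul_one_div (654 * ((d : ℝ) + 1))]
          nlinarith
      _ ≤ _ := by
        rw [mul_assoc (100 * _), mul_assoc (100 * _)]
        exact le_mul_of_one_le_left (by positivity) hC
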